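/- **Diversity games.** A diversity game consists of disjoint finite sets $R$ (red agents) and $B$ (blue agents) and, for every agent $i\in N=R\cup B$, a strict linear order $\succ_i$ on $\Theta=\{\frac rs : r\in\{0,\dots,|R|\},\ s\in\{1,\dots,|R|+|B|\}\}$. For a nonempty coalition $S\subseteq N$ put $\theta_R(S)=|S\cap R|/|S|$ and $\theta_B(S)=1-\theta_R(S)$. An agent $i$ strictly prefers a coalition $S$ to a coalition $T$ (both containing $i$) if $\theta_R(S)\succ_i\theta_R(T)$, and weakly prefers $S$ to $T$ if moreover $\theta_R(S)=\theta_R(T)$ is allowed. $S$ is individually rational if every $i\in S$ weakly prefers $S$ to $\{i\}$, and mixed if it contains agents of both colours. For $i\in T$ and $i\notin S$, $i$ has an IS-deviation from $T$ to $S$ if $i$ strictly prefers $S\cup\{i\}$ to $T$ and every $j\in S$ accepts $i$, i.e. weakly prefers $S\cup\{i\}$ to $S$. A partition $\pi$ of $N$ is individually stable if no agent has an IS-deviation from her coalition in $\pi$ to another coalition of $\pi$ or to $\emptyset$. The preferences of $i$ are single-peaked if there is a peak $p_i\in[0,1]$ such that for all $\theta_1,\theta_2\in\Theta$: if $\theta_1<\theta_2\le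 p_i$ or $\theta_1>\theta_2\ge p_i$, then $\theta_2\succ_i\theta_1$. **Subroutine HALF**, for a set $A$ of agents (called red here), a disjoint set $A'$ (called blue here), preferences over the ratio $\theta_A(S)=|S\cap A|/|S|$, and peaks $p_i$. The virtual peak $q_i$ is $i$'s favourite ratio among $x/(x+1)$, $0\le x\le|A|$. Sort the red agents with $p_i\ge\frac12$, and the blue agents with $p_i\ge\frac12$, into two lines by decreasing virtual peak (ties broken arbitrarily). Put $S_0=\emptyset$. 1. As long as both lines are nonempty (for $k=1,2,\dots$), start $S_k=\{b_k\}$ with the next blue agent $b_k$. As long as the next red agent $r$ exists and satisfies $\theta_A(S_k\cup\{r\})\le\min\{q_r,q_{b_k}\}$, or some red agent in $S_k$ has an IS-deviation from $S_k$ to some $S_t$ with $0\le t<k$, do the following: first, next red agents join $S_k$ one by one as long as that inequality holds for them; then, if some red agent in $S_k$ has an IS-deviation to some $S_t$, $0\le t<k$, choose such an agent and such an $S_t$ giving her her most preferred ratio, and move her from $S_k$ to $S_t$. 2. As long as there are a red agent $r$ left in the line and a coalition $S_t$, $t\ge0$, such that $r$ strictly prefers the ratio $\theta_A(S_t\cup\{r\})$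 to $\frac12$ and all agents in $S_t$ accept $r$, choose such an $r$ and such an $S_t$ giving her her most preferred ratio, and let $r$ leave the line and join $S_t$. 3. Return the singletons $\{r\}$, $r\in S_0$, together with $S_1,S_2,\dots$; however, omit the last coalition if it consists of a single blue agent and no red agent is left in the line. **The algorithm.** 1. Let $\pi_R$ be the output of HALF on $(R,B)$ with the given preferences and peaks $p_i$. 2. Let $\pi_B$ be the output of HALF with the roles of the colours exchanged, on the blue and red agents not covered by $\pi_R$, with preferences over blue ratios ($\theta_1$ is preferred to $\theta_2$ iff $1-\theta_1\succ_i1-\theta_2$) and peaks $1-p_i$. 3. Among the agents not yet covered who strictly prefer the ratio $\frac12$ to their own singleton, form mixed pairs of one red and one blue agent, arbitrarily, until one colour is exhausted. 4. For $A=R$ and for $A=B$: as long as there are an uncovered agent $i\in A$ and a mixed $S\in\pi_A$ such that $S\cup\{i\}$ is individually rational and all agents in $S$ accept $i$, choose such an $i$ and such an $S$ giving her her most preferred ratio, and replace $S$ by $S\cup\{i\}$. 5. Put all remaining agents into singletons. The input consists of the lists of red and of blue agents and, for each agent, of the list of all elements of $\Theta$ in the order of her preferences. Running time is counted in elementary steps: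 operations on lists cost at least the number of entries visited, a preference query costs a linear search in the agent's list, and comparison of agents, arithmetic on ratios, table look-up and list access are elementary. **Statement.** Every diversity game in which all agents have single-peaked preferences has an individually stable partition. Moreover, there are absolute constants $C,k\in\mathbb N$ such that, for every such game and every such input, the top element of each agent's list is a peak of this agent, and for all rational peaks $p_i$ given to the algorithm and all ways of making its arbitrary choices, the algorithm terminates within $C(|N|+1)^k$ steps and its output is an individually stable partition of $N$. -/

import Mathlib

/-! ### Diversity games -/

/-- The set `Θ = {r / s : 0 ≤ r ≤ |R|, 1 ≤ s ≤ |R| + |B|}` of ratios. -/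
def ratioSet {α : Type} (R B : Finset α) : Set ℚ :=
  {θ | ∃ r s : ℕ, r ≤ R.card ∧ 1 ≤ s ∧ s ≤ R.card + B.card ∧ θ = (r : ℚ) / s}

/-- A diversity game: disjoint finite sets `R`, `B` of red and blue agents, and for each agent `i`
a strict linear order `pref i` on the set `Θ` of ratios, where `pref i a b` means that `i` prefers
the ratio `a` to the ratio `b`. (The values of `pref i` outside `Θ` and of `pref` at non-agents
carry no information.) -/
structure DiversityGame (α : Type) [DecidableEq α] where
  R : Finset α
  B : Finset α
  disj : Disjoint R B
  pref : α → ℚ → ℚ → Prop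
  irrefl : ∀ i ∈ R ∪ B, ∀ a ∈ ratioSet R B, ¬ pref i a a
  trans : ∀ i ∈ R ∪ B, ∀ a ∈ ratioSet R B, ∀ b ∈ ratioSet R B, ∀ c ∈ ratioSet R B,
    pref i a b → pref i b c → pref i a c
  total : ∀ i ∈ R ∪ B, ∀ a ∈ ratioSet R B, ∀ b ∈ ratioSet R B,
    a ≠ b → pref i a b ∨ pref i b a

namespace DiversityGame

variable {α : Type} [DecidableEq α] (G : DiversityGame α)

/-- The set `N = R ∪ B` of all agents. -/
def agents : Finset α := G.R ∪ G.B

/-- The red ratio `θ_R(S) = |S ∩ R| / |S|` of a coalition. -/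
def redRatio (S : Finset α) : ℚ := ((S ∩ G.R).card : ℚ) / (S.card : ℚ)

/-- Agent `i` strictly prefers the coalition `S` to the coalition `T`. -/
def StrictlyPrefers (i : α) (S T : Finset α) : Prop :=
  G.pref i (G.redRatio S) (G.redRatio T)

/-- Agent `i` weakly prefers the coalition `S` to the coalition `T`. -/
def WeaklyPrefers (i : α) (S T : Finset α) : Prop :=
  G.redRatio S = G.redRatio T ∨ G.pref i (G.redRatio S) (G.redRatio T)

/-- The deviation of `i` from the coalition `T` (containing `i`) to `S` (not containing `i`) is an
IS-deviation: `i` strictly prefers `S ∪ {i}` to `T`, and every member of `S` accepts `i`. -/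
def IsISDeviation (i : α) (T S : Finset α) : Prop :=
  G.StrictlyPrefers i (insert i S) T ∧ ∀ j ∈ S, G.WeaklyPrefers j (insert i S) S

/-- Individual stability of a partition of the set of agents: no agent has an IS-deviation from her
own coalition to another coalition of the partition, or to the empty coalition. -/
def IndividuallyStable (π : Finpartition G.agents) : Prop :=
  ∀ i ∈ G.agents, ∀ T ∈ π.parts, i ∈ T →
    (∀ S ∈ π.parts, S ≠ T → ¬ G.IsISDeviation i T S) ∧ ¬ G.IsISDeviation i T ∅

/-- `p ∈ [0, 1]` is a peak of the preferences of agent `i`. -/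
def IsPeak (i : α) (p : ℝ) : Prop :=
  0 ≤ p ∧ p ≤ 1 ∧ ∀ a ∈ ratioSet G.R G.B, ∀ b ∈ ratioSet G.R G.B,
    ((a < b ∧ (b : ℝ) ≤ p) ∨ (b < a ∧ p ≤ (b : ℝ))) → G.pref i b a

/-- All agents have single-peaked preferences. -/
def SinglePeaked : Prop := ∀ i ∈ G.agents, ∃ p : ℝ, G.IsPeak i p

end DiversityGame

/-! ### Nondeterministic computations with a step budget -/

/-- A computation with result in `β`. It receives a tape `ρ` that resolves the nondeterministic
choices and a number `n` of steps that it may still use, and it returns its result together with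
the number of steps that are left, or `none` if the steps did not suffice (or if it got stuck). -/
def Comp (β : Type) : Type := (ℕ → ℕ) → ℕ → Option (β × ℕ)

namespace Comp

instance : Monad Comp where
  pure b := fun _ n => some (b, n)
  bind c f := fun ρ n => match c ρ n with
    | none => none
    | some (b, m) => f b ρ m

/-- Use up `k` steps. -/
def charge (k : ℕ) : Comp Unit := fun _ n => if k ≤ n then some ((), n - k) else none

/-- Choose an arbitrary element of a list, in one step. The choice is the one that the tape
prescribes for the current number of remaining steps, so each choice of a run is resolved by a tape
entry of its own. A choice from the empty list is stuck. -/
def pick {β : Type} (l : List β) : Comp β := fun ρ n =>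
  match n with
  | 0 => none
  | m + 1 => match l[ρ (m + 1) % l.length]? with
    | none => none
    | some b => some (b, m)

/-- At most `k` rounds of the loop `repeatLoop`. -/
def repeatAtMost {σ : Type} (body : σ → Comp (Option σ)) : ℕ → σ → Comp σ
  | 0, _ => fun _ _ => none
  | k + 1, s => do
    charge 1
    match ← body s with
    | none => return s
    | some s' => repeatAtMost body k s'

/-- The loop that replaces the state `s` by `s'` as long as `body s` returns `some s'`, and that
ends with the state `s` when `body s` returns `none`. Each round costs a step of its own, so that
with `n` steps left there are at most `n` rounds. -/
def repeatLoop {σ : Type} (body : σ → Comp (Option σ)) (s : σ) : Comp σ := fun ρ n =>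
  repeatAtMost body n s ρ n

/-- Is the test positive for all entries of the list? -/
def forAll {β : Type} (test : β → Comp Bool) : List β → Comp Bool
  | [] => do charge 1; return true
  | b :: l => do
    charge 1
    if ← test b then forAll test l else return false

/-- The entries of the list for which the test is positive. -/
def select {β : Type} (test : β → Comp Bool) : List β → Comp (List β)
  | [] => do charge 1; return []
  | b :: l => do
    charge 1
    let l' ← select test l
    if ← test b then return b :: l' else return l'

/-- Apply a computation to all entries of a list. -/
def mapAll {β γ : Type} (f : β → Comp γ) : List β → Comp (List γ)
  | [] => do charge 1; return []
  | b :: l => do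
    charge 1
    let c ← f b
    let l' ← mapAll f l
    return c :: l'

end Comp

/-! ### The algorithm

In all routines below, `A` lists the agents of the type whose ratio is considered ("red" in the
descriptions), and `pref i a b` tests whether agent `i` strictly prefers the ratio `a` to the
ratio `b`. Coalitions are lists of agents without repetitions. Operations on lists are charged at
least with the number of list entries that they visit. Comparing two agents, arithmetic on and
comparison of two ratios (whose numerators and denominators are at most quadratic in the number of
agents), looking up the peak or the ranking of an agent, and accessing a list entry are elementary
operations; each of them is covered by a step that is charged next to it. -/

section Algorithm

open Comp

variable {α : Type} [DecidableEq α]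

/-- The input of the algorithm: lists of the red and of the blue agents, and for each agent the list
of all ratios, from the most preferred to the least preferred one. -/
structure GameInput (α : Type) where
  red : List α
  blue : List α
  ranking : α → List ℚ

/-- `I` is a description of the game `G`. -/
def GameInput.Represents (I : GameInput α) (G : DiversityGame α) : Prop :=
  I.red.Nodup ∧ I.red.toFinset = G.R ∧ I.blue.Nodup ∧ I.blue.toFinset = G.B ∧
    ∀ i ∈ G.agents, (∀ θ : ℚ, θ ∈ I.ranking i ↔ θ ∈ ratioSet G.R G.B) ∧
      (I.ranking i).Pairwise (G.pref i)

/-- Does `i` prefer the ratio `a` to the ratio `b`? (Search for both in the ranking.) -/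
def GameInput.prefers (I : GameInput α) (i : α) (a b : ℚ) : Comp Bool := do
  charge (2 * (I.ranking i).length + 1)
  return decide ((I.ranking i).idxOf a < (I.ranking i).idxOf b)

/-- The preferences over the ratios of the blue agents. -/
def GameInput.prefersBlue (I : GameInput α) (i : α) (a b : ℚ) : Comp Bool :=
  I.prefers i (1 - a) (1 - b)

/-- Is `x` an entry of `l`? -/
def isMember (l : List α) (x : α) : Comp Bool := do
  charge (l.length + 1)
  return decide (x ∈ l)

/-- The ratio `|S ∩ A| / |S|`. -/
def ratioOf (A S : List α) : Comp ℚ := do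
  charge ((S.length + 1) * (A.length + 1))
  return (S.countP (fun x => decide (x ∈ A)) : ℚ) / (S.length : ℚ)

/-- Is the ratio `a` equal to `b` or preferred to `b` by `i`? -/
def weaklyPrefersRatio (pref : α → ℚ → ℚ → Comp Bool) (i : α) (a b : ℚ) : Comp Bool := do
  charge 1
  if a = b then return true else pref i a b

/-- Do all agents in `S` accept a deviation of `i` to `S`? -/
def allAccept (A : List α) (pref : α → ℚ → ℚ → Comp Bool) (i : α) (S : List α) : Comp Bool := do
  let old ← ratioOf A S
  let new ← ratioOf A (i :: S)
  forAll (fun j => weaklyPrefersRatio pref j new old) S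

/-- Is the coalition `S` individually rational? -/
def isRational (A : List α) (pref : α → ℚ → ℚ → Comp Bool) (S : List α) : Comp Bool := do
  let θ ← ratioOf A S
  forAll (fun j => do
    let own ← ratioOf A [j]
    weaklyPrefersRatio pref j θ own) S

/-- Is the coalition `S` mixed? -/
def isMixed (A S : List α) : Comp Bool := do
  charge ((2 * S.length + 1) * (A.length + 1))
  return S.any (fun x => decide (x ∈ A)) && S.any (fun x => decide (x ∉ A))

/-- The virtual peak of `i`: her favourite ratio among the ratios `x / (x + 1)`, `x = 0, …, m`, where
`m` is the number of red agents. -/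
def virtualPeak (pref : α → ℚ → ℚ → Comp Bool) (i : α) : ℕ → Comp ℚ
  | 0 => do charge 1; return 0
  | m + 1 => do
    charge 1
    let q ← virtualPeak pref i m
    let c : ℚ := ((m : ℚ) + 1) / ((m : ℚ) + 2)
    if ← pref i c q then return c else return q

/-- Insert an agent with her virtual peak into a list that is sorted by decreasing virtual peaks;
among agents with equal virtual peaks, her position is arbitrary. -/
def insertAgent (x : α × ℚ) : List (α × ℚ) → Comp (List (α × ℚ))
  | [] => do charge 1; return [x]
  | y :: l => do
    charge 1
    if y.2 < x.2 then return x :: y :: l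
    else if x.2 < y.2 then
      let l' ← insertAgent x l
      return y :: l'
    else if ← pick [true, false] then return x :: y :: l
    else
      let l' ← insertAgent x l
      return y :: l'

/-- Sort agents by decreasing virtual peaks, with ties broken arbitrarily. -/
def sortAgents : List (α × ℚ) → Comp (List (α × ℚ))
  | [] => do charge 1; return []
  | x :: l => do
    charge 1
    let l' ← sortAgents l
    insertAgent x l'

/-- The agents with peak at least `1/2` among the given ones, paired with their virtual peaks and
sorted by decreasing virtual peaks. -/
def lineUp (A : List α) (pref : α → ℚ → ℚ → Comp Bool) (peak : α → ℚ) (agents : List α) :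
    Comp (List (α × ℚ)) := do
  let high ← select (fun i => do charge 1; return decide (1 / 2 ≤ peak i)) agents
  charge (A.length + 1)
  let m := A.length
  let l ← mapAll (fun i => do
    let q ← virtualPeak pref i m
    return (i, q)) high
  sortAgents l

/-- A possible move: an agent, the position in the list of coalitions of the coalition that she
joins, and the resulting ratio. -/
structure Move (α : Type) where
  agent : α
  target : ℕ
  ratio : ℚ

/-- The moves of `i` to a coalition in the list for which the test is positive. The first entry of
the list is at position `t`. -/
def movesOf (A : List α) (test : α → List α → Comp Bool) (i : α) :
    ℕ → List (List α) → Comp (List (Move α))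
  | _, [] => do charge 1; return []
  | t, S :: l => do
    charge 1
    let ms ← movesOf A test i (t + 1) l
    if ← test i S then
      let θ ← ratioOf A (i :: S)
      return ⟨i, t, θ⟩ :: ms
    else return ms

/-- The moves `m` in the list `ms` of all moves of one agent whose ratio is her most preferred one
among these moves. -/
def bestOf (pref : α → ℚ → ℚ → Comp Bool) (ms : List (Move α)) : Comp (List (Move α)) :=
  select (fun m => forAll (fun m' => weaklyPrefersRatio pref m.agent m.ratio m'.ratio) ms) ms

/-- All pairs of one of the given agents and a coalition that is, among the coalitions for which the
test is positive, one with the agent's most preferred ratio after her move. -/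
def bestMoves (A : List α) (pref : α → ℚ → ℚ → Comp Bool) (test : α → List α → Comp Bool)
    (coals : List (List α)) : List α → Comp (List (Move α))
  | [] => do charge 1; return []
  | i :: l => do
    charge 1
    let ms ← movesOf A test i 0 coals
    let best ← bestOf pref ms
    let rest ← bestMoves A pref test coals l
    charge (best.length + 1)
    return best ++ rest

/-- Carry out a move in the list of coalitions. -/
def carryOut (m : Move α) (coals : List (List α)) : Comp (List (List α)) := do
  charge (coals.length + 1)
  return coals.modify m.target (fun S => m.agent :: S)

/-- Remove an agent from a list. -/
def removeAgent (i : α) (l : List α) : Comp (List α) := do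
  charge (l.length + 1)
  return l.erase i

/-- As long as there is an agent among those left, and a coalition in the list, for which the test is
positive: choose such an agent and, among the coalitions for which the test is positive, one that
gives her most preferred ratio, and let the agent join it. -/
def settle (A : List α) (pref : α → ℚ → ℚ → Comp Bool) (test : α → List α → Comp Bool)
    (left : List α) (coals : List (List α)) : Comp (List α × List (List α)) :=
  repeatLoop (fun (s : List α × List (List α)) => do
    let ms ← bestMoves A pref test s.2 s.1
    if ms.isEmpty then return none
    else
      let m ← pick ms
      let coals' ← carryOut m s.2
      let left' ← removeAgent m.agent s.1
      return some (left', coals')) (left, coals)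

/-- Can the first agent of the line join `S`, whose blue agent has virtual peak `qb`, such that the
red ratio does not exceed the minimum of `qb` and her virtual peak? -/
def canJoin (A : List α) (qb : ℚ) (line : List (α × ℚ)) (S : List α) : Comp Bool := do
  charge 1
  match line with
  | [] => return false
  | (r, qr) :: _ =>
    let θ ← ratioOf A (r :: S)
    return decide (θ ≤ min qr qb)

/-- Red agents from the line join `S` one after the other as long as `canJoin` holds. -/
def joinReds (A : List α) (qb : ℚ) (line : List (α × ℚ)) (S : List α) :
    Comp (List (α × ℚ) × List α) :=
  repeatLoop (fun (s : List (α × ℚ) × List α) => do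
    if ← canJoin A qb s.1 s.2 then
      match s.1 with
      | [] => return none
      | (r, _) :: line' => return some (line', r :: s.2)
    else return none) (line, S)

/-- The pairs of a red agent `r` in `S` and a coalition among `coals` to which `r` has an IS-deviation
from `S` that gives her most preferred ratio among the coalitions to which she has one. -/
def bestDeviations (A : List α) (pref : α → ℚ → ℚ → Comp Bool) (S : List α)
    (coals : List (List α)) : Comp (List (Move α)) := do
  let θ ← ratioOf A S
  let reds ← select (isMember A) S
  bestMoves A pref (fun r T => do
    let θ' ← ratioOf A (r :: T)
    if ← pref r θ' θ then allAccept A pref r T else return false) coals reds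

/-- The formation of one new coalition. The state consists of the line of red agents, of the coalition
`S = S_k` under construction, and of the list `coals = [S_0, …, S_{k-1}]`. As long as the next red
agent can join `S`, or a red agent in `S` has an IS-deviation to an earlier coalition: red agents
from the line join `S` while they can; then, if a red agent in `S` has an IS-deviation to an earlier
coalition, one such agent carries out a best one. -/
def formCoalition (A : List α) (pref : α → ℚ → ℚ → Comp Bool) (qb : ℚ)
    (line : List (α × ℚ)) (S : List α) (coals : List (List α)) :
    Comp (List (α × ℚ) × List α × List (List α)) :=
  repeatLoop (fun (s : List (α × ℚ) × List α × List (List α)) => do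
    let join ← canJoin A qb s.1 s.2.1
    let devs ← bestDeviations A pref s.2.1 s.2.2
    if join = false ∧ devs.isEmpty = true then return none
    else
      let (line', S') ← joinReds A qb s.1 s.2.1
      let devs' ← bestDeviations A pref S' s.2.2
      if devs'.isEmpty then return some (line', S', s.2.2)
      else
        let m ← pick devs'
        let coals' ← carryOut m s.2.2
        let S'' ← removeAgent m.agent S'
        return some (line', S'', coals')) (line, S, coals)

/-- The algorithm `HALF`, for the "red" agents `A`, the "blue" agents `A'`, the preferences `pref` over
the ratios of the agents in `A`, and the peaks `peak` of these preferences. -/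
def half (A A' : List α) (pref : α → ℚ → ℚ → Comp Bool) (peak : α → ℚ) :
    Comp (List (List α)) := do
  let reds ← lineUp A pref peak A
  let blues ← lineUp A pref peak A'
  -- the list of coalitions starts with `S_0 = ∅`
  let (line, _, coals) ← repeatLoop
    (fun (s : List (α × ℚ) × List (α × ℚ) × List (List α)) => do
      charge 1
      match s.1, s.2.1 with
      | _ :: _, (b, qb) :: blues' =>
        let (line', S, coals') ← formCoalition A pref qb s.1 [b] s.2.2
        charge (coals'.length + 1)
        return some (line', blues', coals' ++ [S])
      | _, _ => return none) (reds, blues, [[]])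
  charge (line.length + 1)
  let (left, final) ← settle A pref (fun r T => do
    let θ ← ratioOf A (r :: T)
    if ← pref r θ (1 / 2) then allAccept A pref r T else return false) (line.map Prod.fst) coals
  charge 1
  match final with
  | [] => return []
  | S₀ :: mixed =>
    charge ((S₀.length + 1) + (mixed.length + 1))
    match mixed.getLast? with
    | none => return S₀.map (fun r => [r])
    | some S =>
      -- a last coalition that consists of a single blue agent is dropped if no red agent is left
      charge (S.length + 1)
      let onlyBlue ← forAll (fun x => do return !(← isMember A x)) S
      if left = [] ∧ S.length = 1 ∧ onlyBlue = true then
        return S₀.map (fun r => [r]) ++ mixed.dropLast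
      else
        return S₀.map (fun r => [r]) ++ mixed

/-- The agents in `l` who are in none of the given coalitions. -/
def uncovered (l : List α) (coals : List (List α)) : Comp (List α) := do
  charge ((l.length + 1) * (coals.flatten.length + coals.length + 1))
  return l.filter (fun i => decide (i ∉ coals.flatten))

/-- Form mixed pairs of an arbitrary red and an arbitrary blue agent until one of the two lists is
exhausted. -/
def formPairs (reds blues : List α) : Comp (List (List α)) := do
  let s ← repeatLoop (fun (s : List α × List α × List (List α)) => do
    charge 1
    if s.1.isEmpty || s.2.1.isEmpty then return none
    else
      let r ← pick s.1
      let b ← pick s.2.1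
      let reds' ← removeAgent r s.1
      let blues' ← removeAgent b s.2.1
      return some (reds', blues', [r, b] :: s.2.2)) (reds, blues, [])
  return s.2.2

/-- The test of the last phase: `T` is mixed, `T ∪ {i}` is individually rational, and all agents in
`T` accept a deviation of `i` to `T`. -/
def canSettle (A : List α) (pref : α → ℚ → ℚ → Comp Bool) (i : α) (T : List α) : Comp Bool := do
  if ← isMixed A T then
    if ← isRational A pref (i :: T) then allAccept A pref i T else return false
  else return false

/-- The algorithm for an individually stable partition, run on the input `I` with the peaks `peak` of
the preferences over red ratios. -/
def stablePartition (I : GameInput α) (peak : α → ℚ) : Comp (List (List α)) := do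
  -- mixed coalitions with red majority, then mixed coalitions with blue majority
  let πR ← half I.red I.blue I.prefers peak
  let R₁ ← uncovered I.red πR
  let B₁ ← uncovered I.blue πR
  let πB ← half B₁ R₁ I.prefersBlue (fun i => 1 - peak i)
  let R₂ ← uncovered R₁ πB
  let B₂ ← uncovered B₁ πB
  -- mixed pairs of remaining agents who prefer the ratio `1/2` to their own singleton
  let reds ← select (fun r => I.prefers r (1 / 2) 1) R₂
  let blues ← select (fun b => I.prefers b (1 / 2) 0) B₂
  let pairs ← formPairs reds blues
  let R₃ ← uncovered R₂ pairs
  let B₃ ← uncovered B₂ pairs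
  -- remaining agents join mixed coalitions
  let (R₄, πR') ← settle I.red I.prefers (canSettle I.red I.prefers) R₃ πR
  let (B₄, πB') ← settle I.blue I.prefersBlue (canSettle I.blue I.prefersBlue) B₃ πB
  -- all others form singletons
  charge (πR'.length + πB'.length + pairs.length + R₄.length + B₄.length + 1)
  return πR' ++ πB' ++ pairs ++ R₄.map (fun i => [i]) ++ B₄.map (fun i => [i])

end Algorithm

/-! In a coalition of one blue agent and `n - 1` red agents the red ratio is `lad n = 1 - 1 / n`.
Single-peakedness makes the preferences of every agent along this ladder unimodal in the size `n`
(`SinglePeakedRank.unimodal`), with a best size `w i`, her virtual peak. A member of such a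
coalition accepts another red agent only if the enlarged size is still at most her `w`
(`OneBlue.succ_le`). Acceptance thereby becomes arithmetic of sizes.

Inside `half`, a finished mixed coalition `T` with blue agent `b` is saturated (`Proper`): a red
agent `i` who may still move has `w i ≤ |T|`, unless `w b ≤ |T|`. If such an agent joins, then `b`
has accepted her, so `w i ≤ |T|`; the newcomer is past her best size and rejects everybody after her
(`Proper.not_accepts_cons`). Hence a best move opens no new target, harms no member of the coalition
joined, and leaves the mover with her best option, so that stability among red agents survives
(`StableReds.move`). The remaining danger is that members of earlier coalitions envy a later one.
`Secure` assigns to each of them a size `y ≤ w i` whose ratio is no better for her than her present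
one. To beat it, a later coalition would have to accept her into a size above `y`, so all its
members would need virtual peaks above `y`, and `FormFut` says that there are too few of these
(`StableReds.finish`).

The two colours interact little. A red agent of high peak who is not past her virtual peak rejects
every blue agent (`SinglePeakedRank.rejects`), so a mixed coalition built by one run of `half` is
closed to its minority colour (`Configuration.other_rejects`). After the first run, an uncovered red
and an uncovered blue agent cannot both have peak at least `1/2`; after the second run they cannot
both have peak at most `1/2` (`HalfResult.low_peak`). So each pair of the third phase has one member
who rejects red agents and one who rejects blue agents. In the last phase, uncovered agents of low
peak have best size at most `2`, so the saturation argument applies to them too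
(`HalfResult.sideInv`, `SideInv.step`). `Configuration.stable` combines all this for one colour; the
reflection `θ ↦ 1 - θ` gives the other colour.

For the running time, all costs are bounded by powers of `M = |N| + 4`. A sequential composition
raises the exponent by one, a traversal of a list by two, and a loop whose variant is below `M ^ j`
by `j + 1`. Since the program text is fixed, a constant exponent results. The formation of a
coalition terminates because twice the length of the line plus the size of the coalition decreases.
-/

set_option linter.unusedSectionVars false

/-! ### Total correctness with a bound on the number of steps -/

/-- With at least `T` steps left, the computation `c` ends after at most `T` steps, whatever choices
are made, and its result satisfies `Q`. -/
def RunsIn {β : Type} (T : ℕ) (c : Comp β) (Q : β → Prop) : Prop :=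
  ∀ ρ n, T ≤ n → ∃ b m, c ρ n = some (b, m) ∧ n ≤ m + T ∧ Q b

/-- `RunsIn` with the bound `M ^ k`. -/
def Runs {β : Type} (M k : ℕ) (c : Comp β) (Q : β → Prop) : Prop := RunsIn (M ^ k) c Q

theorem RunsIn.mono {β : Type} {T T' : ℕ} {c : Comp β} {Q Q' : β → Prop} (h : RunsIn T c Q)
    (hT : T ≤ T') (hQ : ∀ b, Q b → Q' b) : RunsIn T' c Q' := by
  intro ρ n hn
  obtain ⟨b, m, h1, h2, h3⟩ := h ρ n (hT.trans hn)
  exact ⟨b, m, h1, by omega, hQ b h3⟩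

theorem RunsIn.bind {β γ : Type} {T T' : ℕ} {c : Comp β} {f : β → Comp γ} {Q : β → Prop}
    {P : γ → Prop} (h : RunsIn T c Q) (h' : ∀ b, Q b → RunsIn T' (f b) P) :
    RunsIn (T + T') (c >>= f) P := by
  intro ρ n hn
  obtain ⟨b, m, h1, h2, h3⟩ := h ρ n (by omega)
  obtain ⟨b', m', h1', h2', h3'⟩ := h' b h3 ρ m (by omega)
  refine ⟨b', m', ?_, by omega, h3'⟩
  change (match c ρ n with
    | none => none
    | some (b, m) => f b ρ m) = _
  rw [h1]
  exact h1'

theorem RunsIn.pure {β : Type} {T : ℕ} {b : β} {Q : β → Prop} (h : Q b) :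
    RunsIn T (Pure.pure b : Comp β) Q :=
  fun _ n _ => ⟨b, n, rfl, by omega, h⟩

theorem RunsIn.charge (k : ℕ) : RunsIn k (Comp.charge k) (fun _ => True) :=
  fun _ n hn => ⟨(), n - k, by simp [Comp.charge, hn], by omega, trivial⟩

/-! ### Step bounds that are powers of `M` -/

section Powers

variable {M : ℕ} [hM : Fact (4 ≤ M)] {β γ σ : Type}

theorem one_le_pow_of_fact (M k : ℕ) [hM : Fact (4 ≤ M)] : 1 ≤ M ^ k :=
  Nat.one_le_pow _ _ (by have := hM.out; omega)

theorem four_mul_pow_le (M k : ℕ) [hM : Fact (4 ≤ M)] : 4 * M ^ k ≤ M ^ (k + 1) := by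
  rw [pow_succ, mul_comm]
  exact Nat.mul_le_mul_left _ hM.out

theorem pow_le_pow_of_fact {M k l : ℕ} [hM : Fact (4 ≤ M)] (h : k ≤ l) : M ^ k ≤ M ^ l :=
  Nat.pow_le_pow_right (by have := hM.out; omega) h

theorem Runs.mono {k k' : ℕ} {c : Comp β} {Q Q' : β → Prop} (h : Runs M k c Q)
    (hk : k ≤ k') (hQ : ∀ b, Q b → Q' b) : Runs M k' c Q' :=
  RunsIn.mono h (pow_le_pow_of_fact hk) hQ

theorem Runs.le {k k' : ℕ} {c : Comp β} {Q : β → Prop} (h : Runs M k c Q)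
    (hk : k ≤ k') : Runs M k' c Q := h.mono hk fun _ hb => hb

/-- The sum of two costs `M ^ k` is below `M ^ (k + 1)` because `M ≥ 4`. This crude accounting is
affordable since the program text, and with it the nesting depth, is fixed. -/
theorem Runs.bind {k : ℕ} {c : Comp β} {f : β → Comp γ} {Q : β → Prop} {P : γ → Prop}
    (h : Runs M k c Q) (h' : ∀ b, Q b → Runs M k (f b) P) : Runs M (k + 1) (c >>= f) P :=
  (RunsIn.bind h h').mono (by have := four_mul_pow_le M k; omega) fun _ hb => hb

omit hM in
theorem Runs.pure {k : ℕ} {b : β} {Q : β → Prop} (h : Q b) : Runs M k (Pure.pure b : Comp β) Q :=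
  RunsIn.pure h

omit hM in
theorem Runs.charge {k e : ℕ} (h : e ≤ M ^ k) : Runs M k (Comp.charge e) (fun _ => True) :=
  (RunsIn.charge e).mono h fun _ hb => hb

theorem Runs.charge_bind {k e : ℕ} {c : Unit → Comp γ} {P : γ → Prop} (h : e ≤ M ^ k)
    (hc : Runs M k (c ()) P) : Runs M (k + 1) (Comp.charge e >>= c) P :=
  Runs.bind (Runs.charge h) fun _ _ => hc

/-- Only membership is recorded about the chosen entry. As the tape is universally quantified in
`RunsIn`, everything derived from this holds for all ways of making the choices. -/
theorem Runs.pick {k : ℕ} {l : List β} (h : l ≠ []) : Runs M k (Comp.pick l) (fun b => b ∈ l) := by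
  intro ρ n hn
  have h1 := one_le_pow_of_fact M k
  obtain ⟨m, rfl⟩ : ∃ m, n = m + 1 := ⟨n - 1, by omega⟩
  have hlt : ρ (m + 1) % l.length < l.length := Nat.mod_lt _ (List.length_pos_iff.2 h)
  refine ⟨l[ρ (m + 1) % l.length], m, ?_, by omega, List.getElem_mem _⟩
  simp [Comp.pick, List.getElem?_eq_getElem hlt]

/-- The cost of traversing a list: fewer than `M` rounds of one step plus `M ^ k`, and one step at
the end of the list. -/
theorem mul_pow_add_le {n k : ℕ} (hn : n < M) : n * (M ^ k + 1) + 1 ≤ M ^ (k + 2) := by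
  have h1 := one_le_pow_of_fact M k
  have h2 := four_mul_pow_le M k
  have h3 : (n + 1) * (M ^ k + 1) ≤ M * M ^ (k + 1) := Nat.mul_le_mul hn (by omega)
  rw [← pow_succ'] at h3
  nlinarith

/-- The variant `μ` bounds the number of rounds by `d + 1`, where the last round is the one that
halts. The cap `r` on the number of rounds is not reached because `d < r`. -/
theorem runsIn_repeatAtMost {body : σ → Comp (Option σ)} {T : ℕ} (Inv Post : σ → Prop)
    (μ : σ → ℕ)
    (hbody : ∀ s, Inv s → RunsIn T (body s)
      (fun o => (o = none → Post s) ∧ ∀ s', o = some s' → Inv s' ∧ μ s' < μ s)) :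
    ∀ (d r : ℕ) (s : σ), Inv s → μ s ≤ d → d < r →
      RunsIn ((d + 1) * (T + 1)) (Comp.repeatAtMost body r s) (fun s' => Inv s' ∧ Post s') := by
  intro d
  induction d with
  | zero =>
    intro r s hs hd hr
    obtain ⟨r, rfl⟩ : ∃ r', r = r' + 1 := ⟨r - 1, by omega⟩
    unfold Comp.repeatAtMost
    refine RunsIn.mono (RunsIn.bind (RunsIn.charge 1) fun _ _ =>
      RunsIn.bind (T' := 0) (hbody s hs) fun o ho => ?_) (by omega) fun _ hb => hb
    match o, ho with
    | none, ho => exact RunsIn.pure ⟨hs, ho.1 rfl⟩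
    | some s', ho => exact absurd (ho.2 s' rfl).2 (by omega)
  | succ d ih =>
    intro r s hs hd hr
    obtain ⟨r, rfl⟩ : ∃ r', r = r' + 1 := ⟨r - 1, by omega⟩
    unfold Comp.repeatAtMost
    refine RunsIn.mono (RunsIn.bind (RunsIn.charge 1) fun _ _ =>
      RunsIn.bind (T' := (d + 1) * (T + 1)) (hbody s hs) fun o ho => ?_) (by ring_nf; omega)
      fun _ hb => hb
    match o, ho with
    | none, ho => exact RunsIn.pure ⟨hs, ho.1 rfl⟩
    | some s', ho =>
      obtain ⟨h1, h2⟩ := ho.2 s' rfl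
      exact ih r s' h1 (by omega) (by omega)

theorem Runs.repeatLoop {body : σ → Comp (Option σ)} {k j : ℕ} (Inv Post : σ → Prop)
    (μ : σ → ℕ)
    (hbody : ∀ s, Inv s → Runs M k (body s)
      (fun o => (o = none → Post s) ∧ ∀ s', o = some s' → Inv s' ∧ μ s' < μ s))
    {s : σ} (hs : Inv s) (hμ : μ s < M ^ j) :
    Runs M (k + 1 + j) (Comp.repeatLoop body s) (fun s' => Inv s' ∧ Post s') := by
  intro ρ n hn
  have h1 : (μ s + 1) * (M ^ k + 1) ≤ M ^ (k + 1 + j) := by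
    have := four_mul_pow_le M k
    have := one_le_pow_of_fact M k
    rw [pow_add, mul_comm]
    exact Nat.mul_le_mul (by omega) hμ
  -- `repeatLoop` caps the rounds by the number `n` of steps left; since the step bound exceeds `μ
  -- s`, this cap does not interfere.
  have h2 : μ s < n := by
    have : (μ s + 1) * 1 ≤ (μ s + 1) * (M ^ k + 1) := Nat.mul_le_mul_left _ (by omega)
    omega
  obtain ⟨b, m, h3, h4, h5⟩ := runsIn_repeatAtMost Inv Post μ hbody (μ s) n s hs le_rfl h2 ρ n
    (h1.trans hn)
  exact ⟨b, m, h3, by omega, h5⟩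

theorem Runs.forAll {k : ℕ} {test : β → Comp Bool} {p : β → Prop} {l : List β}
    (h : ∀ b ∈ l, Runs M k (test b) (fun r => r = true ↔ p b)) (hl : l.length < M) :
    Runs M (k + 2) (Comp.forAll test l) (fun r => r = true ↔ ∀ b ∈ l, p b) := by
  refine RunsIn.mono (T := l.length * (M ^ k + 1) + 1) ?_ (mul_pow_add_le hl) fun _ hb => hb
  clear hl
  induction l with
  | nil =>
    exact (RunsIn.bind (T' := 0) (RunsIn.charge 1) fun _ _ => RunsIn.pure (by simp)).mono
      (by simp) fun _ hb => hb
  | cons b l ih =>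
    unfold Comp.forAll
    refine RunsIn.mono (RunsIn.bind (RunsIn.charge 1) fun _ _ =>
      RunsIn.bind (h b (by simp)) (T' := l.length * (M ^ k + 1) + 1) fun r hr => ?_)
      (by simp only [List.length_cons]; ring_nf; omega) fun _ hb => hb
    split
    · next hrt =>
      exact (ih fun b hb => h b (by simp [hb])).mono le_rfl fun r' hr' => by
        rw [hr', List.forall_mem_cons]
        tauto
    · next hrt =>
      exact RunsIn.pure (by rw [List.forall_mem_cons]; simp; tauto)

theorem Runs.select {k : ℕ} {test : β → Comp Bool} {p : β → Prop} [DecidablePred p] {l : List β}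
    (h : ∀ b ∈ l, Runs M k (test b) (fun r => r = true ↔ p b)) (hl : l.length < M) :
    Runs M (k + 2) (Comp.select test l) (fun r => r = l.filter p) := by
  refine RunsIn.mono (T := l.length * (M ^ k + 1) + 1) ?_ (mul_pow_add_le hl) fun _ hb => hb
  clear hl
  induction l with
  | nil =>
    exact (RunsIn.bind (T' := 0) (RunsIn.charge 1) fun _ _ => RunsIn.pure (by simp)).mono
      (by simp) fun _ hb => hb
  | cons b l ih =>
    unfold Comp.select
    refine RunsIn.mono (RunsIn.bind (RunsIn.charge 1) fun _ _ =>
      RunsIn.bind (ih fun b hb => h b (by simp [hb])) fun l' hl' =>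
      RunsIn.bind (T' := 0) (h b (by simp)) fun r hr => ?_)
      (by simp only [List.length_cons]; ring_nf; omega) fun _ hb => hb
    split
    · next hrt => exact RunsIn.pure (by rw [hl', List.filter_cons_of_pos (by simpa using hr.1 hrt)])
    · next hrt =>
      exact RunsIn.pure (by rw [hl', List.filter_cons_of_neg (by simpa using fun h => hrt (hr.2 h))])

theorem Runs.mapAll {k : ℕ} {f : β → Comp γ} {g : β → γ} {l : List β}
    (h : ∀ b ∈ l, Runs M k (f b) (fun r => r = g b)) (hl : l.length < M) :
    Runs M (k + 2) (Comp.mapAll f l) (fun r => r = l.map g) := by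
  refine RunsIn.mono (T := l.length * (M ^ k + 1) + 1) ?_ (mul_pow_add_le hl) fun _ hb => hb
  clear hl
  induction l with
  | nil =>
    exact (RunsIn.bind (T' := 0) (RunsIn.charge 1) fun _ _ => RunsIn.pure (by simp)).mono
      (by simp) fun _ hb => hb
  | cons b l ih =>
    unfold Comp.mapAll
    exact RunsIn.mono (RunsIn.bind (RunsIn.charge 1) fun _ _ =>
      RunsIn.bind (h b (by simp)) fun c hc =>
      RunsIn.bind (T' := 0) (ih fun b hb => h b (by simp [hb])) fun l' hl' =>
        RunsIn.pure (by simp [hc, hl']))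
      (by simp only [List.length_cons]; ring_nf; omega) fun _ hb => hb

omit hM in
theorem succ_mul_succ_le {a b : ℕ} (ha : a < M) (hb : b < M) : (a + 1) * (b + 1) ≤ M ^ 2 := by
  rw [sq]
  exact Nat.mul_le_mul ha hb

end Powers

/-! ### Ratios, acceptance, and the elementary routines -/

section Routines

variable {α : Type} [DecidableEq α] {M : ℕ} [hM : Fact (4 ≤ M)]

/-- The ratio `|S ∩ A| / |S|` for lists. -/
def rat (A S : List α) : ℚ := (S.countP (fun x => decide (x ∈ A)) : ℚ) / (S.length : ℚ)

/-- All members of `S` accept `i`, if agents prefer ratios of smaller rank. -/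
def Accepts (A : List α) (rank : α → ℚ → ℕ) (i : α) (S : List α) : Prop :=
  ∀ j ∈ S, rat A (i :: S) = rat A S ∨ rank j (rat A (i :: S)) < rank j (rat A S)

/-- The preference queries of the agents in `U` are answered correctly according to `rank`. -/
def Decides (M : ℕ) (pref : α → ℚ → ℚ → Comp Bool) (rank : α → ℚ → ℕ) (U : α → Prop) : Prop :=
  ∀ i, U i → ∀ a b, Runs M 3 (pref i a b) (fun r => r = true ↔ rank i a < rank i b)

theorem runs_ratioOf {A S : List α} (hA : A.length < M) (hS : S.length < M) :
    Runs M 3 (ratioOf A S) (fun r => r = rat A S) :=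
  Runs.charge_bind (succ_mul_succ_le hS hA) (Runs.pure rfl)

theorem runs_isMember {l : List α} {x : α} (hl : l.length < M) :
    Runs M 2 (isMember l x) (fun r => r = true ↔ x ∈ l) :=
  Runs.charge_bind (by rw [pow_one]; exact hl) (Runs.pure (by simp))

variable {pref : α → ℚ → ℚ → Comp Bool} {rank : α → ℚ → ℕ} {U : α → Prop}

omit [DecidableEq α] in
theorem runs_weaklyPrefersRatio (h : Decides M pref rank U) {i : α} (hi : U i) (a b : ℚ) :
    Runs M 4 (weaklyPrefersRatio pref i a b) (fun r => r = true ↔ a = b ∨ rank i a < rank i b) := by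
  refine Runs.charge_bind (one_le_pow_of_fact M 3) ?_
  split
  · next hab => exact Runs.pure (by simp [hab])
  · next hab => exact (h i hi a b).mono le_rfl fun r hr => by simp [hr, hab]

theorem runs_allAccept (h : Decides M pref rank U) {A S : List α} {i : α} (hS : ∀ j ∈ S, U j)
    (hA : A.length < M) (hl : S.length + 1 < M) :
    Runs M 8 (allAccept A pref i S) (fun r => r = true ↔ Accepts A rank i S) := by
  refine Runs.bind ((runs_ratioOf hA (by omega)).le (by norm_num)) fun old hold => ?_
  refine Runs.bind ((runs_ratioOf hA (by simpa using hl)).le (by norm_num)) fun new hnew => ?_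
  subst hold hnew
  exact Runs.forAll (fun j hj => runs_weaklyPrefersRatio h (hS j hj) _ _) (by omega)

/-- The list of moves `ms` contains exactly the moves of `i` to those coalitions for which `T` holds. -/
theorem runs_movesOf {A : List α} {test : α → List α → Comp Bool} {T : α → List α → Prop} {k : ℕ}
    (hk : 3 ≤ k) (hA : A.length < M) {i : α} {l : List (List α)}
    (htest : ∀ S ∈ l, S.length + 1 < M ∧ Runs M k (test i S) (fun r => r = true ↔ T i S))
    (hl : l.length < M) (t : ℕ) :
    Runs M (k + 3) (movesOf A test i t l) (fun ms => ms.length ≤ l.length ∧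
      ∀ m, m ∈ ms ↔ ∃ j S, l[j]? = some S ∧ T i S ∧ m = ⟨i, t + j, rat A (i :: S)⟩) := by
  refine RunsIn.mono (T := l.length * (M ^ (k + 1) + 1) + 1) ?_ (mul_pow_add_le hl) fun _ hb => hb
  clear hl
  induction l generalizing t with
  | nil =>
    exact (RunsIn.bind (T' := 0) (RunsIn.charge 1) fun _ _ => RunsIn.pure (by simp)).mono
      (by simp) fun _ hb => hb
  | cons S l ih =>
    unfold movesOf
    have hlist : ∀ m : Move α,
        (∃ j S', (S :: l)[j]? = some S' ∧ T i S' ∧ m = ⟨i, t + j, rat A (i :: S')⟩) ↔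
        (T i S ∧ m = ⟨i, t, rat A (i :: S)⟩) ∨
          ∃ j S', l[j]? = some S' ∧ T i S' ∧ m = ⟨i, t + 1 + j, rat A (i :: S')⟩ := by
      intro m
      constructor
      · rintro ⟨j, S', h1, h2, h3⟩
        cases j with
        | zero =>
          simp only [List.getElem?_cons_zero, Option.some.injEq] at h1
          subst h1
          exact Or.inl ⟨h2, h3⟩
        | succ j => exact Or.inr ⟨j, S', by simpa using h1, h2, by rw [h3]; congr 1; omega⟩
      · rintro (⟨h1, h2⟩ | ⟨j, S', h1, h2, h3⟩)
        · exact ⟨0, S, by simp, h1, h2⟩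
        · exact ⟨j + 1, S', by simpa using h1, h2, by rw [h3]; congr 1; omega⟩
    have hrest : ∀ (b : Bool) (ms : List (Move α)), (b = true ↔ T i S) →
        (ms.length ≤ l.length ∧ ∀ m, m ∈ ms ↔
          ∃ j S', l[j]? = some S' ∧ T i S' ∧ m = ⟨i, t + 1 + j, rat A (i :: S')⟩) →
        Runs M k (if b = true then do
            let θ ← ratioOf A (i :: S)
            Pure.pure ((⟨i, t, θ⟩ : Move α) :: ms)
          else Pure.pure ms) (fun ms => ms.length ≤ (S :: l).length ∧ ∀ m, m ∈ ms ↔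
          ∃ j S', (S :: l)[j]? = some S' ∧ T i S' ∧ m = ⟨i, t + j, rat A (i :: S')⟩) := by
      intro b ms hb hms
      split
      · next hbt =>
        have hT := hb.1 hbt
        refine RunsIn.mono (RunsIn.bind (T' := 0)
          (runs_ratioOf hA (by simpa using (htest S (by simp)).1)) fun θ hθ =>
          RunsIn.pure ⟨by simpa using hms.1, fun m => ?_⟩) (pow_le_pow_of_fact hk) fun _ hb => hb
        rw [hlist, List.mem_cons, hms.2, hθ]
        simp [hT]
      · next hbt =>
        have hT : ¬ T i S := fun h => hbt (hb.2 h)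
        refine Runs.pure ⟨by simpa using hms.1.trans (by omega), fun m => ?_⟩
        rw [hlist, hms.2]
        simp [hT]
    refine RunsIn.mono (RunsIn.bind (RunsIn.charge 1) fun _ _ =>
      RunsIn.bind (ih (fun S hS => htest S (by simp [hS])) (t + 1)) fun ms hms =>
      RunsIn.bind (htest S (by simp)).2 fun b hb => hrest b ms hb hms)
      ?_ fun _ hb => hb
    have := four_mul_pow_le M k
    simp only [List.length_cons]
    rw [Nat.succ_mul]
    omega

omit [DecidableEq α] in
theorem runs_bestOf (h : Decides M pref rank U) {ms : List (Move α)} (hms : ∀ m ∈ ms, U m.agent)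
    (hl : ms.length < M) : Runs M 8 (bestOf pref ms) (fun r => r = ms.filter (fun m => decide
      (∀ m' ∈ ms, m.ratio = m'.ratio ∨ rank m.agent m.ratio < rank m.agent m'.ratio))) :=
  Runs.select (fun m hm => Runs.forAll (fun _ _ => runs_weaklyPrefersRatio h (hms m hm) _ _) hl) hl

/-- `m` is a move of one of the agents in `l` that gives her a most preferred ratio among the coalitions
for which `T` holds. -/
def IsBestMove (A : List α) (rank : α → ℚ → ℕ) (T : α → List α → Prop) (coals : List (List α))
    (l : List α) (m : Move α) : Prop :=
  m.agent ∈ l ∧ ∃ S, coals[m.target]? = some S ∧ T m.agent S ∧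
    ∀ S' ∈ coals, T m.agent S' →
      rank m.agent (rat A (m.agent :: S)) ≤ rank m.agent (rat A (m.agent :: S'))

/-- `rank` distinguishes the ratios that `i` can reach in the coalitions for which `T` holds. -/
def Distinguishes (A : List α) (rank : α → ℚ → ℕ) (T : α → List α → Prop) (coals : List (List α))
    (i : α) : Prop :=
  ∀ S ∈ coals, T i S → ∀ S' ∈ coals, T i S' →
    rank i (rat A (i :: S)) = rank i (rat A (i :: S')) → rat A (i :: S) = rat A (i :: S')

theorem runs_bestMoves (h : Decides M pref rank U) {A : List α} {test : α → List α → Comp Bool}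
    {T : α → List α → Prop} {k : ℕ} (hk : 7 ≤ k) (hA : A.length < M) {coals : List (List α)}
    (hc : coals.length < M) {l : List α} (hl : l.length < M) (hU : ∀ i ∈ l, U i)
    (hinj : ∀ i ∈ l, Distinguishes A rank T coals i)
    (htest : ∀ i ∈ l, ∀ S ∈ coals,
      S.length + 1 < M ∧ Runs M k (test i S) (fun r => r = true ↔ T i S)) :
    Runs M (k + 6) (bestMoves A pref test coals l) (fun ms =>
      (∀ m ∈ ms, IsBestMove A rank T coals l m) ∧
      (ms = [] → ∀ i ∈ l, ∀ S ∈ coals, ¬ T i S)) := by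
  refine RunsIn.mono (T := l.length * (M ^ (k + 4) + 1) + 1) ?_ (mul_pow_add_le hl) fun _ hb => hb
  clear hl
  induction l with
  | nil =>
    exact (RunsIn.bind (T' := 0) (RunsIn.charge 1) fun _ _ => RunsIn.pure (by simp)).mono
      (by simp) fun _ hb => hb
  | cons i l ih =>
    unfold bestMoves
    refine RunsIn.mono (RunsIn.bind (RunsIn.charge 1) fun _ _ =>
      RunsIn.bind (runs_movesOf (T := T) (k := k) (by omega) hA (htest i (by simp)) hc 0) fun ms hms =>
      RunsIn.bind (runs_bestOf h (ms := ms) (fun m hm => ?agent) (by omega)) fun best hbest =>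
      RunsIn.bind (ih (fun i hi => hU i (by simp [hi])) (fun i hi => hinj i (by simp [hi]))
        (fun i hi => htest i (by simp [hi]))) fun rest hrest =>
      RunsIn.bind (T' := 0) (RunsIn.mono (T' := M) (RunsIn.charge _) ?length fun _ hb => hb) fun _ _ =>
      RunsIn.pure ⟨fun m hm => ?best, fun hnil => ?none⟩) ?cost fun _ hb => hb
    case agent =>
      obtain ⟨j, S, h1, h2, h3⟩ := (hms.2 m).1 hm
      rw [h3]
      exact hU i (by simp)
    case length =>
      have : best.length ≤ ms.length := by rw [hbest]; exact List.length_filter_le _ _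
      have := hms.1
      omega
    case best =>
      rcases List.mem_append.1 hm with hm | hm
      · rw [hbest, List.mem_filter] at hm
        obtain ⟨hm, hb⟩ := hm
        obtain ⟨j, S, h1, h2, h3⟩ := (hms.2 m).1 hm
        subst h3
        refine ⟨by simp, S, by simpa using h1, h2, fun S' hS' hT' => ?_⟩
        obtain ⟨j', hj'⟩ := List.mem_iff_getElem?.1 hS'
        have := (of_decide_eq_true hb) ⟨i, 0 + j', rat A (i :: S')⟩ ((hms.2 _).2 ⟨j', S', hj', hT', rfl⟩)
        rcases this with h | h
        · exact (congrArg (rank i) h).le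
        · exact h.le
      · obtain ⟨h1, h2⟩ := hrest.1 m hm
        exact ⟨by simp [h1], h2⟩
    case none =>
      obtain ⟨h1, h2⟩ := List.append_eq_nil_iff.1 hnil
      intro i' hi' S hS hT
      rcases List.mem_cons.1 hi' with rfl | hi'
      · obtain ⟨j, hj⟩ := List.mem_iff_getElem?.1 hS
        have hm0 : (⟨i', 0 + j, rat A (i' :: S)⟩ : Move α) ∈ ms := (hms.2 _).2 ⟨j, S, hj, hT, rfl⟩
        -- A move of minimal rank passes the test in `bestOf`: moves tying with it lead to the same
        -- ratio by `Distinguishes`. So an agent with a move also has a best move, and an empty list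
        -- of best moves means that nobody can move.
        obtain ⟨m, hm, hmin⟩ := Set.exists_min_image {m | m ∈ ms}
          (fun m => rank i' m.ratio) (List.finite_toSet ms) ⟨_, hm0⟩
        have : m ∈ best := by
          rw [hbest, List.mem_filter]
          refine ⟨hm, decide_eq_true fun m' hm' => ?_⟩
          obtain ⟨j1, S1, h11, h12, h13⟩ := (hms.2 m).1 hm
          obtain ⟨j2, S2, h21, h22, h23⟩ := (hms.2 m').1 hm'
          have hle := hmin m' hm'
          subst h13 h23
          rcases hle.lt_or_eq with h | h
          · exact Or.inr h
          · exact Or.inl (hinj i' (by simp) S1 (List.mem_of_getElem? h11) h12 S2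
              (List.mem_of_getElem? h21) h22 h)
        rw [h1] at this
        simp at this
      · exact hrest.2 h2 i' hi' S hS hT
    case cost =>
      have e1 : 4 * M ^ (k + 3) ≤ M ^ (k + 4) := four_mul_pow_le M (k + 3)
      have e2 : M ^ 8 ≤ M ^ (k + 3) := pow_le_pow_of_fact (by omega)
      have e3 : M ^ 1 ≤ M ^ (k + 3) := pow_le_pow_of_fact (by omega)
      rw [pow_one] at e3
      have e4 := one_le_pow_of_fact M (k + 3)
      simp only [List.length_cons]
      rw [Nat.succ_mul]
      omega

omit [DecidableEq α] in
theorem runs_carryOut {m : Move α} {coals : List (List α)} (hc : coals.length < M) :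
    Runs M 2 (carryOut m coals)
      (fun r => r = coals.modify m.target (fun S => m.agent :: S)) :=
  Runs.charge_bind (by rw [pow_one]; exact hc) (Runs.pure rfl)

theorem runs_removeAgent {i : α} {l : List α} (hl : l.length < M) :
    Runs M 2 (removeAgent i l) (fun r => r = l.erase i) :=
  Runs.charge_bind (by rw [pow_one]; exact hl) (Runs.pure rfl)

/-- The loop `settle` preserves every invariant that is preserved by best moves, and it ends only when
no move is possible. -/
theorem runs_settle (h : Decides M pref rank U) {A : List α} {test : α → List α → Comp Bool}
    {T : α → List α → Prop} {k : ℕ} (hk : 7 ≤ k) (hA : A.length < M)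
    (Inv : List α → List (List α) → Prop)
    (hsize : ∀ l coals, Inv l coals → l.length < M ∧ coals.length < M ∧ ∀ i ∈ l, U i ∧
      Distinguishes A rank T coals i ∧
      ∀ S ∈ coals, S.length + 1 < M ∧ Runs M k (test i S) (fun r => r = true ↔ T i S))
    (hstep : ∀ l coals m, Inv l coals → IsBestMove A rank T coals l m →
      Inv (l.erase m.agent) (coals.modify m.target (fun S => m.agent :: S)))
    {left : List α} {coals : List (List α)} (h0 : Inv left coals) :
    Runs M (k + 12) (settle A pref test left coals)
      (fun s => Inv s.1 s.2 ∧ ∀ i ∈ s.1, ∀ S ∈ s.2, ¬ T i S) := by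
  refine Runs.le (Runs.repeatLoop (k := k + 10) (j := 1) (σ := List α × List (List α)) (fun s => Inv s.1 s.2)
    (fun s => ∀ i ∈ s.1, ∀ S ∈ s.2, ¬ T i S) (fun s => s.1.length) (fun s hs => ?_) h0
    (by rw [pow_one]; exact (hsize _ _ h0).1)) (by omega)
  obtain ⟨h1, h2, h3⟩ := hsize _ _ hs
  refine Runs.bind (k := k + 9) (Runs.le (runs_bestMoves h hk hA h2 h1 (fun i hi => (h3 i hi).1)
    (fun i hi => (h3 i hi).2.1) (fun i hi => (h3 i hi).2.2)) (by omega)) fun ms hms => ?_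
  split
  · next hnil => exact Runs.pure ⟨fun _ => hms.2 (by simpa using hnil), by simp⟩
  · next hnil =>
    refine Runs.bind (k := k + 8) (Runs.pick (by simpa using hnil)) fun m hm => ?_
    refine Runs.bind (k := k + 7) ((runs_carryOut h2).le (by omega)) fun c hc => ?_
    refine Runs.bind (k := k + 6) ((runs_removeAgent h1).le (by omega)) fun l hl => ?_
    refine Runs.pure ⟨by simp, fun s' hs' => ?_⟩
    have hb := hms.1 m hm
    simp only [Option.some.injEq] at hs'
    subst hs'
    subst hc hl
    refine ⟨hstep _ _ m hs hb, ?_⟩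
    have := List.length_erase_of_mem hb.1
    have := List.length_pos_of_mem hb.1
    simp only
    omega

end Routines

/-! ### Ladders of ratios -/

/-- The ratio `1 - 1 / n` of a coalition of size `n` with exactly one blue agent. -/
def lad (n : ℕ) : ℚ := 1 - 1 / (n : ℚ)

/-- The ratios `x / (x + y)` of the coalitions of `x ≤ a` red and `y ≤ b` blue agents. -/
def ratios (a b : ℕ) : Set ℚ := {θ | ∃ x y : ℕ, x ≤ a ∧ y ≤ b ∧ 0 < x + y ∧ θ = (x : ℚ) / (x + y)}

/-- The order on `Θ` in which ratios of smaller rank are preferred is strict, and single-peaked with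
peak `p`. -/
structure SinglePeakedRank (rank : ℚ → ℕ) (p : ℚ) (Θ : Set ℚ) : Prop where
  inj : Set.InjOn rank Θ
  left : ∀ a ∈ Θ, ∀ b ∈ Θ, a < b → b ≤ p → rank b < rank a
  right : ∀ a ∈ Θ, ∀ b ∈ Θ, b < a → p ≤ b → rank b < rank a

/-- `g` is strictly decreasing on `[1, w]` and strictly increasing on `[w, m]`. -/
structure Unimodal (g : ℕ → ℕ) (w m : ℕ) : Prop where
  le : w ≤ m
  dec : ∀ k n, 1 ≤ k → k < n → n ≤ w → g n < g k
  inc : ∀ k n, w ≤ k → k < n → n ≤ m → g k < g n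

/-- The size at which the best ratio among `lad 1, …, lad (m + 1)` is attained. -/
def vsize (rank : ℚ → ℕ) : ℕ → ℕ
  | 0 => 1
  | m + 1 => if rank (lad (m + 2)) < rank (lad (vsize rank m)) then m + 2 else vsize rank m

theorem vsize_succ (rank : ℚ → ℕ) (m : ℕ) : vsize rank (m + 1) =
    if rank (lad (m + 2)) < rank (lad (vsize rank m)) then m + 2 else vsize rank m := rfl

theorem lad_one : lad 1 = 0 := by norm_num [lad]

theorem lad_two : lad 2 = 1 / 2 := by norm_num [lad]

theorem lad_lt_lad {m n : ℕ} (hm : 1 ≤ m) (h : m < n) : lad m < lad n := by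
  unfold lad
  have : (0 : ℚ) < m := by exact_mod_cast hm
  have h' : (m : ℚ) < n := by exact_mod_cast h
  have := one_div_lt_one_div_of_lt this h'
  linarith

theorem lad_le_lad_iff {m n : ℕ} (hm : 1 ≤ m) (hn : 1 ≤ n) : lad m ≤ lad n ↔ m ≤ n := by
  constructor
  · intro h
    by_contra hlt
    exact absurd (lad_lt_lad hn (not_le.1 hlt)) (not_lt.2 h)
  · intro h
    rcases h.lt_or_eq with h | rfl
    · exact (lad_lt_lad hm h).le
    · exact le_rfl

theorem lad_eq_div (x : ℕ) : lad (x + 1) = (x : ℚ) / (x + 1) := by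
  unfold lad
  have : (x : ℚ) + 1 ≠ 0 := by positivity
  push_cast
  field_simp
  ring

theorem lad_mem_ratios {a b n : ℕ} (hb : 1 ≤ b) (hn : 1 ≤ n) (hna : n ≤ a + 1) :
    lad n ∈ ratios a b := by
  obtain ⟨x, rfl⟩ : ∃ x, n = x + 1 := ⟨n - 1, by omega⟩
  exact ⟨x, 1, by omega, hb, by omega, by rw [lad_eq_div]; simp⟩

theorem one_mem_ratios {a b : ℕ} (ha : 1 ≤ a) : (1 : ℚ) ∈ ratios a b :=
  ⟨1, 0, ha, by omega, by omega, by norm_num⟩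

theorem half_mem_ratios {a b : ℕ} (ha : 1 ≤ a) (hb : 1 ≤ b) : (1 / 2 : ℚ) ∈ ratios a b :=
  ⟨1, 1, ha, hb, by omega, by norm_num⟩

theorem one_le_vsize (rank : ℚ → ℕ) (m : ℕ) : 1 ≤ vsize rank m := by
  induction m with
  | zero => exact le_rfl
  | succ m ih => unfold vsize; split <;> omega

theorem vsize_le (rank : ℚ → ℕ) (m : ℕ) : vsize rank m ≤ m + 1 := by
  induction m with
  | zero => exact le_rfl
  | succ m ih => unfold vsize; split <;> omega

theorem rank_lad_vsize_le (rank : ℚ → ℕ) (m n : ℕ) (hn : 1 ≤ n) (hm : n ≤ m + 1) :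
    rank (lad (vsize rank m)) ≤ rank (lad n) := by
  induction m with
  | zero => obtain rfl : n = 1 := by omega
            exact le_rfl
  | succ m ih =>
    unfold vsize
    rcases Nat.lt_or_ge (m + 1) n with h | h
    · obtain rfl : n = m + 2 := by omega
      split <;> omega
    · have := ih h
      split <;> omega

/-- The sizes left of the optimum `w` have ratios at most `p`: if `lad n` with `n < w` exceeded `p`,
then `lad w` would lie even further right and be worse than `lad n`. Symmetrically on the right.
Steps that end or start at `w` itself are settled by minimality and injectivity of the rank. -/
theorem SinglePeakedRank.unimodal {rank : ℚ → ℕ} {p : ℚ} {a b m : ℕ}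
    (h : SinglePeakedRank rank p (ratios a b)) (hb : 1 ≤ b) (hm : m ≤ a) :
    Unimodal (fun n => rank (lad n)) (vsize rank m) (m + 1) := by
  have h1 := one_le_vsize rank m
  have h2 := vsize_le rank m
  have hmin := rank_lad_vsize_le rank m
  set w := vsize rank m
  have hmem : ∀ n, 1 ≤ n → n ≤ m + 1 → lad n ∈ ratios a b := fun n hn hn' =>
    lad_mem_ratios hb hn (by omega)
  have hne : ∀ n, 1 ≤ n → n ≤ m + 1 → n ≠ w → rank (lad w) < rank (lad n) := by
    intro n hn hn' hnw
    refine lt_of_le_of_ne (hmin n hn hn') fun heq => ?_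
    have := h.inj (hmem w h1 h2) (hmem n hn hn') heq
    rcases lt_or_gt_of_ne hnw with hlt | hlt
    · exact absurd (lad_lt_lad hn hlt) (by rw [this]; exact lt_irrefl _)
    · exact absurd (lad_lt_lad h1 hlt) (by rw [this]; exact lt_irrefl _)
  refine ⟨h2, fun k n hk hkn hn => ?_, fun k n hk hkn hn => ?_⟩
  · rcases hn.lt_or_eq with hnw | rfl
    · by_cases hp : lad n ≤ p
      · exact h.left _ (hmem k hk (by omega)) _ (hmem n (by omega) (by omega)) (lad_lt_lad hk hkn) hp
      · have := h.right _ (hmem w h1 h2) _ (hmem n (by omega) (by omega)) (lad_lt_lad (by omega) hnw)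
          (not_le.1 hp).le
        exact absurd (hmin n (by omega) (by omega)) (by omega)
    · exact hne k hk (by omega) (by omega)
  · rcases hk.lt_or_eq with hwk | rfl
    · by_cases hp : p ≤ lad k
      · exact h.right _ (hmem n (by omega) (by omega)) _ (hmem k (by omega) (by omega))
          (lad_lt_lad (by omega) hkn) hp
      · have := h.left _ (hmem w h1 h2) _ (hmem k (by omega) (by omega)) (lad_lt_lad h1 hwk)
          (not_le.1 hp).le
        exact absurd (hmin k (by omega) (by omega)) (by omega)
    · exact hne n (by omega) (by omega) (by omega)

/-- A peak at least `1/2 = lad 2` makes `lad 2` better than `lad 1`. Hence a red and a blue agent of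
high peak are always willing to start a coalition together. -/
theorem SinglePeakedRank.two_le_vsize {rank : ℚ → ℕ} {p : ℚ} {a b m : ℕ}
    (h : SinglePeakedRank rank p (ratios a b)) (hb : 1 ≤ b) (hm : m ≤ a) (hm1 : 1 ≤ m)
    (hp : 1 / 2 ≤ p) : 2 ≤ vsize rank m := by
  have hu := h.unimodal hb hm
  by_contra hlt
  have h1 := hu.inc 1 2 (by omega) (by omega) (by omega)
  have h2 := h.left _ (lad_mem_ratios hb (n := 1) le_rfl (by omega)) _
    (lad_mem_ratios hb (n := 2) (by omega) (by omega)) (lad_lt_lad le_rfl (by omega))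
    (by rw [lad_two]; exact hp)
  omega

/-- Beyond a peak below `1/2 = lad 2` the ladder only gets worse. An agent of low peak is thus
already saturated by every mixed coalition, which admits her as a free agent in the last phase. -/
theorem SinglePeakedRank.vsize_le_two {rank : ℚ → ℕ} {p : ℚ} {a b m : ℕ}
    (h : SinglePeakedRank rank p (ratios a b)) (hb : 1 ≤ b) (hm : m ≤ a)
    (hp : p < 1 / 2) : vsize rank m ≤ 2 := by
  have hu := h.unimodal hb hm
  by_contra hlt
  have hle := hu.le
  have h1 := hu.dec 2 3 (by omega) (by omega) (by omega)
  have h2 := h.right _ (lad_mem_ratios hb (n := 3) (by omega) (by omega)) _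
    (lad_mem_ratios hb (n := 2) (by omega) (by omega)) (lad_lt_lad (by omega) (by omega))
    (by rw [lad_two]; exact hp.le)
  omega

/-! ### Coalitions with one blue agent -/

section Coalitions

variable {α : Type} [DecidableEq α] {A A' : List α} {rank : α → ℚ → ℕ} {peak : α → ℚ} {w : α → ℕ}

/-- `b` is the only blue agent in the coalition `S`. -/
structure OneBlue (A A' S : List α) (b : α) : Prop where
  nodup : S.Nodup
  mem : b ∈ S
  blue : b ∈ A'
  reds : ∀ j ∈ S, j ≠ b → j ∈ A

/-- Two disjoint lists of agents whose preferences on the ladder of ratios are unimodal. -/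
structure Ladder (A A' : List α) (rank : α → ℚ → ℕ) (w : α → ℕ) : Prop where
  nodup : (A ++ A').Nodup
  uni : A' ≠ [] → ∀ i, i ∈ A ∨ i ∈ A' → Unimodal (fun n => rank i (lad n)) (w i) (A.length + 1)

theorem Ladder.notMem (h : Ladder A A' rank w) {i : α} (hi : i ∈ A) : i ∉ A' :=
  fun hi' => (List.disjoint_of_nodup_append h.nodup) hi hi'

theorem Ladder.notMem' (h : Ladder A A' rank w) {i : α} (hi : i ∈ A') : i ∉ A :=
  fun hi' => (List.disjoint_of_nodup_append h.nodup) hi' hi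

theorem rat_eq_one {S : List α} (hS : S ≠ []) (h : ∀ j ∈ S, j ∈ A) : rat A S = 1 := by
  unfold rat
  rw [List.countP_eq_length.2 (by simpa using h)]
  have : (S.length : ℚ) ≠ 0 := by simpa using hS
  exact div_self this

theorem OneBlue.one_le {S : List α} {b : α} (h : OneBlue A A' S b) : 1 ≤ S.length :=
  List.length_pos_of_mem h.mem

theorem OneBlue.length_le {S : List α} {b : α} (h : OneBlue A A' S b) : S.length ≤ A.length + 1 := by
  have hn := h.nodup.erase b
  have hs : S.erase b ⊆ A := fun j hj => by
    rw [h.nodup.mem_erase_iff] at hj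
    exact h.reds j hj.2 hj.1
  have := (hn.subperm hs).length_le
  have := List.length_erase_of_mem h.mem
  omega

theorem OneBlue.rat_eq (hL : Ladder A A' rank w) {S : List α} {b : α} (h : OneBlue A A' S b) :
    rat A S = lad S.length := by
  have hp := List.perm_cons_erase h.mem
  have h1 : S.countP (fun x => decide (x ∈ A)) = (S.erase b).length := by
    rw [hp.countP_eq, List.countP_cons_of_neg (by simpa using hL.notMem' h.blue),
      List.countP_eq_length]
    intro j hj
    rw [h.nodup.mem_erase_iff] at hj
    simpa using h.reds j hj.2 hj.1
  have h2 := List.length_erase_of_mem h.mem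
  have h3 := h.one_le
  unfold rat
  rw [h1, show S.length = (S.erase b).length + 1 by omega, lad_eq_div]
  push_cast
  rfl

theorem OneBlue.cons {S : List α} {b i : α} (h : OneBlue A A' S b) (hi : i ∈ A) (hiS : i ∉ S) :
    OneBlue A A' (i :: S) b where
  nodup := List.nodup_cons.2 ⟨hiS, h.nodup⟩
  mem := List.mem_cons_of_mem _ h.mem
  blue := h.blue
  reds j hj hjb := by
    rcases List.mem_cons.1 hj with rfl | hj
    · exact hi
    · exact h.reds j hj hjb

theorem OneBlue.rat_cons (hL : Ladder A A' rank w) {S : List α} {b i : α} (h : OneBlue A A' S b)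
    (hi : i ∈ A) (hiS : i ∉ S) : rat A (i :: S) = lad (S.length + 1) := by
  rw [(h.cons hi hiS).rat_eq hL]
  rfl

theorem OneBlue.uni (hL : Ladder A A' rank w) {S : List α} {b j : α} (h : OneBlue A A' S b)
    (hj : j ∈ A ∨ j ∈ A') : Unimodal (fun n => rank j (lad n)) (w j) (A.length + 1) :=
  hL.uni (List.ne_nil_of_mem h.blue) j hj

theorem OneBlue.mem_or {S : List α} {b j : α} (h : OneBlue A A' S b) (hj : j ∈ S) :
    j ∈ A ∨ j ∈ A' := by
  by_cases hjb : j = b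
  · exact Or.inr (hjb ▸ h.blue)
  · exact Or.inl (h.reds j hj hjb)

/-- In terms of ranks: all members of a coalition with one blue agent accept a red agent. -/
theorem OneBlue.accepts_iff (hL : Ladder A A' rank w) {S : List α} {b i : α} (h : OneBlue A A' S b)
    (hi : i ∈ A) (hiS : i ∉ S) : Accepts A rank i S ↔
      ∀ j ∈ S, rank j (lad (S.length + 1)) < rank j (lad S.length) := by
  unfold Accepts
  rw [h.rat_cons hL hi hiS, h.rat_eq hL]
  refine forall₂_congr fun j _ => or_iff_right ?_
  exact (lad_lt_lad h.one_le (Nat.lt_succ_self _)).ne'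

/-- Past the virtual peak the ladder gets strictly worse, so an accepting member must still be below
it. Almost all uses of acceptance go through this inequality. -/
theorem OneBlue.succ_le (hL : Ladder A A' rank w) {S : List α} {b i : α} (h : OneBlue A A' S b)
    (hi : i ∈ A) (hiS : i ∉ S) (hacc : Accepts A rank i S) {j : α} (hj : j ∈ S) :
    S.length + 1 ≤ w j := by
  have h1 := (h.accepts_iff hL hi hiS).1 hacc j hj
  have h2 := h.uni hL (h.mem_or hj)
  have h3 := (h.cons hi hiS).length_le
  by_contra hlt
  have := h2.inc S.length (S.length + 1) (by omega) (by omega) h3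
  omega

/-- A coalition with one blue agent of high peak and some red agent of high peak, none of whom is
beyond her virtual peak, such that no agent in `free` could join without exceeding her own virtual
peak or that of the blue agent. -/
def Proper (A A' : List α) (peak : α → ℚ) (w : α → ℕ) (free : α → Prop) (S : List α) : Prop :=
  ∃ b, OneBlue A A' S b ∧ 1 / 2 ≤ peak b ∧ S.length ≤ w b ∧
    (∃ r ∈ S, r ∈ A ∧ 1 / 2 ≤ peak r ∧ S.length ≤ w r) ∧
    ∀ r, free r → w r ≤ S.length ∨ w b ≤ S.length

/-- The coalitions in the list are sets of red agents or proper, and no red agent in one of them has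
an IS-deviation to another one or to her own singleton. -/
structure StableReds (A A' : List α) (rank : α → ℚ → ℕ) (peak : α → ℚ) (w : α → ℕ)
    (free : α → Prop) (coals : List (List α)) : Prop where
  kind : ∀ S ∈ coals, (∀ j ∈ S, j ∈ A) ∨ Proper A A' peak w free S
  rational : ∀ S ∈ coals, ∀ i ∈ S, i ∈ A → rank i (rat A S) ≤ rank i 1
  stable : ∀ S ∈ coals, ∀ i ∈ S, i ∈ A → ∀ T ∈ coals, i ∉ T → Accepts A rank i T →
    rank i (rat A S) ≤ rank i (rat A (i :: T))

theorem StableReds.mono {free free' : α → Prop} {coals : List (List α)}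
    (h : StableReds A A' rank peak w free coals) (hf : ∀ i, free' i → free i) :
    StableReds A A' rank peak w free' coals where
  kind S hS := (h.kind S hS).imp id fun ⟨b, h1, h2, h3, h4, h5⟩ =>
    ⟨b, h1, h2, h3, h4, fun r hr => h5 r (hf r hr)⟩
  rational := h.rational
  stable := h.stable

theorem mem_modify_cons {i : α} {t : ℕ} {T S : List α} {coals : List (List α)}
    (hT : coals[t]? = some T) (hS : S ∈ coals.modify t (fun S => i :: S)) :
    S ∈ coals ∨ S = i :: T := by
  obtain ⟨n, hn⟩ := List.mem_iff_getElem?.1 hS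
  rw [List.getElem?_modify] at hn
  split at hn
  · next htn =>
    subst htn
    rw [hT] at hn
    exact Or.inr (by simpa using hn.symm)
  · rw [id_map'] at hn
    exact Or.inl (List.mem_of_getElem? hn)

/-- Acceptance puts the new size below the virtual peaks of `b` and of the witness `r`. It also
rules out the alternative `w b ≤ |T|`, so every free agent satisfies `w r ≤ |T|`, which persists
when the size grows. -/
theorem Proper.accept_cons (hL : Ladder A A' rank w) {free free' : α → Prop} {T : List α} {i : α}
    (h : Proper A A' peak w free T) (hi : i ∈ A) (hiT : i ∉ T)
    (hacc : Accepts A rank i T) (hf : ∀ j, free' j → free j) :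
    Proper A A' peak w free' (i :: T) := by
  obtain ⟨b, h1, h2, h3, ⟨r, hr, hrA, hrp, hrw⟩, h5⟩ := h
  have hs := fun j hj => h1.succ_le hL hi hiT hacc (j := j) hj
  refine ⟨b, h1.cons hi hiT, h2, hs b h1.mem, ⟨r, by simp [hr], hrA, hrp, hs r hr⟩, fun r hr => ?_⟩
  rcases h5 r (hf r hr) with h | h
  · left
    simp only [List.length_cons]
    omega
  · have := hs b h1.mem
    omega

/-- After a free agent has joined a proper coalition, the coalition does not accept anyone else. -/
theorem Proper.not_accepts_cons (hL : Ladder A A' rank w) {free : α → Prop} {T : List α} {i j : α}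
    (h : Proper A A' peak w free T) (hi : i ∈ A) (hiT : i ∉ T) (hacc : Accepts A rank i T)
    (hfree : free i) (hj : j ∈ A) (hjT : j ∉ i :: T) : ¬ Accepts A rank j (i :: T) := by
  obtain ⟨b, h1, -, -, -, h5⟩ := h
  intro hacc'
  -- Acceptance of `i` by `b` gives `|T| + 1 ≤ w b`, so freeness of `i` leaves `w i ≤ |T|`. If `i`
  -- accepted `j`, then `|T| + 2 ≤ w i`.
  have h6 := (h1.cons hi hiT).succ_le hL hj hjT hacc' (j := i) (by simp)
  have h7 := h1.succ_le hL hi hiT hacc h1.mem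
  have h8 := h5 i hfree
  simp only [List.length_cons] at h6
  omega

/-- The invariant is preserved if a free agent makes a best move. -/
theorem StableReds.move (hL : Ladder A A' rank w) {free free' : α → Prop} {coals : List (List α)}
    (h : StableReds A A' rank peak w free coals) (hf : ∀ j, free' j → free j) {i : α}
    (hi : i ∈ A) (hfree : free i) (hnot : ∀ S ∈ coals, i ∉ S) {t : ℕ} {T : List α}
    (hT : coals[t]? = some T) (hacc : Accepts A rank i T)
    (hrat : rank i (rat A (i :: T)) ≤ rank i 1)
    (hbest : ∀ T' ∈ coals, Accepts A rank i T' →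
      rank i (rat A (i :: T)) ≤ rank i (rat A (i :: T'))) :
    StableReds A A' rank peak w free' (coals.modify t (fun S => i :: S)) := by
  have hTm := List.mem_of_getElem? hT
  have hiT := hnot T hTm
  have himp : ∀ j ∈ T, rank j (rat A (i :: T)) ≤ rank j (rat A T) := fun j hj => by
    rcases hacc j hj with h | h
    · rw [h]
    · exact h.le
  have hrat' : ∀ S ∈ coals.modify t (fun S => i :: S), ∀ j ∈ S, j ∈ A →
      rank j (rat A S) ≤ rank j 1 := by
    intro S hS j hj hjA
    rcases mem_modify_cons hT hS with hS | rfl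
    · exact h.rational S hS j hj hjA
    · rcases List.mem_cons.1 hj with rfl | hj
      · exact hrat
      · exact (himp j hj).trans (h.rational T hTm j hj hjA)
  refine ⟨fun S hS => ?_, hrat', fun S hS j hj hjA T' hT' hjT' hacc' => ?_⟩
  · rcases mem_modify_cons hT hS with hS | rfl
    · exact (h.mono hf).kind S hS
    · rcases h.kind T hTm with hred | hpr
      · left
        intro j hj
        rcases List.mem_cons.1 hj with rfl | hj
        · exact hi
        · exact hred j hj
      · exact Or.inr (hpr.accept_cons hL hi hiT hacc hf)
  -- For an old target, members of `T` have only gained by accepting `i`, and `i` has made her best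
  -- choice. The enlarged coalition offers the ratio `1` if it is all red, which is covered by
  -- individual rationality; otherwise it is closed.
  · rcases mem_modify_cons hT hT' with hT'' | rfl
    · rcases mem_modify_cons hT hS with hS | rfl
      · exact h.stable S hS j hj hjA T' hT'' hjT' hacc'
      · rcases List.mem_cons.1 hj with rfl | hj
        · exact hbest T' hT'' hacc'
        · exact (himp j hj).trans (h.stable T hTm j hj hjA T' hT'' hjT' hacc')
    · rcases h.kind T hTm with hred | hpr
      · rw [rat_eq_one (S := j :: i :: T) (by simp)]
        · exact hrat' S hS j hj hjA
        · intro x hx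
          simp only [List.mem_cons] at hx
          rcases hx with rfl | rfl | hx
          · exact hjA
          · exact hi
          · exact hred x hx
      · exact absurd hacc' (hpr.not_accepts_cons hL hi hiT hacc hfree hjA hjT')

/-- Every red agent in the coalitions is at least as happy as with some ratio `lad y` below her virtual
peak, for which `Fut y` holds. -/
def Secure (A : List α) (rank : α → ℚ → ℕ) (w : α → ℕ) (Fut : ℕ → Prop) (coals : List (List α)) :
    Prop :=
  ∀ S ∈ coals, ∀ i ∈ S, i ∈ A → ∃ y, 2 ≤ y ∧ y ≤ w i ∧ rank i (rat A S) ≤ rank i (lad y) ∧ Fut y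

theorem Secure.mono {Fut Fut' : ℕ → Prop} {coals : List (List α)} (h : Secure A rank w Fut coals)
    (hf : ∀ y, Fut y → Fut' y) : Secure A rank w Fut' coals := fun S hS i hi hiA =>
  let ⟨y, h1, h2, h3, h4⟩ := h S hS i hi hiA
  ⟨y, h1, h2, h3, hf y h4⟩

theorem Secure.move {Fut Fut' : ℕ → Prop} {coals : List (List α)} (h : Secure A rank w Fut coals)
    (hf : ∀ y, Fut y → Fut' y) {i : α} {t : ℕ} {T : List α} (hT : coals[t]? = some T)
    (hacc : Accepts A rank i T) {y : ℕ} (hy : 2 ≤ y) (hyw : y ≤ w i)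
    (hyr : rank i (rat A (i :: T)) ≤ rank i (lad y)) (hyf : Fut' y) :
    Secure A rank w Fut' (coals.modify t (fun S => i :: S)) := by
  intro S hS j hj hjA
  rcases mem_modify_cons hT hS with hS | rfl
  · exact h.mono hf S hS j hj hjA
  · rcases List.mem_cons.1 hj with rfl | hj
    · exact ⟨y, hy, hyw, hyr, hyf⟩
    · obtain ⟨y', h1, h2, h3, h4⟩ := h.mono hf T (List.mem_of_getElem? hT) j hj hjA
      refine ⟨y', h1, h2, le_trans ?_ h3, h4⟩
      rcases hacc j hj with h | h
      · rw [h]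
      · exact h.le

/-- What is known, during the formation of the coalition `S` with blue agent `b`, about the size `y`
of a coalition in which an agent could have stayed. -/
def FormFut (A : List α) (w : α → ℕ) (line S : List α) (b : α) (y : ℕ) : Prop :=
  w b ≤ y ∨ ((∀ r ∈ line, w r ≤ y) ∧ S.countP (fun r => decide (r ∈ A ∧ y < w r)) + 1 < y)

/-- A finished coalition can be appended to the list. -/
theorem StableReds.finish (hL : Ladder A A' rank w) {free free' : α → Prop} {line S : List α}
    {coals : List (List α)} {b : α}
    (h : StableReds A A' rank peak w free coals) (hf : ∀ j, free' j → free j)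
    (hsec : Secure A rank w (FormFut A w line S b) coals)
    (hS : OneBlue A A' S b) (hprop : Proper A A' peak w free' S)
    (hred : ∃ T ∈ coals, (∀ j ∈ T, j ∈ A) ∧ ∀ i ∈ S, i ∉ T)
    (hdev : ∀ i ∈ S, i ∈ A → ∀ T ∈ coals, Accepts A rank i T →
      rank i (rat A S) ≤ rank i (rat A (i :: T))) :
    StableReds A A' rank peak w free' (coals ++ [S]) := by
  have hrat : ∀ i ∈ S, i ∈ A → rank i (rat A S) ≤ rank i 1 := by
    intro i hi hiA
    -- An all-red coalition accepts every red agent and gives her the ratio of her singleton, so the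
    -- absence of deviations to it yields individual rationality.
    obtain ⟨T, hT, hTA, hiT⟩ := hred
    have h1 : rat A (i :: T) = 1 := rat_eq_one (by simp) (by simpa using ⟨hiA, hTA⟩)
    have := hdev i hi hiA T hT fun j hj => by
      rw [h1, rat_eq_one (List.ne_nil_of_mem hj) hTA]
      exact Or.inl rfl
    rwa [h1] at this
  have hmem : ∀ {T}, T ∈ coals ++ [S] → T ∈ coals ∨ T = S := fun hT => by simpa using hT
  refine ⟨fun T hT => ?_, fun T hT i hi hiA => ?_, fun U hU i hi hiA T hT hiT hacc => ?_⟩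
  · rcases hmem hT with hT | rfl
    · exact (h.mono hf).kind T hT
    · exact Or.inr hprop
  · rcases hmem hT with hT | rfl
    · exact h.rational T hT i hi hiA
    · exact hrat i hi hiA
  · rcases hmem hU with hU1 | rfl <;> rcases hmem hT with hT1 | rfl
    · exact h.stable U hU1 i hi hiA T hT1 hiT hacc
    · obtain ⟨y, hy, hyw, hyr, hyf⟩ := hsec U hU1 i hi hiA
      have hu := hS.uni hL (Or.inl hiA)
      rw [hS.rat_cons hL hiA hiT]
      refine hyr.trans ?_
      have hs := fun j hj => hS.succ_le hL hiA hiT hacc (j := j) hj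
      have h1 := hS.one_le
      -- If `|T| + 1 ≤ y ≤ w i`, then `lad y` is at least as good as the offer. If `|T| + 1 > y`,
      -- acceptance gives virtual peaks above `y` to `b`, which refutes the first alternative of
      -- `FormFut`, and to all `|T| - 1 ≥ y - 1` red members, which refutes the second.
      rcases Nat.lt_trichotomy (T.length + 1) y with hlt | heq | hgt
      · exact (hu.dec (T.length + 1) y (by omega) hlt hyw).le
      · rw [heq]
      · exfalso
        rcases hyf with hb | ⟨-, hcount⟩
        · have := hs b hS.mem
          omega
        · have hle : (T.erase b).countP (fun r => decide (r ∈ A ∧ y < w r)) ≤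
              T.countP (fun r => decide (r ∈ A ∧ y < w r)) :=
            (List.erase_sublist).countP_le
          have hall : (T.erase b).countP (fun r => decide (r ∈ A ∧ y < w r)) =
              (T.erase b).length := by
            rw [List.countP_eq_length]
            intro r hr
            rw [hS.nodup.mem_erase_iff] at hr
            have := hs r hr.2
            simp only [decide_eq_true_eq]
            exact ⟨hS.reds r hr.2 hr.1, by omega⟩
          have := List.length_erase_of_mem hS.mem
          omega
    · exact hdev i hi hiA T hT1 hacc
    · exact absurd hi hiT

end Coalitions

/-! ### One side of the game -/

section Side

variable {α : Type} [DecidableEq α] {M : ℕ} [hM : Fact (4 ≤ M)]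

/-- The standing assumptions about an application of `half`: the agents in the disjoint lists `A`, `A'`
have single-peaked preferences given by `rank`, which are answered correctly by `pref`, and `M`
is large. -/
structure Side (M : ℕ) (A A' : List α) (pref : α → ℚ → ℚ → Comp Bool) (rank : α → ℚ → ℕ)
    (peak : α → ℚ) (a b : ℕ) : Prop where
  nodup : (A ++ A').Nodup
  decides : Decides M pref rank (fun i => i ∈ A ∨ i ∈ A')
  single : ∀ i, i ∈ A ∨ i ∈ A' → SinglePeakedRank (rank i) (peak i) (ratios a b)
  lenA : A.length ≤ a
  lenA' : A'.length ≤ b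
  large : a + b + 4 ≤ M

/-- The size of a coalition that attains the virtual peak of `i`. -/
def vpeak (A : List α) (rank : α → ℚ → ℕ) (i : α) : ℕ := vsize (rank i) A.length

variable {A A' : List α} {pref : α → ℚ → ℚ → Comp Bool} {rank : α → ℚ → ℕ} {peak : α → ℚ} {a b : ℕ}

/-- The ratios `lad n` are ratios of coalitions with a blue agent, so they lie in `ratios a b` only
if there is one. This is why `Ladder.uni` assumes `A' ≠ []`. -/
theorem Side.ladder (h : Side M A A' pref rank peak a b) : Ladder A A' rank (vpeak A rank) where
  nodup := h.nodup
  uni hne i hi := (h.single i hi).unimodal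
    ((List.length_pos_iff.2 hne).trans_le h.lenA') h.lenA

theorem Side.two_le_vpeak (h : Side M A A' pref rank peak a b) (hA : A ≠ []) (hA' : A' ≠ []) {i : α}
    (hi : i ∈ A ∨ i ∈ A') (hp : 1 / 2 ≤ peak i) : 2 ≤ vpeak A rank i :=
  (h.single i hi).two_le_vsize ((List.length_pos_iff.2 hA').trans_le h.lenA') h.lenA
    (List.length_pos_iff.2 hA) hp

theorem Side.length_le (h : Side M A A' pref rank peak a b) {l : List α} (hl : l.Nodup)
    (hU : ∀ i ∈ l, i ∈ A ∨ i ∈ A') : l.length ≤ a + b := by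
  have := (hl.subperm (l₂ := A ++ A') fun i hi => by simpa using hU i hi).length_le
  have h1 := h.lenA
  have h2 := h.lenA'
  rw [List.length_append] at this
  omega

theorem rat_mem_ratios {T : List α} (hT : T ≠ []) (hn : T.Nodup) (hU : ∀ i ∈ T, i ∈ A ∨ i ∈ A')
    (ha : A.length ≤ a) (hb : A'.length ≤ b) : rat A T ∈ ratios a b := by
  have h1 := List.length_eq_countP_add_countP (l := T) (fun x => decide (x ∈ A))
  refine ⟨T.countP (fun x => decide (x ∈ A)), T.countP (fun x => ¬ decide (x ∈ A)), ?_, ?_, ?_, ?_⟩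
  · rw [List.countP_eq_length_filter]
    refine le_trans (List.Subperm.length_le ?_) ha
    exact (hn.filter _).subperm fun i hi => by simpa using (List.mem_filter.1 hi).2
  · rw [List.countP_eq_length_filter]
    refine le_trans (List.Subperm.length_le ?_) hb
    refine (hn.filter _).subperm fun i hi => ?_
    have h2 := List.mem_filter.1 hi
    exact (hU i h2.1).resolve_left (by simpa using h2.2)
  · rw [← h1]
    exact List.length_pos_iff.2 hT
  · unfold rat
    rw [← Nat.cast_add, ← h1]

theorem Side.distinguishes (h : Side M A A' pref rank peak a b) {coals : List (List α)} {i : α}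
    (hi : i ∈ A ∨ i ∈ A') (hc : ∀ S ∈ coals, (i :: S).Nodup ∧ ∀ j ∈ S, j ∈ A ∨ j ∈ A')
    (T : α → List α → Prop) : Distinguishes A rank T coals i := by
  have hmem : ∀ S ∈ coals, rat A (i :: S) ∈ ratios a b := fun S hS =>
    rat_mem_ratios (A' := A') (by simp) (hc S hS).1 (fun j hj => by
      rcases List.mem_cons.1 hj with rfl | hj
      · exact hi
      · exact (hc S hS).2 j hj) h.lenA h.lenA'
  exact fun S hS _ S' hS' _ heq => (h.single i hi).inj (hmem S hS) (hmem S' hS') heq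

/-! ### Sorting -/

theorem Side.runs_virtualPeak (h : Side M A A' pref rank peak a b) {i : α} (hi : i ∈ A ∨ i ∈ A')
    {m : ℕ} (hm : m < M) :
    Runs M 6 (virtualPeak pref i m) (fun q => q = lad (vsize (rank i) m)) := by
  refine RunsIn.mono (T := m * (M ^ 4 + 1) + 1) ?_ (mul_pow_add_le hm) fun _ hb => hb
  clear hm
  induction m with
  | zero =>
    exact RunsIn.mono (T := 1 + 0) (RunsIn.bind (RunsIn.charge 1) fun _ _ =>
      RunsIn.pure lad_one.symm) (by omega) fun _ hb => hb
  | succ m ih =>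
    unfold virtualPeak
    have hc : ((m : ℚ) + 1) / ((m : ℚ) + 2) = lad (m + 2) := by
      rw [lad_eq_div (m + 1)]
      push_cast
      ring
    refine RunsIn.mono (RunsIn.bind (RunsIn.charge 1) fun _ _ => RunsIn.bind ih fun q hq =>
      RunsIn.bind (T' := 0) (h.decides i hi _ _) fun r hr => ?_) ?_ fun _ hb => hb
    · subst hq
      rw [hc] at hr
      rw [vsize_succ]
      split
      · next hrt => exact RunsIn.pure (by rw [if_pos (hr.1 hrt), hc])
      · next hrt => exact RunsIn.pure (by rw [if_neg fun hlt => hrt (hr.2 hlt)])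
    · have : 4 * M ^ 3 ≤ M ^ 4 := four_mul_pow_le M 3
      have := one_le_pow_of_fact M 3
      rw [Nat.succ_mul]
      omega

/-- Sorted by decreasing virtual peaks. -/
abbrev SortedDown (l : List (α × ℚ)) : Prop := l.Pairwise (fun x y => y.2 ≤ x.2)

theorem runs_insertAgent {x : α × ℚ} {l : List (α × ℚ)} (hl : l.length < M) :
    Runs M 3 (insertAgent x l) (fun r => r.Perm (x :: l) ∧ (SortedDown l → SortedDown r)) := by
  refine RunsIn.mono (T := l.length * (M ^ 1 + 1) + 1) ?_ (mul_pow_add_le hl) fun _ hb => hb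
  clear hl
  induction l with
  | nil =>
    exact (RunsIn.bind (T' := 0) (RunsIn.charge 1) fun _ _ => RunsIn.pure (by simp)).mono
      (by simp) fun _ hb => hb
  | cons y l ih =>
    have hfront : x.2 ≥ y.2 → (x :: y :: l).Perm (x :: y :: l) ∧
        (SortedDown (y :: l) → SortedDown (x :: y :: l)) := fun hxy =>
      ⟨List.Perm.refl _, fun hs => List.pairwise_cons.2 ⟨fun z hz => by
        rcases List.mem_cons.1 hz with rfl | hz
        · exact hxy
        · exact ((List.pairwise_cons.1 hs).1 z hz).trans hxy, hs⟩⟩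
    have hback : x.2 ≤ y.2 → ∀ l', (l'.Perm (x :: l) ∧ (SortedDown l → SortedDown l')) →
        (y :: l').Perm (x :: y :: l) ∧ (SortedDown (y :: l) → SortedDown (y :: l')) := by
      rintro hxy l' ⟨h1, h2⟩
      refine ⟨(h1.cons y).trans (List.Perm.swap x y l), fun hs => List.pairwise_cons.2 ⟨?_, ?_⟩⟩
      · intro z hz
        rcases List.mem_cons.1 (h1.mem_iff.1 hz) with rfl | hz
        · exact hxy
        · exact (List.pairwise_cons.1 hs).1 z hz
      · exact h2 (List.pairwise_cons.1 hs).2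
    unfold insertAgent
    have hrec : x.2 ≤ y.2 → RunsIn (l.length * (M ^ 1 + 1) + 1) (do
        let l' ← insertAgent x l
        Pure.pure (y :: l')) (fun r => r.Perm (x :: y :: l) ∧
          (SortedDown (y :: l) → SortedDown r)) := fun hxy =>
      (RunsIn.bind (T' := 0) ih fun l' hl' => RunsIn.pure (hback hxy l' hl')).mono le_rfl
        fun _ hb => hb
    refine RunsIn.mono (T := 1 + (1 + (l.length * (M ^ 1 + 1) + 1)))
      (RunsIn.bind (RunsIn.charge 1) fun _ _ => ?_) ?_ fun _ hb => hb
    · split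
      · next hlt => exact RunsIn.pure (hfront hlt.le)
      · next hlt =>
        split
        · next hlt' => exact (hrec hlt'.le).mono (by omega) fun _ hb => hb
        · next hlt' =>
          refine RunsIn.bind (T := 1) (RunsIn.mono (T := M ^ 0) (Runs.pick (k := 0)
            (l := [true, false]) (by simp)) (by simp) fun _ hb => hb) fun r _ => ?_
          split
          · exact RunsIn.pure (hfront (not_lt.1 hlt'))
          · exact hrec (not_lt.1 hlt)
    · have := hM.out
      simp only [List.length_cons, pow_one]
      ring_nf
      omega

theorem runs_sortAgents {l : List (α × ℚ)} (hl : l.length < M) :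
    Runs M 6 (sortAgents l) (fun r => r.Perm l ∧ SortedDown r) := by
  have hl' : l.length ≤ M - 1 := by omega
  refine RunsIn.mono (T := l.length * (M ^ 4 + 1) + 1) ?_ (mul_pow_add_le hl) fun _ hb => hb
  clear hl
  induction l with
  | nil =>
    exact (RunsIn.bind (T' := 0) (RunsIn.charge 1) fun _ _ => RunsIn.pure (by simp)).mono
      (by simp) fun _ hb => hb
  | cons x l ih =>
    unfold sortAgents
    have hM' := hM.out
    simp only [List.length_cons] at hl'
    refine RunsIn.mono (RunsIn.bind (RunsIn.charge 1) fun _ _ =>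
      RunsIn.bind (ih (by omega)) fun l' hl'' =>
      RunsIn.mono (runs_insertAgent (M := M) (x := x) (l := l') (by rw [hl''.1.length_eq]; omega))
        (pow_le_pow_of_fact (l := 4) (by norm_num))
        fun r hr => ⟨hr.1.trans (hl''.1.cons x), hr.2 hl''.2⟩) ?_ fun _ hb => hb
    simp only [List.length_cons]
    rw [Nat.succ_mul]
    omega

/-- An agent together with the ratio `lad (w i)`. -/
def tag (w : α → ℕ) (i : α) : α × ℚ := (i, lad (w i))

theorem map_fst_tag (w : α → ℕ) (l : List α) : (l.map (tag w)).map Prod.fst = l := by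
  rw [List.map_map]
  exact List.map_id _

/-- The agents of high peak. -/
def high (peak : α → ℚ) (l : List α) : List α := l.filter (fun i => 1 / 2 ≤ peak i)

theorem Side.runs_lineUp (h : Side M A A' pref rank peak a b) {l : List α} (hl : l.length < M)
    (hU : ∀ i ∈ l, i ∈ A ∨ i ∈ A') :
    Runs M 12 (lineUp A pref peak l) (fun r => ∃ l' : List α, r = l'.map (tag (vpeak A rank)) ∧
      l'.Perm (high peak l) ∧ l'.Pairwise (fun i j => vpeak A rank j ≤ vpeak A rank i)) := by
  have hA : A.length < M := by have := h.lenA; have := h.large; omega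
  refine Runs.bind (Runs.le (Runs.select (k := 2) (p := fun i => 1 / 2 ≤ peak i) (fun i _ =>
    Runs.charge_bind (one_le_pow_of_fact M _) (Runs.pure (by simp))) hl) (by norm_num)) fun hi hhi => ?_
  have hilen : hi.length < M := by
    rw [hhi]
    exact (List.length_filter_le _ _).trans_lt hl
  refine Runs.charge_bind (k := 10) ?_ ?_
  · have : M ^ 1 ≤ M ^ 10 := pow_le_pow_of_fact (by norm_num)
    rw [pow_one] at this
    omega
  refine Runs.bind (k := 9) (Runs.le (Runs.mapAll (k := 7) (g := tag (vpeak A rank)) (fun i hi' =>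
    Runs.bind (h.runs_virtualPeak (hU i ?_) hA) fun q hq => Runs.pure (by rw [hq]; rfl)) hilen)
    (by norm_num)) fun t ht => ?_
  · rw [hhi] at hi'
    exact (List.mem_filter.1 hi').1
  subst ht
  refine (runs_sortAgents (by simpa using hilen)).mono (by norm_num) fun r hr => ?_
  have hr1 : r = (r.map Prod.fst).map (tag (vpeak A rank)) := by
    rw [List.map_map]
    conv_lhs => rw [← List.map_id r]
    refine List.map_congr_left fun x hx => ?_
    obtain ⟨i, -, hx⟩ := List.mem_map.1 (hr.1.mem_iff.1 hx)
    rw [← hx]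
    rfl
  refine ⟨r.map Prod.fst, hr1, ?_, ?_⟩
  · have := hr.1.map Prod.fst
    rw [map_fst_tag] at this
    rwa [hhi] at this
  · have h2 := hr.2
    rw [SortedDown, hr1, List.pairwise_map] at h2
    refine h2.imp fun {i j} hij => ?_
    exact (lad_le_lad_iff (one_le_vsize _ _) (one_le_vsize _ _)).1 hij

end Side

/-! ### The formation of one coalition -/

section Formation

variable {α : Type} [DecidableEq α] {M : ℕ} [hM : Fact (4 ≤ M)]

/-- The next agent of the line can join `S`, with blue agent `b`, without exceeding virtual peaks. -/
def CanJoin (w : α → ℕ) (l S : List α) (b : α) : Prop :=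
  ∃ r, l.head? = some r ∧ S.length + 1 ≤ w r ∧ S.length + 1 ≤ w b

/-- The first coalition consists of red agents, and no other one does. -/
def Shape (A : List α) (coals : List (List α)) : Prop :=
  ∃ S₀ mixed, coals = S₀ :: mixed ∧ (∀ j ∈ S₀, j ∈ A) ∧ ∀ S ∈ mixed, ∃ j ∈ S, j ∉ A

/-- The red agent `i` in `S` has an IS-deviation to `T`. -/
def Dev (A : List α) (rank : α → ℚ → ℕ) (S : List α) (i : α) (T : List α) : Prop :=
  rank i (rat A (i :: T)) < rank i (rat A S) ∧ Accepts A rank i T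

/-- The invariant of the formation of a coalition `S` with blue agent `b`, where `l` is the line of red
agents and `P` lists all agents involved. -/
structure Forming (A A' : List α) (rank : α → ℚ → ℕ) (peak : α → ℚ) (P : List α) (n : ℕ) (b : α)
    (l S : List α) (coals : List (List α)) : Prop where
  blue : OneBlue A A' S b
  perm : (l ++ (S ++ coals.flatten)).Perm P
  len : coals.length = n
  highBlue : 1 / 2 ≤ peak b
  highLine : ∀ r ∈ l, r ∈ A ∧ 1 / 2 ≤ peak r
  highReds : ∀ r ∈ S, r ∈ A → 1 / 2 ≤ peak r
  sorted : l.Pairwise (fun i j => vpeak A rank j ≤ vpeak A rank i)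
  below : ∀ j ∈ S, S.length ≤ vpeak A rank j
  above : ∀ r ∈ l, ∀ j ∈ S, j ∈ A → vpeak A rank r ≤ vpeak A rank j
  shape : Shape A coals
  stable : StableReds A A' rank peak (vpeak A rank) (fun r => r ∈ l ∨ (r ∈ S ∧ r ∈ A)) coals
  secure : Secure A rank (vpeak A rank) (FormFut A (vpeak A rank) l S b) coals

variable {A A' : List α} {pref : α → ℚ → ℚ → Comp Bool} {rank : α → ℚ → ℕ} {peak : α → ℚ} {a b₀ : ℕ}
  {P : List α} {n : ℕ} {b : α} {l S : List α} {coals : List (List α)}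

theorem Shape.modify (h : Shape A coals) {i : α} (hi : i ∈ A) (t : ℕ) :
    Shape A (coals.modify t (fun S => i :: S)) := by
  obtain ⟨S₀, mixed, rfl, h1, h2⟩ := h
  cases t with
  | zero =>
    refine ⟨i :: S₀, mixed, by simp, fun j hj => ?_, h2⟩
    rcases List.mem_cons.1 hj with rfl | hj
    · exact hi
    · exact h1 j hj
  | succ t =>
    refine ⟨S₀, mixed.modify t (fun S => i :: S), by simp, h1, fun S hS => ?_⟩
    obtain ⟨T, hT⟩ | hnone : (∃ T, mixed[t]? = some T) ∨ mixed[t]? = none := by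
      cases mixed[t]? <;> simp
    · rcases mem_modify_cons hT hS with hS | rfl
      · exact h2 S hS
      · obtain ⟨j, hj, hjA⟩ := h2 T (List.mem_of_getElem? hT)
        exact ⟨j, by simp [hj], hjA⟩
    · rw [List.modify_eq_self (by simpa using hnone)] at hS
      exact h2 S hS

theorem Shape.exists_red (h : Shape A coals) :
    ∃ S₀ ∈ coals, (∀ j ∈ S₀, j ∈ A) ∧ ∀ i ∈ A, Accepts A rank i S₀ ∧ rat A (i :: S₀) = 1 := by
  obtain ⟨S₀, mixed, hc, h1, -⟩ := h
  refine ⟨S₀, by simp [hc], h1, fun i hi => ?_⟩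
  have h2 : rat A (i :: S₀) = 1 := rat_eq_one (by simp) (by simpa using ⟨hi, h1⟩)
  refine ⟨fun j hj => Or.inl ?_, h2⟩
  rw [h2, rat_eq_one (List.ne_nil_of_mem hj) h1]

theorem flatten_modify_cons_perm {i : α} {T : List α} {coals : List (List α)} {t : ℕ}
    (hT : coals[t]? = some T) :
    (coals.modify t (fun S => i :: S)).flatten.Perm (i :: coals.flatten) := by
  induction coals generalizing t with
  | nil => simp at hT
  | cons S coals ih =>
    cases t with
    | zero => simp
    | succ t =>
      simp only [List.modify_succ_cons, List.flatten_cons]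
      exact ((ih (by simpa using hT)).append_left S).trans List.perm_middle

theorem length_le_flatten_length {S : List α} {coals : List (List α)} (h : S ∈ coals) :
    S.length ≤ coals.flatten.length :=
  (List.sublist_flatten_of_mem h).length_le

theorem nodup_of_mem_of_nodup_flatten {S : List α} {coals : List (List α)}
    (h : coals.flatten.Nodup) (hS : S ∈ coals) : S.Nodup :=
  h.sublist (List.sublist_flatten_of_mem hS)

/-- The line is sorted by decreasing virtual peak, so if the first agent is stopped by her own
virtual peak, then so is everybody behind her. -/
theorem not_canJoin {w : α → ℕ} (hs : l.Pairwise (fun i j => w j ≤ w i)) (h : ¬ CanJoin w l S b) :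
    w b ≤ S.length ∨ ∀ r ∈ l, w r ≤ S.length := by
  by_contra! hcon
  obtain ⟨h1, r, hr, h2⟩ := hcon
  cases l with
  | nil => simp at hr
  | cons r' l =>
    refine h ⟨r', rfl, ?_, by omega⟩
    rcases List.mem_cons.1 hr with rfl | hr
    · omega
    · have := (List.pairwise_cons.1 hs).1 r hr
      omega

namespace Forming

theorem nodup (h : Forming A A' rank peak P n b l S coals) (hP : P.Nodup) :
    (l ++ (S ++ coals.flatten)).Nodup := h.perm.nodup_iff.2 hP

theorem notMem (h : Forming A A' rank peak P n b l S coals) (hP : P.Nodup) {i : α} (hi : i ∈ S)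
    {T : List α} (hT : T ∈ coals) : i ∉ T := fun hiT =>
  (List.disjoint_of_nodup_append (List.nodup_append.1 (h.nodup hP)).2.1) hi
    (List.mem_flatten_of_mem hT hiT)

theorem notMem_line (h : Forming A A' rank peak P n b l S coals) (hP : P.Nodup) {i : α} (hi : i ∈ l) :
    i ∉ S := fun hiS =>
  (List.disjoint_of_nodup_append (h.nodup hP)) hi (List.mem_append_left _ hiS)

/-- Members taken from the line earlier have virtual peaks at least that of `r`, so the inequality
checked for `r` and `b` holds for all members. In the second alternative of `FormFut`, `r` comes
from the line and has `w r ≤ y`, so she does not enter the count. -/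
theorem join {r : α} (h : Forming A A' rank peak P n b (r :: l) S coals) (hP : P.Nodup)
    (hr : S.length + 1 ≤ vpeak A rank r) (hb : S.length + 1 ≤ vpeak A rank b) :
    Forming A A' rank peak P n b l (r :: S) coals := by
  have hrA := (h.highLine r (by simp)).1
  have hrS := h.notMem_line hP (i := r) (by simp)
  refine ⟨h.blue.cons hrA hrS, ?_, h.len, h.highBlue, fun j hj => h.highLine j (by simp [hj]), ?_,
    (List.pairwise_cons.1 h.sorted).2, ?_, ?_, h.shape, h.stable.mono ?_, h.secure.mono ?_⟩
  · refine List.Perm.trans ?_ h.perm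
    simp only [List.cons_append]
    exact List.perm_middle
  · intro j hj hjA
    rcases List.mem_cons.1 hj with rfl | hj
    · exact (h.highLine j (by simp)).2
    · exact h.highReds j hj hjA
  · intro j hj
    rw [List.length_cons]
    rcases List.mem_cons.1 hj with rfl | hj
    · exact hr
    · by_cases hjb : j = b
      · rw [hjb]
        exact hb
      · exact hr.trans (h.above r (by simp) j hj (h.blue.reds j hj hjb))
  · intro r' hr' j hj hjA
    rcases List.mem_cons.1 hj with rfl | hj
    · exact (List.pairwise_cons.1 h.sorted).1 r' hr'
    · exact h.above r' (by simp [hr']) j hj hjA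
  · rintro j (hj | ⟨hj, hjA⟩)
    · exact Or.inl (by simp [hj])
    · rcases List.mem_cons.1 hj with rfl | hj
      · exact Or.inl (by simp)
      · exact Or.inr ⟨hj, hjA⟩
  · rintro y (hy | ⟨hy1, hy2⟩)
    · exact Or.inl hy
    · refine Or.inr ⟨fun r' hr' => hy1 r' (by simp [hr']), ?_⟩
      rw [List.countP_cons_of_neg]
      · exact hy2
      · have := hy1 r (by simp)
        simp only [decide_eq_true_eq, not_and, not_lt]
        exact fun _ => this

/-- The leaver receives the security size `y = |S|`, since she prefers her new ratio to `lad |S|`.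
The loop lets agents leave only when nobody can join, which is what makes `FormFut` true for this
`y`. -/
theorem leave (hL : Ladder A A' rank (vpeak A rank))
    (h : Forming A A' rank peak P n b l S coals) (hP : P.Nodup)
    (hjoin : ¬ CanJoin (vpeak A rank) l S b) {m : Move α}
    (hm : IsBestMove A rank (Dev A rank S) coals (S.filter (fun i => i ∈ A)) m) :
    Forming A A' rank peak P n b l (S.erase m.agent)
      (coals.modify m.target (fun T => m.agent :: T)) := by
  obtain ⟨i, t, θ⟩ := m
  obtain ⟨hi, T, hT, ⟨hdev, hacc⟩, hbest⟩ := hm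
  simp only at hi hT hdev hacc hbest ⊢
  obtain ⟨hiS, hiA⟩ : i ∈ S ∧ i ∈ A := by simpa using hi
  have hib : i ≠ b := fun hib => hL.notMem' h.blue.blue (hib ▸ hiA)
  have hlen := List.length_erase_of_mem hiS
  have hsub : ∀ {j}, j ∈ S.erase i → j ∈ S := fun hj => List.mem_of_mem_erase hj
  -- The algorithm optimises only over improvements on `S`. An accepting coalition that is no
  -- improvement is no better than the chosen one, so the choice is best among all coalitions that
  -- accept her.
  have hbest' : ∀ T' ∈ coals, Accepts A rank i T' →
      rank i (rat A (i :: T)) ≤ rank i (rat A (i :: T')) := fun T' hT' hacc' => by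
    by_cases hlt : rank i (rat A (i :: T')) < rank i (rat A S)
    · exact hbest T' hT' ⟨hlt, hacc'⟩
    · omega
  have hbe : b ∈ S.erase i := (List.mem_erase_of_ne hib.symm).2 h.blue.mem
  have htwo : 2 ≤ S.length := by
    have := List.length_pos_of_mem hbe
    omega
  have hmono : ∀ y, FormFut A (vpeak A rank) l S b y →
      FormFut A (vpeak A rank) l (S.erase i) b y := fun y hy => hy.imp id fun hy =>
    ⟨hy.1, (Nat.add_le_add_right List.erase_sublist.countP_le 1).trans_lt hy.2⟩
  refine ⟨⟨h.blue.nodup.erase i, hbe, h.blue.blue, fun j hj => h.blue.reds j (hsub hj)⟩, ?_,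
    by rw [List.length_modify, h.len], h.highBlue, h.highLine, fun j hj => h.highReds j (hsub hj),
    h.sorted, fun j hj => ?_, fun r hr j hj => h.above r hr j (hsub hj), h.shape.modify hiA t,
    h.stable.move hL ?_ hiA (Or.inr ⟨hiS, hiA⟩) (fun T hT => h.notMem hP hiS hT) hT hacc ?_ hbest',
    h.secure.move hmono hT hacc (y := S.length) htwo (h.below i hiS) ?_ ?_⟩
  · refine List.Perm.trans (List.Perm.append_left l ?_) h.perm
    refine ((flatten_modify_cons_perm hT).append_left _).trans ?_
    refine List.perm_middle.trans ?_
    rw [← List.cons_append]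
    exact (List.perm_cons_erase hiS).symm.append_right _
  · have := h.below j (hsub hj)
    omega
  · rintro j (hj | ⟨hj, hjA⟩)
    · exact Or.inl hj
    · exact Or.inr ⟨hsub hj, hjA⟩
  · obtain ⟨S₀, hS₀, -, h1⟩ := h.shape.exists_red (rank := rank)
    obtain ⟨h2, h3⟩ := h1 i hiA
    rw [← h3]
    exact hbest' S₀ hS₀ h2
  · rw [← h.blue.rat_eq hL]
    exact hdev.le
  · rcases not_canJoin h.sorted hjoin with hb | hl
    · exact Or.inl hb
    · refine Or.inr ⟨hl, ?_⟩
      -- After `i` has left, at most `|S| - 2` red agents remain besides `b`, so the count is small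
      -- enough for `y = |S|`, whatever their virtual peaks are.
      have h1 : (S.erase i).countP (fun r => decide (r ∈ A ∧ S.length < vpeak A rank r)) ≤
          ((S.erase i).erase b).length := by
        rw [(List.perm_cons_erase hbe).countP_eq, List.countP_cons_of_neg]
        · exact List.countP_le_length
        · simp [hL.notMem' h.blue.blue]
      have h2 := List.length_erase_of_mem hbe
      omega

end Forming

theorem Side.forming_sizes (hS : Side M A A' pref rank peak a b₀) (hP : P.Nodup)
    (hPU : ∀ i ∈ P, i ∈ A ∨ i ∈ A') (h : Forming A A' rank peak P n b l S coals) :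
    l.length + S.length + 3 < M ∧ A.length < M ∧ ∀ T ∈ coals, T.length + 3 < M := by
  have h1 := hS.length_le hP hPU
  have h2 := hS.large
  have h3 := h.perm.length_eq
  have h4 := hS.lenA
  have h5 := h.blue.one_le
  simp only [List.length_append] at h3
  refine ⟨by omega, by omega, fun T hT => ?_⟩
  have := length_le_flatten_length hT
  omega

theorem Side.runs_canJoin (hS : Side M A A' pref rank peak a b₀) (hP : P.Nodup)
    (hPU : ∀ i ∈ P, i ∈ A ∨ i ∈ A') (h : Forming A A' rank peak P n b l S coals) :
    Runs M 5 (canJoin A (lad (vpeak A rank b)) (l.map (tag (vpeak A rank))) S)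
      (fun r => r = true ↔ CanJoin (vpeak A rank) l S b) := by
  obtain ⟨h1, h2, -⟩ := hS.forming_sizes hP hPU h
  refine Runs.charge_bind (one_le_pow_of_fact M 4) ?_
  cases l with
  | nil => exact Runs.pure (by simp [CanJoin])
  | cons r l =>
    simp only [List.length_cons] at h1
    refine Runs.bind (k := 3) (runs_ratioOf h2 (S := r :: S) (by rw [List.length_cons]; omega))
      fun θ hθ => Runs.pure ?_
    rw [h.blue.rat_cons hS.ladder (h.highLine r (by simp)).1 (h.notMem_line hP (by simp))] at hθ
    rw [hθ, decide_eq_true_iff, le_min_iff]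
    rw [lad_le_lad_iff (n := vpeak A rank r) (by omega) (one_le_vsize _ _),
      lad_le_lad_iff (n := vpeak A rank b) (by omega) (one_le_vsize _ _)]
    simp [CanJoin]

theorem map_tag_injective (w : α → ℕ) : Function.Injective (List.map (tag w)) := fun l l' h => by
  rw [← map_fst_tag w l, h, map_fst_tag]

theorem Side.runs_joinReds (hS : Side M A A' pref rank peak a b₀) (hP : P.Nodup)
    (hPU : ∀ i ∈ P, i ∈ A ∨ i ∈ A') (h : Forming A A' rank peak P n b l S coals) :
    Runs M 8 (joinReds A (lad (vpeak A rank b)) (l.map (tag (vpeak A rank))) S)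
      (fun s => ∃ l' S', s = (l'.map (tag (vpeak A rank)), S') ∧
        Forming A A' rank peak P n b l' S' coals ∧ ¬ CanJoin (vpeak A rank) l' S' b ∧
        ((l' = l ∧ S' = S) ∨ 2 * l'.length + S'.length < 2 * l.length + S.length)) := by
  refine Runs.mono (Runs.repeatLoop (k := 6) (j := 1)
    (fun s : List (α × ℚ) × List α => ∃ l' S', s = (l'.map (tag (vpeak A rank)), S') ∧
        Forming A A' rank peak P n b l' S' coals ∧
        ((l' = l ∧ S' = S) ∨ 2 * l'.length + S'.length < 2 * l.length + S.length))
    (fun s => ∀ l' S', s = (l'.map (tag (vpeak A rank)), S') → ¬ CanJoin (vpeak A rank) l' S' b)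
    (fun s => s.1.length) ?_ ⟨l, S, rfl, h, Or.inl ⟨rfl, rfl⟩⟩ ?_) (by norm_num) ?_
  · rintro _ ⟨l', S', rfl, h', hlt⟩
    refine Runs.bind (hS.runs_canJoin hP hPU h') fun r hr => ?_
    split
    · next hrt =>
      obtain ⟨x, hx, hx1, hx2⟩ := hr.1 hrt
      cases l' with
      | nil => simp at hx
      | cons y l' =>
        obtain rfl : y = x := by simpa using hx
        refine Runs.pure ⟨by simp, fun s' hs' => ?_⟩
        obtain rfl : (l'.map (tag (vpeak A rank)), y :: S') = s' := by simpa using hs'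
        refine ⟨⟨l', y :: S', rfl, h'.join hP hx1 hx2, Or.inr ?_⟩, by simp⟩
        simp only [List.length_cons] at hlt ⊢
        rcases hlt with ⟨rfl, rfl⟩ | hlt
        · simp only [List.length_cons]
          omega
        · omega
    · next hrt =>
      refine Runs.pure ⟨fun _ l'' S'' heq => ?_, by simp⟩
      rw [Prod.mk.injEq] at heq
      rw [← map_tag_injective _ heq.1, ← heq.2, ← hr]
      exact hrt
  · obtain ⟨h1, -⟩ := hS.forming_sizes hP hPU h
    rw [pow_one, List.length_map]
    omega
  · rintro s ⟨⟨l', S', rfl, h', hlt⟩, hpost⟩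
    exact ⟨l', S', rfl, h', hpost l' S' rfl, hlt⟩

theorem Side.runs_bestDeviations (hS : Side M A A' pref rank peak a b₀) (hP : P.Nodup)
    (hPU : ∀ i ∈ P, i ∈ A ∨ i ∈ A') (hn : n < M) (h : Forming A A' rank peak P n b l S coals) :
    Runs M 18 (bestDeviations A pref S coals) (fun ms =>
      (∀ m ∈ ms, IsBestMove A rank (Dev A rank S) coals (S.filter (fun i => i ∈ A)) m) ∧
      (ms = [] → ∀ i ∈ S, i ∈ A → ∀ T ∈ coals, ¬ Dev A rank S i T)) := by
  obtain ⟨h1, h2, h3⟩ := hS.forming_sizes hP hPU h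
  have hU : ∀ T ∈ coals, ∀ j ∈ T, j ∈ A ∨ j ∈ A' := fun T hT j hj =>
    hPU j (h.perm.mem_iff.1 (List.mem_append_right _
      (List.mem_append_right _ (List.mem_flatten_of_mem hT hj))))
  have hnd : ∀ T ∈ coals, T.Nodup := fun T hT =>
    nodup_of_mem_of_nodup_flatten (List.nodup_append.1 (List.nodup_append.1 (h.nodup hP)).2.1).2.1 hT
  refine Runs.bind (k := 17) ((runs_ratioOf h2 (by omega)).le (by norm_num)) fun θ hθ => ?_
  refine Runs.bind (k := 16) (Runs.le (Runs.select (k := 2) (p := fun i => i ∈ A)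
    (fun i _ => runs_isMember h2) (by omega)) (by norm_num)) fun reds hreds => ?_
  have hmem : ∀ {i}, i ∈ reds → i ∈ S ∧ i ∈ A := fun hi => by simpa [hreds] using hi
  refine (runs_bestMoves (T := Dev A rank S) (k := 10) hS.decides (by norm_num) h2 (h.len ▸ hn) ?_
    (fun i hi => Or.inl (hmem hi).2) (fun i hi => hS.distinguishes (Or.inl (hmem hi).2)
      (fun T hT => ⟨List.nodup_cons.2 ⟨h.notMem hP (hmem hi).1 hT, hnd T hT⟩, hU T hT⟩) _)
    (fun i hi T hT => ⟨?_, ?_⟩)).mono (by norm_num) fun ms hms => ⟨fun m hm => ?_, fun hnil i hi hiA => ?_⟩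
  · rw [hreds]
    have := List.length_filter_le (fun i => decide (i ∈ A)) S
    omega
  · have := h3 T hT
    omega
  · have h3 := h3 T hT
    refine Runs.bind (k := 9) (Runs.le (runs_ratioOf h2 (S := i :: T)
      (by rw [List.length_cons]; omega)) (by norm_num)) fun θ' hθ' => ?_
    refine Runs.bind (k := 8) (Runs.le (hS.decides i (Or.inl (hmem hi).2) _ _) (by norm_num))
      fun r hr => ?_
    subst hθ hθ'
    split
    · next hrt =>
      refine (runs_allAccept hS.decides (hU T hT) h2 (by omega)).mono le_rfl fun r' hr' => ?_
      rw [hr', Dev]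
      exact (and_iff_right (hr.1 hrt)).symm
    · next hrt => exact Runs.pure (by simp [Dev, ← hr, hrt])
  · rw [← hreds]
    exact hms.1 m hm
  · exact hms.2 hnil i (by rw [hreds]; simp [hi, hiA])

theorem Side.runs_formCoalition (hS : Side M A A' pref rank peak a b₀) (hP : P.Nodup)
    (hPU : ∀ i ∈ P, i ∈ A ∨ i ∈ A') (hn : n < M) (h : Forming A A' rank peak P n b l S coals) :
    Runs M 28 (formCoalition A pref (lad (vpeak A rank b)) (l.map (tag (vpeak A rank))) S coals)
      (fun s => ∃ l' S' coals', s = (l'.map (tag (vpeak A rank)), S', coals') ∧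
        Forming A A' rank peak P n b l' S' coals' ∧ ¬ CanJoin (vpeak A rank) l' S' b ∧
        ∀ i ∈ S', i ∈ A → ∀ T ∈ coals', ¬ Dev A rank S' i T) := by
  refine Runs.mono (Runs.repeatLoop (k := 25) (j := 2)
    (fun s : List (α × ℚ) × List α × List (List α) =>
      ∃ l' S' coals', s = (l'.map (tag (vpeak A rank)), S', coals') ∧
        Forming A A' rank peak P n b l' S' coals')
    (fun s => ∀ l' S' coals', s = (l'.map (tag (vpeak A rank)), S', coals') →
      ¬ CanJoin (vpeak A rank) l' S' b ∧ ∀ i ∈ S', i ∈ A → ∀ T ∈ coals', ¬ Dev A rank S' i T)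
    -- A red agent who joins turns from weight two into weight one, and a deviation removes an agent
    -- of weight one from `S`; both lower the variant.
    (fun s => 2 * s.1.length + s.2.1.length) ?_ ⟨l, S, coals, rfl, h⟩ ?_) (by norm_num) ?_
  · rintro _ ⟨l, S, coals, rfl, h⟩
    refine Runs.bind (k := 24) ((hS.runs_canJoin hP hPU h).le (by norm_num)) fun join hjoin => ?_
    refine Runs.bind (k := 23) ((hS.runs_bestDeviations hP hPU hn h).le (by norm_num))
      fun devs hdevs => ?_
    split
    · next hhalt =>
      refine Runs.pure ⟨fun _ l' S' coals' heq => ?_, by simp⟩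
      simp only [Prod.mk.injEq] at heq
      obtain ⟨h1, rfl, rfl⟩ := heq
      obtain rfl := map_tag_injective _ h1
      refine ⟨fun hc => ?_, hdevs.2 (by simpa using hhalt.2)⟩
      have := hjoin.2 hc
      simp [hhalt.1] at this
    · next hgo =>
      refine Runs.bind (k := 22) ((hS.runs_joinReds hP hPU h).le (by norm_num)) fun x hx => ?_
      obtain ⟨l', S', rfl, h', hnj, hlt⟩ := hx
      refine Runs.bind (k := 21) ((hS.runs_bestDeviations hP hPU hn h').le (by norm_num))
        fun devs' hdevs' => ?_
      obtain ⟨h1, h2, h3⟩ := hS.forming_sizes hP hPU h'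
      split
      · next hnil =>
        refine Runs.pure ⟨by simp, fun s' hs' => ?_⟩
        obtain rfl : (l'.map (tag (vpeak A rank)), S', coals) = s' := by simpa using hs'
        refine ⟨⟨l', S', coals, rfl, h'⟩, ?_⟩
        simp only [List.length_map]
        rcases hlt with ⟨rfl, rfl⟩ | hlt
        · exfalso
          -- No red agent joined, so the two lists of deviations belong to the same state. The
          -- second one being empty forces the first to be empty, although the round was entered
          -- because somebody could join or deviate.
          refine hgo ⟨Bool.eq_false_iff.2 fun h => hnj (hjoin.1 h), ?_⟩
          have hno := hdevs'.2 (by simpa using hnil)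
          rw [List.isEmpty_iff]
          by_contra hne
          obtain ⟨m, hm⟩ := List.exists_mem_of_ne_nil _ hne
          obtain ⟨hmS, T, hT, hdev, -⟩ := hdevs.1 m hm
          obtain ⟨hmS, hmA⟩ : m.agent ∈ S' ∧ m.agent ∈ A := by simpa using hmS
          exact hno _ hmS hmA T (List.mem_of_getElem? hT) hdev
        · omega
      · next hne =>
        refine Runs.bind (k := 20) (Runs.pick (by simpa using hne)) fun m hm => ?_
        refine Runs.bind (k := 19) (Runs.le (runs_carryOut (by rw [h'.len]; exact hn)) (by norm_num))
          fun c hc => ?_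
        refine Runs.bind (k := 18) (Runs.le (runs_removeAgent (by omega)) (by norm_num))
          fun S'' hS'' => ?_
        subst hc hS''
        refine Runs.pure ⟨by simp, fun s' hs' => ?_⟩
        simp only [Option.some.injEq] at hs'
        subst hs'
        have hbm := hdevs'.1 m hm
        refine ⟨⟨l', _, _, rfl, h'.leave hS.ladder hP hnj hbm⟩, ?_⟩
        have hmS : m.agent ∈ S' := List.mem_of_mem_filter hbm.1
        have := List.length_erase_of_mem hmS
        have := List.length_pos_of_mem hmS
        simp only [List.length_map]
        rcases hlt with ⟨rfl, rfl⟩ | hlt <;> omega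
  · obtain ⟨h1, -⟩ := hS.forming_sizes hP hPU h
    simp only [List.length_map]
    have := hM.out
    have : 4 * M ≤ M ^ 2 := by rw [sq]; exact Nat.mul_le_mul_right _ this
    omega
  · rintro s ⟨⟨l', S', coals', rfl, h'⟩, hpost⟩
    obtain ⟨h1, h2⟩ := hpost l' S' coals' rfl
    exact ⟨l', S', coals', rfl, h', h1, h2⟩

end Formation

/-! ### The subroutine `half` -/

section Half

variable {α : Type} [DecidableEq α] {M : ℕ} [hM : Fact (4 ≤ M)]

/-- The invariant of the first phase of `half`, with the lines `l` and `β` of red and blue agents. -/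
structure Lined (A A' : List α) (rank : α → ℚ → ℕ) (peak : α → ℚ) (P l β : List α)
    (coals : List (List α)) : Prop where
  perm : (l ++ (β ++ coals.flatten)).Perm P
  len : coals.length + β.length ≤ P.length + 1
  highLine : ∀ r ∈ l, r ∈ A ∧ 1 / 2 ≤ peak r
  highBlues : ∀ b ∈ β, b ∈ A' ∧ 1 / 2 ≤ peak b
  sorted : l.Pairwise (fun i j => vpeak A rank j ≤ vpeak A rank i)
  sortedBlues : β.Pairwise (fun i j => vpeak A rank j ≤ vpeak A rank i)
  shape : Shape A coals
  trivial_or : A' ≠ [] ∨ coals = [[]]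
  stable : StableReds A A' rank peak (vpeak A rank) (fun r => r ∈ l) coals
  secure : Secure A rank (vpeak A rank)
    (fun y => ∀ b ∈ β, vpeak A rank b ≤ y ∨ ∀ r ∈ l, vpeak A rank r ≤ y) coals

/-- The invariant of the second phase of `half`. -/
structure Settling (A A' : List α) (rank : α → ℚ → ℕ) (peak : α → ℚ) (P l β : List α)
    (coals : List (List α)) : Prop where
  perm : (l ++ (β ++ coals.flatten)).Perm P
  len : coals.length ≤ P.length + 1
  highLine : ∀ r ∈ l, r ∈ A ∧ 1 / 2 ≤ peak r
  highBlues : ∀ b ∈ β, b ∈ A' ∧ 1 / 2 ≤ peak b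
  shape : Shape A coals
  stable : StableReds A A' rank peak (vpeak A rank) (fun r => r ∈ l) coals
  atLeastHalf : ∀ S ∈ coals, ∀ i ∈ S, i ∈ A → rank i (rat A S) ≤ rank i (1 / 2)

/-- The properties of the output `L` of `half`, where `l` and `β` are the agents of high peak
that remain in the lines. -/
structure HalfResult (A A' : List α) (rank : α → ℚ → ℕ) (peak : α → ℚ) (l β : List α)
    (L : List (List α)) : Prop where
  perm : (l ++ (β ++ L.flatten)).Perm (high peak A ++ high peak A')
  exhausted : l = [] ∨ β = []
  highLine : ∀ r ∈ l, r ∈ A ∧ 1 / 2 ≤ peak r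
  highBlues : ∀ b ∈ β, b ∈ A' ∧ 1 / 2 ≤ peak b
  nonempty : ∀ S ∈ L, S ≠ []
  single : ∀ S ∈ L, (∀ j ∈ S, j ∈ A) → ∃ r, S = [r]
  stable : StableReds A A' rank peak (vpeak A rank) (fun r => r ∈ l) L
  atLeastHalf : ∀ S ∈ L, ∀ i ∈ S, i ∈ A → rank i (rat A S) ≤ rank i (1 / 2)
  left : ∀ i ∈ l, ∀ S ∈ L, Accepts A rank i S → rank i (1 / 2) ≤ rank i (rat A (i :: S))

variable {A A' : List α} {pref : α → ℚ → ℚ → Comp Bool} {rank : α → ℚ → ℕ} {peak : α → ℚ} {a b₀ : ℕ}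
  {P : List α} {b : α} {l β S : List α} {coals : List (List α)}

/-- When the formation halts, nobody from the line can join, which is the saturation required by
`Proper`, and nobody in `S` has a deviation. The red members of `S` get the security size `y = |S|`;
it passes to later blue agents because their virtual peaks are no larger than that of `b`. -/
theorem Forming.finish {P₁ : List α} {n : ℕ} (hS : Side M A A' pref rank peak a b₀)
    (h : Forming A A' rank peak P₁ n b l S coals) (hP₁ : P₁.Nodup)
    (hjoin : ¬ CanJoin (vpeak A rank) l S b)
    (hdev : ∀ i ∈ S, i ∈ A → ∀ T ∈ coals, ¬ Dev A rank S i T)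
    (hperm : (l ++ (β ++ (coals ++ [S]).flatten)).Perm P)
    (hlen : (coals ++ [S]).length + β.length ≤ P.length + 1)
    (hhigh : ∀ b ∈ β, b ∈ A' ∧ 1 / 2 ≤ peak b)
    (hsort : (b :: β).Pairwise (fun i j => vpeak A rank j ≤ vpeak A rank i))
    (htwo : 2 ≤ S.length) : Lined A A' rank peak P l β (coals ++ [S]) := by
  have hL := hS.ladder
  have hnj := not_canJoin h.sorted hjoin
  obtain ⟨r, hr⟩ : ∃ r, r ∈ S.erase b := by
    refine List.exists_mem_of_ne_nil _ fun hnil => ?_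
    have := List.length_erase_of_mem h.blue.mem
    rw [hnil, List.length_nil] at this
    omega
  obtain ⟨hrb, hrS⟩ := h.blue.nodup.mem_erase_iff.1 hr
  have hrA := h.blue.reds r hrS hrb
  have hprop : Proper A A' peak (vpeak A rank) (fun r => r ∈ l) S :=
    ⟨b, h.blue, h.highBlue, h.below b h.blue.mem, ⟨r, hrS, hrA, h.highReds r hrS hrA, h.below r hrS⟩,
      fun r' hr' => hnj.elim Or.inr fun h => Or.inl (h r' hr')⟩
  refine ⟨hperm, hlen, h.highLine, hhigh, h.sorted, (List.pairwise_cons.1 hsort).2, ?_,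
    Or.inl (List.ne_nil_of_mem h.blue.blue),
    h.stable.finish hL (fun j hj => Or.inl hj) h.secure h.blue hprop ?_ ?_, ?_⟩
  · obtain ⟨S₀, mixed, rfl, h1, h2⟩ := h.shape
    refine ⟨S₀, mixed ++ [S], rfl, h1, fun T hT => ?_⟩
    rcases List.mem_append.1 hT with hT | hT
    · exact h2 T hT
    · obtain rfl : T = S := by simpa using hT
      exact ⟨b, h.blue.mem, hL.notMem' h.blue.blue⟩
  · obtain ⟨S₀, hS₀, h1, -⟩ := h.shape.exists_red (rank := rank)
    exact ⟨S₀, hS₀, h1, fun i hi => h.notMem hP₁ hi hS₀⟩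
  · intro i hi hiA T hT hacc
    by_contra hlt
    exact hdev i hi hiA T hT ⟨not_le.1 hlt, hacc⟩
  · intro T hT i hi hiA
    rcases List.mem_append.1 hT with hT | hT
    · obtain ⟨y, h1, h2, h3, h4⟩ := h.secure T hT i hi hiA
      refine ⟨y, h1, h2, h3, fun b' hb' => ?_⟩
      rcases h4 with h4 | h4
      · exact Or.inl (((List.pairwise_cons.1 hsort).1 b' hb').trans h4)
      · exact Or.inr h4.1
    · obtain rfl : T = S := by simpa using hT
      refine ⟨T.length, htwo, h.below i hi, by rw [h.blue.rat_eq hL], fun b' hb' => ?_⟩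
      rcases hnj with h4 | h4
      · exact Or.inl (((List.pairwise_cons.1 hsort).1 b' hb').trans h4)
      · exact Or.inr h4

/-- The count in `FormFut` is zero for `[b]`, and `0 + 1 < y` holds because security sizes are at
least `2`. -/
theorem Lined.start (hS : Side M A A' pref rank peak a b₀)
    (h : Lined A A' rank peak P l (b :: β) coals) :
    Forming A A' rank peak (l ++ ([b] ++ coals.flatten)) coals.length b l [b] coals := by
  have hb := h.highBlues b (by simp)
  have hbA := hS.ladder.notMem' hb.1
  refine ⟨⟨by simp, by simp, hb.1, by simp⟩, List.Perm.refl _, rfl, hb.2, h.highLine, ?_, h.sorted,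
    ?_, ?_, h.shape, h.stable.mono ?_, ?_⟩
  · intro r hr hrA
    obtain rfl : r = b := by simpa using hr
    exact hb.2
  · intro j _
    exact one_le_vsize _ _
  · intro r _ j hj hjA
    obtain rfl : j = b := by simpa using hj
    exact absurd hjA hbA
  · rintro j (hj | ⟨hj, hjA⟩)
    · exact hj
    · obtain rfl : j = b := by simpa using hj
      exact absurd hjA hbA
  · intro T hT i hi hiA
    obtain ⟨y, h1, h2, h3, h4⟩ := h.secure T hT i hi hiA
    refine ⟨y, h1, h2, h3, (h4 b (by simp)).imp id fun h5 => ⟨h5, ?_⟩⟩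
    rw [List.countP_cons_of_neg (by simp [hbA])]
    rw [List.countP_nil]
    omega

/-- A coalition of a single blue agent is formed only when the line of red agents is exhausted, and
then the blue agent might as well have stayed in the line. -/
theorem Forming.finish_single {P₁ : List α} {n : ℕ} (hS : Side M A A' pref rank peak a b₀)
    (h : Forming A A' rank peak P₁ n b l S coals)
    (hjoin : ¬ CanJoin (vpeak A rank) l S b)
    (hperm : (l ++ (β ++ (coals ++ [S]).flatten)).Perm P)
    (hlen : (coals ++ [S]).length + β.length ≤ P.length + 1)
    (hhigh : ∀ b ∈ β, b ∈ A' ∧ 1 / 2 ≤ peak b)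
    (hsort : (b :: β).Pairwise (fun i j => vpeak A rank j ≤ vpeak A rank i))
    (hone : ¬ 2 ≤ S.length) : l = [] ∧ S = [b] ∧ Lined A A' rank peak P [] (b :: β) coals := by
  have hA' : A' ≠ [] := List.ne_nil_of_mem h.blue.blue
  have hSb : S = [b] := by
    have h1 := h.blue.one_le
    obtain ⟨x, rfl⟩ := List.length_eq_one_iff.1 (show S.length = 1 by omega)
    have := h.blue.mem
    simp only [List.mem_singleton] at this
    rw [this]
  subst hSb
  -- A next red agent would have a high peak, like `b`; both virtual peaks would be at least size
  -- two, and she could join `{b}`.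
  have hl : l = [] := by
    cases l with
    | nil => rfl
    | cons r l =>
      obtain ⟨hrA, hrp⟩ := h.highLine r (by simp)
      have hA : A ≠ [] := List.ne_nil_of_mem hrA
      exact absurd ⟨r, rfl, hS.two_le_vpeak hA hA' (Or.inl hrA) hrp,
        hS.two_le_vpeak hA hA' (Or.inr h.blue.blue) h.highBlue⟩ hjoin
  subst hl
  refine ⟨rfl, rfl, ?_, ?_, by simp, ?_, by simp, hsort, h.shape, Or.inl hA',
    h.stable.mono (by simp), h.secure.mono fun y _ b' _ => Or.inr (by simp)⟩
  · refine List.Perm.trans ?_ hperm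
    rw [List.perm_iff_count]
    intro x
    simp only [List.flatten_append, List.flatten_cons, List.flatten_nil, List.count_append,
      List.count_cons, List.count_nil]
    omega
  · simp only [List.length_append, List.length_cons, List.length_nil] at hlen ⊢
    omega
  · intro b' hb'
    rcases List.mem_cons.1 hb' with rfl | hb'
    · exact ⟨h.blue.blue, h.highBlue⟩
    · exact hhigh b' hb'

/-- A security size satisfies `2 ≤ y ≤ w i`, so it lies on the improving side of the ladder, and
`lad y` is at least as good as `lad 2 = 1/2`. Without blue agents the ladder says nothing, but then
the only coalition is empty. -/
theorem Lined.settling (hS : Side M A A' pref rank peak a b₀)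
    (h : Lined A A' rank peak P l β coals) : Settling A A' rank peak P l β coals := by
  refine ⟨h.perm, by have := h.len; omega, h.highLine, h.highBlues, h.shape, h.stable, ?_⟩
  intro S hSc i hi hiA
  obtain ⟨y, h1, h2, h3, -⟩ := h.secure S hSc i hi hiA
  rcases h.trivial_or with hA' | rfl
  · have hu := hS.ladder.uni hA' i (Or.inl hiA)
    refine h3.trans ?_
    rw [← lad_two]
    rcases h1.lt_or_eq with hlt | rfl
    · exact (hu.dec 2 y (by omega) hlt h2).le
    · exact le_rfl
  · obtain rfl : S = [] := by simpa using hSc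
    simp at hi

/-- In the second phase, `i` would join `S`. -/
def Joins (A : List α) (rank : α → ℚ → ℕ) (i : α) (S : List α) : Prop :=
  rank i (rat A (i :: S)) < rank i (1 / 2) ∧ Accepts A rank i S

theorem Settling.notMem (h : Settling A A' rank peak P l β coals) (hP : P.Nodup) {i : α} (hi : i ∈ l)
    {S : List α} (hS : S ∈ coals) : i ∉ S := fun hiS =>
  (List.disjoint_of_nodup_append (h.perm.nodup_iff.2 hP)) hi
    (List.mem_append_right _ (List.mem_flatten_of_mem hS hiS))

/-- Coalitions offering no improvement on `1/2` are no better than the chosen one, so the move is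
best among all accepting coalitions. Among these is `S_0`, which accepts every red agent at ratio
`1`; hence the move is individually rational. -/
theorem Settling.step (hS : Side M A A' pref rank peak a b₀)
    (h : Settling A A' rank peak P l β coals) (hP : P.Nodup) {m : Move α}
    (hm : IsBestMove A rank (Joins A rank) coals l m) :
    Settling A A' rank peak P (l.erase m.agent) β
      (coals.modify m.target (fun T => m.agent :: T)) := by
  obtain ⟨i, t, θ⟩ := m
  obtain ⟨hi, T, hT, ⟨hlt, hacc⟩, hbest⟩ := hm
  simp only at hi hT hlt hacc hbest ⊢
  have hiA := (h.highLine i hi).1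
  have hsub : ∀ {j}, j ∈ l.erase i → j ∈ l := fun hj => List.mem_of_mem_erase hj
  have hbest' : ∀ T' ∈ coals, Accepts A rank i T' →
      rank i (rat A (i :: T)) ≤ rank i (rat A (i :: T')) := fun T' hT' hacc' => by
    by_cases hlt' : rank i (rat A (i :: T')) < rank i (1 / 2)
    · exact hbest T' hT' ⟨hlt', hacc'⟩
    · omega
  refine ⟨?_, by rw [List.length_modify]; exact h.len, fun r hr => h.highLine r (hsub hr),
    h.highBlues, h.shape.modify hiA t, h.stable.move hS.ladder (fun j hj => hsub hj) hiA hi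
    (fun T hT => h.notMem hP hi hT) hT hacc ?_ hbest', ?_⟩
  · refine List.Perm.trans ?_ h.perm
    refine (((flatten_modify_cons_perm hT).append_left β).append_left _).trans ?_
    refine ((List.perm_middle (l₁ := β)).append_left _).trans ?_
    refine List.perm_middle.trans ?_
    rw [← List.cons_append]
    exact (List.perm_cons_erase hi).symm.append_right _
  · obtain ⟨S₀, hS₀, -, h1⟩ := h.shape.exists_red (rank := rank)
    obtain ⟨h2, h3⟩ := h1 i hiA
    rw [← h3]
    exact hbest' S₀ hS₀ h2
  · intro S' hS' j hj hjA
    rcases mem_modify_cons hT hS' with hS' | rfl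
    · exact h.atLeastHalf S' hS' j hj hjA
    · rcases List.mem_cons.1 hj with rfl | hj
      · exact hlt.le
      · refine le_trans ?_ (h.atLeastHalf T (List.mem_of_getElem? hT) j hj hjA)
        rcases hacc j hj with h | h
        · rw [h]
        · exact h.le

/-- Splitting `S_0` into singletons leaves its members at ratio `1`. A red agent joining one of
these singletons also gets ratio `1`, as she would in `S_0` or alone. -/
theorem Settling.result {mixed : List (List α)} {S₀ : List α}
    (h : Settling A A' rank peak (high peak A ++ high peak A') l β (S₀ :: mixed))
    (hex : l = [] ∨ β = []) (hhalt : ∀ i ∈ l, ∀ S ∈ S₀ :: mixed, ¬ Joins A rank i S) :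
    HalfResult A A' rank peak l β (S₀.map (fun r => [r]) ++ mixed) := by
  obtain ⟨S₀', mixed', heq, h1, h2⟩ := h.shape
  obtain ⟨rfl, rfl⟩ : S₀ = S₀' ∧ mixed = mixed' := by simpa using heq
  have hmem : ∀ {S}, S ∈ S₀.map (fun r => [r]) ++ mixed → (∃ r ∈ S₀, S = [r]) ∨ S ∈ mixed := by
    intro S hS
    rcases List.mem_append.1 hS with hS | hS
    · obtain ⟨r, hr, rfl⟩ := List.mem_map.1 hS
      exact Or.inl ⟨r, hr, rfl⟩
    · exact Or.inr hS
  have hone : ∀ r ∈ S₀, rat A [r] = rat A S₀ := fun r hr => by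
    rw [rat_eq_one (by simp) (by simpa using h1 r hr), rat_eq_one (List.ne_nil_of_mem hr) h1]
  have hone' : ∀ i ∈ A, ∀ r ∈ S₀, rat A [i, r] = 1 := fun i hi r hr =>
    rat_eq_one (by simp) (by simpa using ⟨hi, h1 r hr⟩)
  have hflat : (S₀.map (fun r => [r])).flatten = S₀ := by
    rw [← List.flatMap_def, List.flatMap_singleton']
  have hrat : ∀ S ∈ S₀.map (fun r => [r]) ++ mixed, ∀ i ∈ S, i ∈ A → rank i (rat A S) ≤ rank i 1 := by
    intro S hS i hi hiA
    rcases hmem hS with ⟨r, hr, rfl⟩ | hS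
    · obtain rfl : i = r := by simpa using hi
      rw [hone i hr]
      exact h.stable.rational S₀ (by simp) i hr hiA
    · exact h.stable.rational S (by simp [hS]) i hi hiA
  refine ⟨?_, hex, h.highLine, h.highBlues, fun S hS => ?_, fun S hS hred => ?_, ⟨fun S hS => ?_, hrat,
    fun S hS i hi hiA T hT hiT hacc => ?_⟩, fun S hS i hi hiA => ?_, fun i hi S hS hacc => ?_⟩
  · have := h.perm
    rwa [List.flatten_append, hflat]
  · rcases hmem hS with ⟨r, hr, rfl⟩ | hS
    · simp
    · obtain ⟨j, hj, -⟩ := h2 S hS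
      exact List.ne_nil_of_mem hj
  · rcases hmem hS with ⟨r, hr, rfl⟩ | hS
    · exact ⟨r, rfl⟩
    · obtain ⟨j, hj, hjA⟩ := h2 S hS
      exact absurd (hred j hj) hjA
  · rcases hmem hS with ⟨r, hr, rfl⟩ | hS
    · exact Or.inl (by simpa using h1 r hr)
    · exact h.stable.kind S (by simp [hS])
  · rcases hmem hT with ⟨r, hr, rfl⟩ | hT
    · rw [hone' i hiA r hr]
      exact hrat S hS i hi hiA
    · rcases hmem hS with ⟨r', hr', rfl⟩ | hS
      · obtain rfl : i = r' := by simpa using hi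
        rw [hone i hr']
        exact h.stable.stable S₀ (by simp) i hr' hiA T (by simp [hT]) hiT hacc
      · exact h.stable.stable S (by simp [hS]) i hi hiA T (by simp [hT]) hiT hacc
  · rcases hmem hS with ⟨r, hr, rfl⟩ | hS
    · obtain rfl : i = r := by simpa using hi
      rw [hone i hr]
      exact h.atLeastHalf S₀ (by simp) i hr hiA
    · exact h.atLeastHalf S (by simp [hS]) i hi hiA
  · rcases hmem hS with ⟨r, hr, rfl⟩ | hS
    · have hiA := (h.highLine i hi).1
      rw [hone' i hiA r hr]
      have h3 : rat A (i :: S₀) = 1 := rat_eq_one (by simp) (by simpa using ⟨hiA, h1⟩)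
      by_contra hlt
      refine hhalt i hi S₀ (by simp) ⟨by rw [h3]; exact not_le.1 hlt, fun j hj => Or.inl ?_⟩
      rw [h3, rat_eq_one (List.ne_nil_of_mem hj) h1]
    · by_contra hlt
      exact hhalt i hi S (by simp [hS]) ⟨not_le.1 hlt, hacc⟩

end Half

/-! ### Correctness and running time of `half` -/

section HalfRuns

variable {α : Type} [DecidableEq α] {M : ℕ} [hM : Fact (4 ≤ M)]
variable {A A' : List α} {pref : α → ℚ → ℚ → Comp Bool} {rank : α → ℚ → ℕ} {peak : α → ℚ} {a b₀ : ℕ}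
  {P : List α} {b : α} {l β S : List α} {coals : List (List α)}

theorem Side.length_lt (hS : Side M A A' pref rank peak a b₀) (hP : P.Nodup)
    (hPU : ∀ i ∈ P, i ∈ A ∨ i ∈ A') : P.length + 4 ≤ M := by
  have := hS.length_le hP hPU
  have := hS.large
  omega

theorem Side.runs_settle_half (hS : Side M A A' pref rank peak a b₀) (hP : P.Nodup)
    (hPU : ∀ i ∈ P, i ∈ A ∨ i ∈ A') (h : Settling A A' rank peak P l β coals) :
    Runs M 24 (settle A pref (fun r T => do
      let θ ← ratioOf A (r :: T)
      if ← pref r θ (1 / 2) then allAccept A pref r T else return false) l coals)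
      (fun s => Settling A A' rank peak P s.1 β s.2 ∧ s.1.length ≤ l.length ∧
        ∀ i ∈ s.1, ∀ S ∈ s.2, ¬ Joins A rank i S) := by
  have hlt := hS.length_lt hP hPU
  have hA : A.length < M := by
    have := hS.lenA
    have := hS.large
    omega
  refine (runs_settle (U := fun i => i ∈ A ∨ i ∈ A') (T := Joins A rank) (k := 11) hS.decides
    (by norm_num) hA (fun l' c => Settling A A' rank peak P l' β c ∧ l'.length ≤ l.length)
    ?_ ?_ ⟨h, le_rfl⟩).mono (by norm_num) fun s hs => ⟨hs.1.1, hs.1.2, hs.2⟩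
  · rintro l' c ⟨h, -⟩
    have hlen := h.perm.length_eq
    simp only [List.length_append] at hlen
    have h1 := h.len
    refine ⟨by omega, by omega, fun i hi => ?_⟩
    have hiA := (h.highLine i hi).1
    have hmemP : ∀ T ∈ c, ∀ j ∈ T, j ∈ A ∨ j ∈ A' := fun T hT j hj =>
      hPU j (h.perm.mem_iff.1 (List.mem_append_right _
        (List.mem_append_right _ (List.mem_flatten_of_mem hT hj))))
    have hnd : c.flatten.Nodup :=
      (List.nodup_append.1 (List.nodup_append.1 (h.perm.nodup_iff.2 hP)).2.1).2.1
    refine ⟨Or.inl hiA, hS.distinguishes (Or.inl hiA) (fun T hT =>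
      ⟨List.nodup_cons.2 ⟨h.notMem hP hi hT, nodup_of_mem_of_nodup_flatten hnd hT⟩, hmemP T hT⟩) _,
      fun T hT => ?_⟩
    have hTl := length_le_flatten_length hT
    refine ⟨by omega, ?_⟩
    refine Runs.bind (k := 10) (Runs.le (runs_ratioOf hA (S := i :: T)
      (by rw [List.length_cons]; omega)) (by norm_num)) fun θ hθ => ?_
    refine Runs.bind (k := 9) (Runs.le (hS.decides i (Or.inl hiA) _ _) (by norm_num)) fun r hr => ?_
    subst hθ
    split
    · next hrt =>
      refine (runs_allAccept hS.decides (hmemP T hT) hA (by omega)).mono (by norm_num) fun r' hr' => ?_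
      rw [hr', Joins]
      exact (and_iff_right (hr.1 hrt)).symm
    · next hrt => exact Runs.pure ⟨by simp, fun hj => absurd (hr.2 hj.1) hrt⟩
  · rintro l' c m ⟨h, hle⟩ hm
    exact ⟨h.step hS hP hm, List.erase_sublist.length_le.trans hle⟩

theorem Side.runs_onlyBlue (hA : A.length < M) (hS : S.length < M) :
    Runs M 5 (Comp.forAll (fun x => do return !(← isMember A x)) S)
      (fun r => r = true ↔ ∀ x ∈ S, x ∉ A) :=
  Runs.forAll (k := 3) (fun x _ => Runs.bind (runs_isMember hA) fun r hr =>
    Runs.pure (by rw [← hr]; simp)) hS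

/-- The formation of the next coalition in `half`. -/
theorem Side.runs_next (hS : Side M A A' pref rank peak a b₀) (hP : P.Nodup)
    (hPU : ∀ i ∈ P, i ∈ A ∨ i ∈ A') (h : Lined A A' rank peak P l (b :: β) coals) :
    Runs M 28 (formCoalition A pref (lad (vpeak A rank b)) (l.map (tag (vpeak A rank))) [b] coals)
      (fun s => ∃ l' S' coals', s = (l'.map (tag (vpeak A rank)), S', coals') ∧
        coals'.length < M ∧
        (Lined A A' rank peak P l' β (coals' ++ [S']) ∨
          (l' = [] ∧ S' = [b] ∧ Lined A A' rank peak P [] (b :: β) coals'))) := by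
  have hsub : (l ++ ([b] ++ coals.flatten)).Sublist (l ++ (b :: β ++ coals.flatten)) :=
    (List.Sublist.append_right (by simp) _).append_left _
  have hP₁ : (l ++ ([b] ++ coals.flatten)).Nodup := (h.perm.nodup_iff.2 hP).sublist hsub
  have hPU₁ : ∀ i ∈ l ++ ([b] ++ coals.flatten), i ∈ A ∨ i ∈ A' := fun i hi =>
    hPU i (h.perm.mem_iff.1 (hsub.subset hi))
  have hlt := hS.length_lt hP hPU
  have hlen := h.len
  simp only [List.length_cons] at hlen
  refine (hS.runs_formCoalition hP₁ hPU₁ (by omega) (h.start hS)).mono le_rfl ?_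
  rintro s ⟨l', S', coals', rfl, hf, hnj, hdev⟩
  have hperm : (l' ++ (β ++ (coals' ++ [S']).flatten)).Perm P := by
    have h1 := hf.perm
    have h2 := h.perm
    rw [List.perm_iff_count] at h1 h2 ⊢
    intro x
    have h1 := h1 x
    have h2 := h2 x
    simp only [List.flatten_append, List.flatten_cons, List.flatten_nil, List.count_append,
      List.count_cons, List.count_nil, List.append_nil] at h1 h2 ⊢
    omega
  have hlen' : (coals' ++ [S']).length + β.length ≤ P.length + 1 := by
    simp only [List.length_append, List.length_cons, List.length_nil, hf.len]
    omega
  have hhigh : ∀ b ∈ β, b ∈ A' ∧ 1 / 2 ≤ peak b := fun b' hb' => h.highBlues b' (by simp [hb'])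
  refine ⟨l', S', coals', rfl, by rw [hf.len]; omega, ?_⟩
  by_cases htwo : 2 ≤ S'.length
  · exact Or.inl (hf.finish hS hP₁ hnj hdev hperm hlen' hhigh h.sortedBlues htwo)
  · exact Or.inr (hf.finish_single hS hnj hperm hlen' hhigh h.sortedBlues htwo)

/-- The invariant of the main loop of `half`. -/
def HalfInv (A A' : List α) (rank : α → ℚ → ℕ) (peak : α → ℚ) (P : List α)
    (s : List (α × ℚ) × List (α × ℚ) × List (List α)) : Prop :=
  (∃ l β coals, s = (l.map (tag (vpeak A rank)), β.map (tag (vpeak A rank)), coals) ∧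
    Lined A A' rank peak P l β coals) ∨
  ∃ b β coals, s = ([], β.map (tag (vpeak A rank)), coals ++ [[b]]) ∧
    Lined A A' rank peak P [] (b :: β) coals

theorem Side.runs_half (hS : Side M A A' pref rank peak a b₀) :
    Runs M 40 (half A A' pref peak) (fun L => ∃ l β, HalfResult A A' rank peak l β L) := by
  have hlarge := hS.large
  have hA : A.length + 4 ≤ M := by have := hS.lenA; omega
  have hA' : A'.length + 4 ≤ M := by have := hS.lenA'; omega
  have hP : (high peak A ++ high peak A').Nodup :=
    hS.nodup.sublist (List.Sublist.append List.filter_sublist List.filter_sublist)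
  have hPU : ∀ i ∈ high peak A ++ high peak A', i ∈ A ∨ i ∈ A' := fun i hi =>
    (List.mem_append.1 hi).imp List.mem_of_mem_filter List.mem_of_mem_filter
  have hPlen := hS.length_lt hP hPU
  set P := high peak A ++ high peak A' with hPdef
  unfold half
  refine Runs.bind (k := 39) (Runs.le (hS.runs_lineUp (by omega) fun i hi => Or.inl hi) (by norm_num)) ?_
  rintro _ ⟨l, rfl, hlp, hls⟩
  refine Runs.bind (k := 38) (Runs.le (hS.runs_lineUp (by omega) fun i hi => Or.inr hi) (by norm_num)) ?_
  rintro _ ⟨β, rfl, hβp, hβs⟩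
  have h0 : Lined A A' rank peak P l β [[]] := by
    refine ⟨by simpa using hlp.append hβp, ?_, fun r hr => ?_, fun r hr => ?_, hls, hβs,
      ⟨[], [], rfl, by simp, by simp⟩, Or.inr rfl, ⟨?_, by simp, by simp⟩, by simp [Secure]⟩
    · have h1 := hβp.length_eq
      rw [hPdef]
      simp only [List.length_append, List.length_cons, List.length_nil]
      omega
    · simpa [high] using hlp.mem_iff.1 hr
    · simpa [high] using hβp.mem_iff.1 hr
    · intro S hS
      obtain rfl : S = [] := by simpa using hS
      exact Or.inl (by simp)
  refine Runs.bind (k := 37) (Runs.le (Runs.repeatLoop (k := 30) (j := 1) (HalfInv A A' rank peak P)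
    (fun s => s.1 = [] ∨ s.2.1 = []) (fun s => s.2.1.length) ?_ (Or.inl ⟨l, β, [[]], rfl, h0⟩) ?_)
    (by norm_num)) ?_
  · rintro s hs
    refine Runs.charge_bind (k := 29) (one_le_pow_of_fact M _) ?_
    rcases hs with ⟨l, β, coals, rfl, h⟩ | ⟨b, β, coals, rfl, h⟩
    · cases l with
      | nil => exact Runs.pure (by simp)
      | cons r l =>
        cases β with
        | nil => exact Runs.pure (by simp)
        | cons b β =>
          refine Runs.bind (k := 28) (hS.runs_next hP hPU h) ?_
          rintro _ ⟨l', S', coals', rfl, hlen, h'⟩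
          refine Runs.charge_bind (k := 27) ?_ (Runs.pure ⟨by simp, fun s' hs' => ?_⟩)
          · have : M ^ 1 ≤ M ^ 27 := pow_le_pow_of_fact (by norm_num)
            rw [pow_one] at this
            omega
          · obtain rfl : (l'.map (tag (vpeak A rank)), β.map (tag (vpeak A rank)), coals' ++ [S'])
              = s' := by simpa using hs'
            refine ⟨?_, by simp⟩
            rcases h' with h' | ⟨rfl, rfl, h'⟩
            · exact Or.inl ⟨l', β, _, rfl, h'⟩
            · exact Or.inr ⟨b, β, coals', rfl, h'⟩
    · exact Runs.pure (by simp)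
  · have h1 := h0.len
    simp only [List.length_cons, List.length_nil] at h1
    rw [pow_one, List.length_map]
    omega
  · rintro s ⟨hs, hex⟩
    -- In the second case the line of red agents ran out while `{b}` was being formed; the invariant
    -- treats `b` as still waiting and `[b]` as an extra last entry, to be dropped at the end.
    rcases hs with ⟨l, β, coals, rfl, h⟩ | ⟨b, β, coals, rfl, h⟩
    · have hex' : l = [] ∨ β = [] := by simpa using hex
      have hset := h.settling hS
      have hlen := hset.perm.length_eq
      simp only [List.length_append] at hlen
      refine Runs.charge_bind (k := 36) ?_ ?_
      · have : M ^ 1 ≤ M ^ 36 := pow_le_pow_of_fact (by norm_num)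
        rw [pow_one] at this
        rw [List.length_map]
        omega
      simp only [map_fst_tag]
      refine Runs.bind (k := 35) (Runs.le (hS.runs_settle_half hP hPU hset) (by norm_num)) ?_
      rintro ⟨left, final⟩ ⟨h', hle, hhalt⟩
      have hex'' : left = [] ∨ β = [] := hex'.imp (fun h0 => by
        rw [h0] at hle
        simpa using hle) id
      obtain ⟨S₀, mixed, rfl, hS₀, hmixed⟩ := h'.shape
      have hres := h'.result hex'' hhalt
      have hlen' := h'.perm.length_eq
      have hclen := h'.len
      simp only [List.length_append, List.flatten_cons, List.length_cons] at hlen' hclen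
      have hpow : M ^ 2 ≤ M ^ 33 := pow_le_pow_of_fact (by norm_num)
      have hpow' : 4 * M ≤ M ^ 2 := by rw [sq]; exact Nat.mul_le_mul_right _ hM.out
      refine Runs.charge_bind (k := 34) (one_le_pow_of_fact M _) ?_
      refine Runs.charge_bind (k := 33) (by omega) ?_
      cases hlast : mixed.getLast? with
      | none =>
        obtain rfl : mixed = [] := by simpa using hlast
        exact Runs.pure ⟨left, β, by simpa using hres⟩
      | some S =>
        have hSm : S ∈ mixed := List.mem_of_getLast? hlast
        have hSl := length_le_flatten_length hSm
        refine Runs.charge_bind (k := 32) ?_ ?_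
        · have : M ^ 2 ≤ M ^ 32 := pow_le_pow_of_fact (by norm_num)
          omega
        refine Runs.bind (k := 31) (Runs.le (Side.runs_onlyBlue (by omega) (by omega)) (by norm_num))
          fun r _ => ?_
        split
        · next hdrop =>
          -- Here every coalition after `S_0` is proper and so contains a red agent; none of them is
          -- a lone blue agent.
          exfalso
          rcases h'.stable.kind S (by simp [hSm]) with hred | ⟨b, h1, -, -, ⟨r, hr, hrA, -⟩, -⟩
          · obtain ⟨j, hj, hjA⟩ := hmixed S hSm
            exact hjA (hred j hj)
          · obtain ⟨x, rfl⟩ := List.length_eq_one_iff.1 hdrop.2.1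
            have h2 := h1.mem
            simp only [List.mem_singleton] at h2 hr
            exact hS.ladder.notMem' h1.blue (by rw [h2, ← hr]; exact hrA)
        · exact Runs.pure ⟨left, β, hres⟩
    · have hset := h.settling hS
      have hlen := hset.perm.length_eq
      have hclen := h.len
      simp only [List.length_append, List.length_nil, List.length_cons] at hlen hclen
      have hb := (h.highBlues b (by simp)).1
      refine Runs.charge_bind (k := 36) (by simpa using one_le_pow_of_fact M 36) ?_
      refine Runs.bind (k := 35) (Runs.le (runs_settle (U := fun i => i ∈ A ∨ i ∈ A')
        (T := Joins A rank) (k := 7) hS.decides le_rfl (by omega)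
        (fun l' c => l' = [] ∧ c = coals ++ [[b]]) ?_ ?_ ⟨rfl, rfl⟩) (by norm_num)) ?_
      · rintro l' c ⟨rfl, rfl⟩
        simp only [List.length_append, List.length_nil, List.length_cons]
        exact ⟨by omega, by omega, by simp⟩
      · rintro l' c m ⟨rfl, rfl⟩ hm
        exact absurd hm.1 (by simp)
      rintro ⟨left, final⟩ ⟨⟨h1, h2⟩, -⟩
      simp only at h1 h2
      subst h1 h2
      obtain ⟨S₀, mixed, rfl, hS₀, hmixed⟩ := hset.shape
      have hres := hset.result (Or.inl rfl) (by simp)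
      simp only [List.flatten_cons, List.length_cons, List.length_append] at hlen hclen
      have hpow : M ^ 2 ≤ M ^ 33 := pow_le_pow_of_fact (by norm_num)
      have hpow' : 4 * M ≤ M ^ 2 := by rw [sq]; exact Nat.mul_le_mul_right _ hM.out
      refine Runs.charge_bind (k := 34) (one_le_pow_of_fact M _) ?_
      refine Runs.charge_bind (k := 33) (e := _ + 1 + ((mixed ++ [[b]]).length + 1)) ?_ ?_
      · simp only [List.length_append, List.length_cons, List.length_nil]
        omega
      change Runs M 33 (match (mixed ++ [[b]]).getLast? with
        | none => _
        | some S => _) _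
      rw [List.getLast?_concat]
      refine Runs.charge_bind (k := 32) ?_ ?_
      · have : M ^ 2 ≤ M ^ 32 := pow_le_pow_of_fact (by norm_num)
        simp only [List.length_cons, List.length_nil]
        omega
      refine Runs.bind (k := 31) (Runs.le (Side.runs_onlyBlue (by omega) (by simp; omega))
        (by norm_num)) fun r hr => ?_
      -- All conditions for dropping are met: no red agent is left, and the last coalition is the
      -- single blue agent `b`.
      rw [if_pos ⟨rfl, rfl, hr.2 (by simpa using hS.ladder.notMem' hb)⟩]
      exact Runs.pure ⟨[], b :: β, by simpa using hres⟩

end HalfRuns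

/-! ### The last phase -/

section Last

variable {α : Type} [DecidableEq α] {M : ℕ} [hM : Fact (4 ≤ M)]
variable {A A' A₁ A₁' : List α} {pref : α → ℚ → ℚ → Comp Bool} {rank : α → ℚ → ℕ} {peak : α → ℚ}
  {a b₀ : ℕ} {l β U U' S T : List α} {i j b : α} {L coals : List (List α)}

/-- The second run of `half` measures ratios against the lists of uncovered agents, but the last
phase against the full lists. On coalitions of uncovered agents the two agree. -/
theorem rat_congr (hd : (A ++ A').Nodup) (hA : A₁ ⊆ A) (hA' : A₁' ⊆ A')
    (hS : ∀ j ∈ S, j ∈ A₁ ∨ j ∈ A₁') : rat A S = rat A₁ S := by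
  unfold rat
  congr 2
  refine List.countP_congr fun x hx => ?_
  simp only [decide_eq_true_eq]
  refine ⟨fun h => (hS x hx).resolve_right fun h' => ?_, fun h => hA h⟩
  exact (List.disjoint_of_nodup_append hd) h (hA' h')

theorem accepts_congr (hd : (A ++ A').Nodup) (hA : A₁ ⊆ A) (hA' : A₁' ⊆ A')
    (hS : ∀ j ∈ S, j ∈ A₁ ∨ j ∈ A₁') (hi : i ∈ A₁) : Accepts A rank i S ↔ Accepts A₁ rank i S := by
  unfold Accepts
  rw [rat_congr hd hA hA' hS, rat_congr hd hA hA' (S := i :: S) (by simpa using ⟨Or.inl hi, hS⟩)]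

theorem Side.sub (h : Side M A A' pref rank peak a b₀) (hA : A₁ ⊆ A) (hA' : A₁' ⊆ A')
    (hn : A₁.Nodup) (hn' : A₁'.Nodup) : Side M A₁ A₁' pref rank peak a b₀ where
  nodup := List.nodup_append'.2
    ⟨hn, hn', fun _ h1 h2 => (List.disjoint_of_nodup_append h.nodup) (hA h1) (hA' h2)⟩
  decides i hi := h.decides i (hi.imp (fun h => hA h) fun h => hA' h)
  single i hi := h.single i (hi.imp (fun h => hA h) fun h => hA' h)
  lenA := (hn.subperm hA).length_le.trans h.lenA
  lenA' := (hn'.subperm hA').length_le.trans h.lenA'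
  large := h.large

theorem Proper.mem_or {w : α → ℕ} {free : α → Prop} (h : Proper A A' peak w free S) (hj : j ∈ S) :
    j ∈ A ∨ j ∈ A' := by
  obtain ⟨b, h1, -⟩ := h
  exact h1.mem_or hj

theorem OneBlue.two_le (hL : Ladder A A' rank (vpeak A rank)) (h : OneBlue A A' S b)
    (hr : ∃ r ∈ S, r ∈ A) : 2 ≤ S.length := by
  obtain ⟨r, hrS, hrA⟩ := hr
  have hrb : r ≠ b := fun hrb => hL.notMem' h.blue (hrb ▸ hrA)
  have h1 := List.length_pos_of_mem ((List.mem_erase_of_ne hrb).2 hrS)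
  have h2 := List.length_erase_of_mem h.mem
  omega

/-- The test of the last phase. -/
def Settles (A : List α) (rank : α → ℚ → ℕ) (i : α) (S : List α) : Prop :=
  (∃ j ∈ S, j ∈ A) ∧ (∃ j ∈ S, j ∉ A) ∧
    (∀ j ∈ i :: S, rat A (i :: S) = rat A [j] ∨ rank j (rat A (i :: S)) < rank j (rat A [j])) ∧
    Accepts A rank i S

theorem runs_isMixed (hA : A.length < M) (hS : S.length < M) :
    Runs M 4 (isMixed A S) (fun r => r = true ↔ (∃ j ∈ S, j ∈ A) ∧ ∃ j ∈ S, j ∉ A) := by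
  refine Runs.charge_bind (k := 3) ?_ (Runs.pure (by simp))
  have h1 : 2 * S.length + 1 ≤ M ^ 2 := by
    have : 4 * M ≤ M ^ 2 := by rw [sq]; exact Nat.mul_le_mul_right _ hM.out
    omega
  rw [pow_succ]
  exact Nat.mul_le_mul h1 hA

theorem Side.runs_isRational (h : Side M A A' pref rank peak a b₀) (hA : A.length < M)
    (hS : S.length < M) (hU : ∀ j ∈ S, j ∈ A ∨ j ∈ A') :
    Runs M 8 (isRational A pref S)
      (fun r => r = true ↔ ∀ j ∈ S, rat A S = rat A [j] ∨ rank j (rat A S) < rank j (rat A [j])) := by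
  refine Runs.bind (k := 7) (Runs.le (runs_ratioOf hA hS) (by norm_num)) fun θ hθ => ?_
  subst hθ
  refine Runs.forAll (k := 5) (fun j hj => Runs.bind (k := 4) (Runs.le (runs_ratioOf hA (S := [j])
    (by have := hM.out; simp only [List.length_cons, List.length_nil]; omega)) (by norm_num))
    fun own hown => ?_) hS
  subst hown
  exact runs_weaklyPrefersRatio h.decides (hU j hj) _ _

theorem Side.runs_canSettle (h : Side M A A' pref rank peak a b₀) (hA : A.length < M)
    (hS : S.length + 1 < M) (hU : ∀ j ∈ S, j ∈ A ∨ j ∈ A') (hi : i ∈ A) :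
    Runs M 12 (canSettle A pref i S) (fun r => r = true ↔ Settles A rank i S) := by
  refine Runs.bind (k := 11) (Runs.le (runs_isMixed hA (by omega)) (by norm_num)) fun r hr => ?_
  split
  · next hrt =>
    refine Runs.bind (k := 10) (Runs.le (h.runs_isRational hA (S := i :: S)
      (by rw [List.length_cons]; omega) (by simpa using ⟨Or.inl hi, hU⟩)) (by norm_num)) fun r' hr' => ?_
    obtain ⟨h1, h2⟩ := hr.1 hrt
    split
    · next hrt' =>
      refine (runs_allAccept h.decides hU hA hS).mono (by norm_num) fun r'' hr'' => ?_
      rw [hr'']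
      exact ⟨fun h3 => ⟨h1, h2, hr'.1 hrt', h3⟩, fun h3 => h3.2.2.2⟩
    · next hrt' => exact Runs.pure ⟨by simp, fun h3 => absurd (hr'.2 h3.2.2.1) hrt'⟩
  · next hrt => exact Runs.pure ⟨by simp, fun h3 => absurd (hr.2 ⟨h3.1, h3.2.1⟩) hrt⟩

/-- The invariant of the last phase, which starts with the agents `U` and the output `L` of `half`. -/
structure SideInv (A A' : List α) (rank : α → ℚ → ℕ) (peak : α → ℚ) (U : List α) (L : List (List α))
    (l : List α) (coals : List (List α)) : Prop where
  perm : (l ++ coals.flatten).Perm (U ++ L.flatten)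
  subset : l ⊆ U
  len : coals.length = L.length
  nonempty : ∀ S ∈ coals, S ≠ []
  single : ∀ S ∈ coals, (∀ j ∈ S, j ∈ A) → ∃ r, S = [r] ∧ rank r (rat A S) ≤ rank r (1 / 2)
  stable : StableReds A A' rank peak (vpeak A rank) (fun r => r ∈ l) coals
  atLeastHalf : ∀ S ∈ coals, ∀ i ∈ S, i ∈ A → rank i (rat A S) ≤ rank i (1 / 2) ∨ i ∈ U
  left : ∀ i ∈ A, i ∉ L.flatten → ∀ S ∈ coals, (∃ j ∈ S, j ∉ A) → i ∉ S → Accepts A rank i S →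
    rank i (1 / 2) ≤ rank i (rat A (i :: S))

/-- The result of the last phase. -/
structure SideResult (A A' : List α) (rank : α → ℚ → ℕ) (peak : α → ℚ) (U : List α)
    (L : List (List α)) (l : List α) (coals : List (List α)) : Prop
    extends SideInv A A' rank peak U L l coals where
  stay : ∀ i ∈ l, ∀ S ∈ coals, (∃ j ∈ S, j ∉ A) → Accepts A rank i S →
    rank i 1 ≤ rank i (rat A (i :: S))

theorem HalfResult.mem_or (h : HalfResult A A' rank peak l β L) (hS : S ∈ L) (hj : j ∈ S) :
    j ∈ A ∨ j ∈ A' := by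
  have : j ∈ high peak A ++ high peak A' := h.perm.mem_iff.1 (List.mem_append_right _
    (List.mem_append_right _ (List.mem_flatten_of_mem hS hj)))
  exact (List.mem_append.1 this).imp List.mem_of_mem_filter List.mem_of_mem_filter

theorem HalfResult.nodup (h : HalfResult A A' rank peak l β L) (hd : (A ++ A').Nodup) :
    (l ++ (β ++ L.flatten)).Nodup :=
  h.perm.nodup_iff.2 (hd.sublist (List.Sublist.append List.filter_sublist List.filter_sublist))

theorem HalfResult.mem_left (h : HalfResult A A' rank peak l β L) (hd : (A ++ A').Nodup)
    (hi : i ∈ A) (hiL : i ∉ L.flatten) (hp : 1 / 2 ≤ peak i) : i ∈ l := by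
  have : i ∈ l ++ (β ++ L.flatten) := h.perm.mem_iff.2 (List.mem_append_left _
    (List.mem_filter.2 ⟨hi, by simpa using hp⟩))
  simp only [List.mem_append] at this
  rcases this with h1 | h1 | h1
  · exact h1
  · exact absurd (h.highBlues i h1).1 ((List.disjoint_of_nodup_append hd) hi)
  · exact absurd h1 hiL

/-- All agents of high peak outside the output are still waiting in a line, and one of the two lines
is exhausted. Applied to both runs of `half`, this gives each later pair a member with peak below
`1/2` and a member with peak above `1/2`. -/
theorem HalfResult.low_peak (h : HalfResult A A' rank peak l β L) (hd : (A ++ A').Nodup)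
    (hi : i ∈ A) (hiL : i ∉ L.flatten) (hj : j ∈ A') (hjL : j ∉ L.flatten) :
    peak i < 1 / 2 ∨ peak j < 1 / 2 := by
  by_contra! hcon
  have h1 := h.mem_left hd hi hiL hcon.1
  have : j ∈ l ++ (β ++ L.flatten) := h.perm.mem_iff.2 (List.mem_append_right _
    (List.mem_filter.2 ⟨hj, by simpa using hcon.2⟩))
  simp only [List.mem_append] at this
  rcases this with h2 | h2 | h2
  · exact (List.disjoint_of_nodup_append hd) (h.highLine j h2).1 hj
  · rcases h.exhausted with h3 | h3
    · simp [h3] at h1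
    · simp [h3] at h2
  · exact hjL h2

theorem StableReds.proper {w : α → ℕ} {free : α → Prop}
    (h : StableReds A A' rank peak w free coals) (hS : S ∈ coals) (hb : ∃ j ∈ S, j ∉ A) :
    Proper A A' peak w free S :=
  (h.kind S hS).resolve_left fun hred => let ⟨j, hj, hjA⟩ := hb; hjA (hred j hj)

/-- Uncovered agents of high peak are in the line, where the properties are known. An uncovered
agent of low peak has virtual peak size at most `2 ≤ |S|`, so saturation holds for her as well; the
offer `lad (|S| + 1)` is worse for her than `1/2`, being further right of her peak. -/
theorem HalfResult.sideInv (hS : Side M A A' pref rank peak a b₀)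
    (h : HalfResult A A' rank peak l β L) (hU : ∀ i ∈ U, i ∈ A ∧ i ∉ L.flatten) :
    SideInv A A' rank peak U L U L := by
  have hL := hS.ladder
  have hb₀ : ∀ {S b}, OneBlue A A' S b → 1 ≤ b₀ := fun h1 =>
    (List.length_pos_of_mem h1.blue).trans_le hS.lenA'
  refine ⟨List.Perm.refl _, fun i hi => hi, rfl, h.nonempty, fun S hSL hred => ?_,
    ⟨fun S hSL => ?_, h.stable.rational, h.stable.stable⟩,
    fun S hSL i hi hiA => Or.inl (h.atLeastHalf S hSL i hi hiA), fun i hi hiL S hSL hb hiS hacc => ?_⟩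
  · obtain ⟨r, rfl⟩ := h.single S hSL hred
    exact ⟨r, rfl, h.atLeastHalf _ hSL r (by simp) (hred r (by simp))⟩
  · refine (h.stable.kind S hSL).imp id ?_
    rintro ⟨b, h1, h2, h3, ⟨r, hr, hrA, hrp, hrw⟩, h5⟩
    refine ⟨b, h1, h2, h3, ⟨r, hr, hrA, hrp, hrw⟩, fun i hi => ?_⟩
    obtain ⟨hiA, hiL⟩ := hU i hi
    by_cases hp : 1 / 2 ≤ peak i
    · exact h5 i (h.mem_left hS.nodup hiA hiL hp)
    · have h6 := (hS.single i (Or.inl hiA)).vsize_le_two (hb₀ h1) hS.lenA (not_le.1 hp)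
      exact Or.inl (le_trans h6 (h1.two_le hL ⟨r, hr, hrA⟩))
  · by_cases hp : 1 / 2 ≤ peak i
    · exact h.left i (h.mem_left hS.nodup hi hiL hp) S hSL hacc
    · obtain ⟨b, h1, -, -, ⟨r, hr, hrA, -⟩, -⟩ := h.stable.proper hSL hb
      have h2 := h1.two_le hL ⟨r, hr, hrA⟩
      have h3 := (h1.cons hi hiS).length_le
      rw [List.length_cons] at h3
      rw [h1.rat_cons hL hi hiS, ← lad_two]
      have h4 := hS.lenA
      exact ((hS.single i (Or.inl hi)).right _ (lad_mem_ratios (hb₀ h1) (by omega) (by omega)) _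
        (lad_mem_ratios (hb₀ h1) (by omega) (by omega)) (lad_lt_lad (by omega) (by omega))
        (by rw [lad_two]; exact (not_le.1 hp).le)).le

/-- A free agent who is accepted by a proper coalition and prefers it to her singleton passes the
test of the last phase. -/
theorem StableReds.settles (hL : Ladder A A' rank (vpeak A rank)) {free : α → Prop}
    (h : StableReds A A' rank peak (vpeak A rank) free coals) (hS : S ∈ coals)
    (hb : ∃ j ∈ S, j ∉ A) (hi : i ∈ A) (hiS : i ∉ S) (hacc : Accepts A rank i S)
    (hlt : rank i (rat A (i :: S)) < rank i 1) : Settles A rank i S := by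
  obtain ⟨b, h1, h2, h3, ⟨r, hr, hrA, -⟩, -⟩ := h.proper hS hb
  have hone : ∀ {j}, j ∈ A → rat A [j] = 1 := fun hj => rat_eq_one (by simp) (by simpa using hj)
  refine ⟨⟨r, hr, hrA⟩, hb, fun j hj => ?_, hacc⟩
  rcases List.mem_cons.1 hj with rfl | hj
  · rw [hone hi]
    exact Or.inr hlt
  -- Old members already weakly prefer `S` to being alone, and acceptance improves on `S`. For the
  -- blue agent this holds because `lad 1 = 0` is worse than every `lad n` with `2 ≤ n ≤ w`.
  · have h4 : rank j (rat A S) ≤ rank j (rat A [j]) := by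
      by_cases hjb : j = b
      · subst hjb
        have h5 : OneBlue A A' [j] j := ⟨by simp, by simp, h1.blue, by simp⟩
        rw [h5.rat_eq hL, h1.rat_eq hL]
        have hu := h1.uni hL (Or.inr h1.blue)
        have h6 := h1.two_le hL ⟨r, hr, hrA⟩
        exact (hu.dec 1 S.length le_rfl (by omega) h3).le
      · rw [hone (h1.reds j hj hjb)]
        exact h.rational S hS j hj (h1.reds j hj hjb)
    have h5 := (h1.accepts_iff hL hi hiS).1 hacc j hj
    rw [← h1.rat_cons hL hi hiS, ← h1.rat_eq hL] at h5
    exact Or.inr (h5.trans_le h4)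

theorem SideInv.notMem (h : SideInv A A' rank peak U L l coals) (hU : (U ++ L.flatten).Nodup)
    (hi : i ∈ l) (hS : S ∈ coals) : i ∉ S := fun hiS =>
  (List.disjoint_of_nodup_append (h.perm.nodup_iff.2 hU)) hi (List.mem_flatten_of_mem hS hiS)

/-- By `StableReds.settles` the test of this phase fails at no mixed coalition that accepts the
mover and improves on her singleton. All-red coalitions offer just the ratio `1`, so the choice is
best among all accepting coalitions. The coalition joined is closed afterwards, which preserves
`left` vacuously. -/
theorem SideInv.step (hL : Ladder A A' rank (vpeak A rank)) (h : SideInv A A' rank peak U L l coals)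
    (hU : (U ++ L.flatten).Nodup) (hUA : ∀ i ∈ U, i ∈ A) {m : Move α}
    (hm : IsBestMove A rank (Settles A rank) coals l m) :
    SideInv A A' rank peak U L (l.erase m.agent)
      (coals.modify m.target (fun T => m.agent :: T)) := by
  obtain ⟨i, t, θ⟩ := m
  obtain ⟨hi, T, hT, hset, hbest⟩ := hm
  simp only at hi hT hset hbest ⊢
  obtain ⟨-, hb, hrat, hacc⟩ := hset
  have hTm := List.mem_of_getElem? hT
  have hiA := hUA i (h.subset hi)
  have hiT := h.notMem hU hi hTm
  have hsub : ∀ {j}, j ∈ l.erase i → j ∈ l := fun hj => List.mem_of_mem_erase hj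
  have hone : rat A [i] = 1 := rat_eq_one (by simp) (by simpa using hiA)
  have hrat' : rank i (rat A (i :: T)) ≤ rank i 1 := by
    rcases hrat i (by simp) with h1 | h1
    · rw [h1, hone]
    · rw [hone] at h1
      exact h1.le
  have hbest' : ∀ T' ∈ coals, Accepts A rank i T' →
      rank i (rat A (i :: T)) ≤ rank i (rat A (i :: T')) := fun T' hT' hacc' => by
    by_cases hlt : rank i (rat A (i :: T')) < rank i 1
    · by_cases hb' : ∃ j ∈ T', j ∉ A
      · exact hbest T' hT' (h.stable.settles hL hT' hb' hiA (h.notMem hU hi hT') hacc' hlt)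
      · push Not at hb'
        rw [rat_eq_one (S := i :: T') (by simp) (by simpa using ⟨hiA, hb'⟩)]
        exact hrat'
    · omega
  have hprop := h.stable.proper hTm hb
  refine ⟨?_, fun j hj => h.subset (hsub hj), by rw [List.length_modify]; exact h.len,
    fun S hS => ?_, fun S hS hred => ?_,
    h.stable.move hL (fun j hj => hsub hj) hiA hi (fun T hT => h.notMem hU hi hT) hT hacc hrat' hbest',
    fun S hS j hj hjA => ?_, fun j hj hjL S hS hbS hjS hjacc => ?_⟩
  · refine List.Perm.trans ?_ h.perm
    refine ((flatten_modify_cons_perm hT).append_left _).trans ?_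
    refine List.perm_middle.trans ?_
    rw [← List.cons_append]
    exact (List.perm_cons_erase hi).symm.append_right _
  · rcases mem_modify_cons hT hS with hS | rfl
    · exact h.nonempty S hS
    · simp
  · rcases mem_modify_cons hT hS with hS | rfl
    · exact h.single S hS hred
    · obtain ⟨x, hx, hxA⟩ := hb
      exact absurd (hred x (by simp [hx])) hxA
  · rcases mem_modify_cons hT hS with hS | rfl
    · exact h.atLeastHalf S hS j hj hjA
    · rcases List.mem_cons.1 hj with rfl | hj
      · exact Or.inr (h.subset hi)
      · refine (h.atLeastHalf T hTm j hj hjA).imp (fun h1 => le_trans ?_ h1) id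
        rcases hacc j hj with h2 | h2
        · rw [h2]
        · exact h2.le
  · rcases mem_modify_cons hT hS with hS | rfl
    · exact h.left j hj hjL S hS hbS hjS hjacc
    · exact absurd hjacc (hprop.not_accepts_cons hL hiA hiT hacc hi hj hjS)

/-- The last phase, for the output `L` of `half` on sublists of the lists of all agents. -/
theorem Side.runs_settle_last (hG : Side M A A' pref rank peak a b₀) (hA : A₁ ⊆ A) (hA' : A₁' ⊆ A')
    (hn : A₁.Nodup) (hn' : A₁'.Nodup) (h : HalfResult A₁ A₁' rank peak l β L)
    (hU : ∀ i ∈ U, i ∈ A₁ ∧ i ∉ L.flatten) (hUn : U.Nodup) :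
    Runs M 28 (settle A pref (canSettle A pref) U L)
      (fun s => SideResult A₁ A₁' rank peak U L s.1 s.2) := by
  have hS := hG.sub hA hA' hn hn'
  have hL := hS.ladder
  have hnod : (U ++ L.flatten).Nodup := List.nodup_append'.2 ⟨hUn,
    (List.nodup_append.1 (List.nodup_append.1 (h.nodup hS.nodup)).2.1).2.1, fun i hi => (hU i hi).2⟩
  have hUmem : ∀ j ∈ U ++ L.flatten, j ∈ A₁ ∨ j ∈ A₁' := by
    intro j hj
    rcases List.mem_append.1 hj with hj | hj
    · exact Or.inl (hU j hj).1
    · obtain ⟨S, hSL, hjS⟩ := List.mem_flatten.1 hj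
      exact h.mem_or hSL hjS
  have hlen := hS.length_le hnod hUmem
  have hlarge := hG.large
  have hAlen := hG.lenA
  have hLlen : L.length ≤ L.flatten.length := by
    rw [List.length_flatten]
    refine le_trans ?_ (List.length_le_sum_of_one_le (L.map List.length) ?_)
    · simp
    · intro n hn
      obtain ⟨S, hS, rfl⟩ := List.mem_map.1 hn
      exact List.length_pos_iff.2 (h.nonempty S hS)
  -- The program tests with the full list `A`, the invariant speaks of `A₁`; all agents involved are
  -- in `A₁` or `A₁'`, so the tests and the ratios coincide.
  have hconv : ∀ {c l'}, SideInv A₁ A₁' rank peak U L l' c → ∀ i ∈ l', ∀ S ∈ c,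
      (∀ j ∈ S, j ∈ A₁ ∨ j ∈ A₁') ∧ rat A (i :: S) = rat A₁ (i :: S) ∧
      (Settles A rank i S ↔ Settles A₁ rank i S) := by
    intro c l' hc i hi S hSc
    have h1 : ∀ j ∈ S, j ∈ A₁ ∨ j ∈ A₁' := fun j hj =>
      hUmem j (hc.perm.mem_iff.1 (List.mem_append_right _ (List.mem_flatten_of_mem hSc hj)))
    have hiA := (hU i (hc.subset hi)).1
    have h2 : ∀ j ∈ i :: S, j ∈ A₁ ∨ j ∈ A₁' := by simpa using ⟨Or.inl hiA, h1⟩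
    have h3 : ∀ j ∈ i :: S, (j ∈ A ↔ j ∈ A₁) := fun j hj =>
      ⟨fun h => (h2 j hj).resolve_right fun h' =>
        (List.disjoint_of_nodup_append hG.nodup) h (hA' h'), fun h => hA h⟩
    refine ⟨h1, rat_congr hG.nodup hA hA' h2, ?_⟩
    unfold Settles
    rw [accepts_congr hG.nodup hA hA' h1 hiA, rat_congr hG.nodup hA hA' h2]
    refine and_congr ?_ (and_congr ?_ (and_congr ?_ Iff.rfl))
    · exact exists_congr fun j => and_congr_right fun hj => h3 j (by simp [hj])
    · exact exists_congr fun j => and_congr_right fun hj => not_congr (h3 j (by simp [hj]))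
    · refine forall₂_congr fun j hj => ?_
      rw [rat_congr hG.nodup hA hA' (S := [j]) (by simpa using h2 j hj)]
  refine (runs_settle (U := fun i => i ∈ A ∨ i ∈ A') (T := Settles A rank) (k := 12) hG.decides
    (by norm_num) (by omega) (SideInv A₁ A₁' rank peak U L) ?_ ?_ (h.sideInv hS hU)).mono
    (by norm_num) fun s hs => ⟨hs.1, fun i hi S hSc hb hacc => ?_⟩
  · intro l' c hc
    have h1 := hc.perm.length_eq
    have h2 := hc.len
    simp only [List.length_append] at h1 hlen
    refine ⟨by omega, by omega, fun i hi => ?_⟩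
    have hiA := hA (hU i (hc.subset hi)).1
    have hcn : c.flatten.Nodup := (List.nodup_append.1 (hc.perm.nodup_iff.2 hnod)).2.1
    have hcU : ∀ S ∈ c, ∀ j ∈ S, j ∈ A ∨ j ∈ A' := fun S hSc j hj =>
      ((hconv hc i hi S hSc).1 j hj).imp (fun h => hA h) fun h => hA' h
    refine ⟨Or.inl hiA, hG.distinguishes (Or.inl hiA) (fun S hSc =>
      ⟨List.nodup_cons.2 ⟨hc.notMem hnod hi hSc, nodup_of_mem_of_nodup_flatten hcn hSc⟩,
        hcU S hSc⟩) _, fun S hSc => ?_⟩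
    have h3 := length_le_flatten_length hSc
    exact ⟨by omega, hG.runs_canSettle (by omega) (by omega) (hcU S hSc) hiA⟩
  · intro l' c m hc hm
    refine hc.step hL hnod (fun i hi => (hU i hi).1) ?_
    obtain ⟨h1, T, hT, h2, h3⟩ := hm
    refine ⟨h1, T, hT, (hconv hc _ h1 T (List.mem_of_getElem? hT)).2.2.1 h2, fun S hSc hset => ?_⟩
    rw [← (hconv hc _ h1 T (List.mem_of_getElem? hT)).2.1, ← (hconv hc _ h1 S hSc).2.1]
    exact h3 S hSc ((hconv hc _ h1 S hSc).2.2.2 hset)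
  · by_contra hlt
    exact hs.2 i hi S hSc ((hconv hs.1 i hi S hSc).2.2.2 (hs.1.stable.settles hL hSc hb
      (hU i (hs.1.subset hi)).1 (hs.1.notMem hnod hi hSc) hacc (not_le.1 hlt)))

end Last

/-! ### Stability of the final partition -/

section Final

variable {α : Type} [DecidableEq α] {M : ℕ} [hM : Fact (4 ≤ M)]
variable {A A' A₁ A₁' B₁ B₁' : List α} {pref pref' : α → ℚ → ℚ → Comp Bool} {rank : α → ℚ → ℕ}
  {peak : α → ℚ} {a b₀ : ℕ} {U U' V V' S T Q : List α} {i j b : α}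
  {L L' K K' pairs : List (List α)}

theorem rat_compl (hd : (A ++ A').Nodup) (hS : S ≠ []) (hU : ∀ j ∈ S, j ∈ A ∨ j ∈ A') :
    rat A' S = 1 - rat A S := by
  have h1 := List.length_eq_countP_add_countP (l := S) (fun x => decide (x ∈ A))
  have h2 : S.countP (fun x => ¬ decide (x ∈ A)) = S.countP (fun x => decide (x ∈ A')) := by
    refine List.countP_congr fun x hx => ?_
    simp only [decide_eq_true_eq]
    exact ⟨fun h => (hU x hx).resolve_left h, fun h h' => (List.disjoint_of_nodup_append hd) h' h⟩
  have h3 : (S.length : ℚ) ≠ 0 := by simpa using hS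
  unfold rat
  rw [h2] at h1
  rw [eq_sub_iff_add_eq, ← add_div, ← Nat.cast_add, add_comm, ← h1, div_self h3]

theorem OneBlue.mono (h : OneBlue A₁ A₁' S b) (hA : A₁ ⊆ A) (hA' : A₁' ⊆ A') : OneBlue A A' S b :=
  ⟨h.nodup, h.mem, hA' h.blue, fun j hj hjb => hA (h.reds j hj hjb)⟩

/-- A red agent of high peak who is not beyond her virtual peak rejects every blue agent. -/
theorem SinglePeakedRank.rejects {rank : ℚ → ℕ} {p : ℚ} {w m n : ℕ}
    (h : SinglePeakedRank rank p (ratios a b₀)) (hu : Unimodal (fun n => rank (lad n)) w m)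
    (hb : 2 ≤ b₀) (hp : 1 / 2 ≤ p) (hn : 2 ≤ n) (hnw : n ≤ w) (hna : n ≤ a + 1) :
    rank (lad n) < rank (((n : ℚ) - 1) / (n + 1)) := by
  obtain ⟨k, rfl⟩ : ∃ k, n = k + 2 := ⟨n - 2, by omega⟩
  have hx : (((k + 2 : ℕ) : ℚ) - 1) / ((k + 2 : ℕ) + 1) = ((k + 1 : ℕ) : ℚ) / ((k + 1 : ℕ) + (2 : ℕ)) := by
    push_cast
    congr 1 <;> ring
  have hxm : (((k + 2 : ℕ) : ℚ) - 1) / ((k + 2 : ℕ) + 1) ∈ ratios a b₀ :=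
    ⟨k + 1, 2, by omega, hb, by omega, hx⟩
  rw [hx] at hxm ⊢
  have hn := lad_mem_ratios (a := a) (b := b₀) (n := k + 2) (by omega) (by omega) hna
  rcases Nat.eq_zero_or_pos k with rfl | hk
  · refine h.left _ hxm _ hn ?_ ?_
    · rw [lad_two]
      norm_num
    · rw [lad_two]
      exact hp
  · have h1 := lad_mem_ratios (a := a) (b := b₀) (n := k + 1) (by omega) (by omega) (by omega)
    have h2 : rank (lad (k + 2)) < rank (lad (k + 1)) := hu.dec (k + 1) (k + 2) (by omega) (by omega) hnw
    -- With `n = k + 2 ≤ w` the ratio `lad (n - 1)` is worse than `lad n`, so it lies below the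
    -- peak. For `k ≥ 1` the ratio `(n - 1) / (n + 1)` is at most `lad (n - 1)`, hence no better
    -- than it; the case `n = 2` is `1/3 < 1/2 ≤ p`.
    have h3 : lad (k + 1) < p := by
      by_contra hcon
      exact absurd (h.right _ hn _ h1 (lad_lt_lad (by omega) (by omega)) (not_lt.1 hcon)) (by omega)
    have h4 : ((k + 1 : ℕ) : ℚ) / ((k + 1 : ℕ) + (2 : ℕ)) ≤ lad (k + 1) := by
      rw [lad_eq_div, div_le_div_iff₀ (by positivity) (by positivity)]
      have : (1 : ℚ) ≤ k := by exact_mod_cast hk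
      push_cast
      nlinarith
    rcases h4.lt_or_eq with h5 | h5
    · exact h2.trans (h.left _ hxm _ h1 h5 h3.le)
    · rw [h5]
      exact h2

/-- The final configuration, seen from the agents in `A`. -/
structure Configuration (A A' A₁ A₁' B₁ B₁' : List α) (rank : α → ℚ → ℕ) (peak : α → ℚ)
    (U : List α) (L : List (List α)) (U' : List α) (L' : List (List α))
    (V : List α) (K : List (List α)) (V' : List α) (K' : List (List α)) (pairs : List (List α)) :
    Prop where
  subA : A₁ ⊆ A
  subA' : A₁' ⊆ A'
  subB : B₁ ⊆ A'
  subB' : B₁' ⊆ A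
  nodup : (A₁ ++ A₁').Nodup
  nodup' : (B₁ ++ B₁').Nodup
  subU : U ⊆ A₁
  subV : V ⊆ B₁
  own : SideResult A₁ A₁' rank peak U L U' L'
  other : SideResult B₁ B₁' (fun i θ => rank i (1 - θ)) (fun i => 1 - peak i) V K V' K'
  pair : ∀ Q ∈ pairs, Q.length = 2 ∧ (∃ b, OneBlue A A' Q b) ∧ (∃ j ∈ Q, peak j < 1 / 2) ∧
    ∀ i ∈ Q, i ∈ A → i ∈ A₁ ∧ i ∉ L.flatten ∧ rank i (1 / 2) ≤ rank i 1
  exhausted : (∀ i ∈ U, ¬ rank i (1 / 2) < rank i 1) ∨ ∀ j ∈ V, ¬ rank j (1 / 2) < rank j 0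

/-- The coalitions of the final partition. -/
def IsFinal (U' : List α) (L' : List (List α)) (V' : List α) (K' pairs : List (List α))
    (T : List α) : Prop :=
  T ∈ L' ∨ T ∈ K' ∨ T ∈ pairs ∨ (∃ i ∈ U', T = [i]) ∨ ∃ j ∈ V', T = [j]

namespace Configuration

/-- These are the facts about `i` in her own coalition that bound every offer she may get: ratio `1`
from agents of her colour, `1/2` from a single agent of the other colour, and joining a mixed
coalition of her side. Only agents left unmatched by the pairing phase may be worse off than at
`1/2`. -/
theorem content (hG : Side M A A' pref rank peak a b₀)
    (h : Configuration A A' A₁ A₁' B₁ B₁' rank peak U L U' L' V K V' K' pairs)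
    (hG' : Side M A' A pref' (fun i θ => rank i (1 - θ)) (fun i => 1 - peak i) b₀ a)
    (hT : IsFinal U' L' V' K' pairs T) (hi : i ∈ A) (hiT : i ∈ T) :
    rank i (rat A T) ≤ rank i 1 ∧
    (rank i (rat A T) ≤ rank i (1 / 2) ∨ i ∈ U) ∧
    ∀ S ∈ L', (∃ j ∈ S, j ∉ A₁) → i ∉ S → Accepts A rank i S →
      rank i (rat A T) ≤ rank i (rat A (i :: S)) := by
  have hd := hG.nodup
  have hS₁ := hG.sub h.subA h.subA' (List.nodup_append.1 h.nodup).1 (List.nodup_append.1 h.nodup).2.1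
  have hS₂ := hG'.sub h.subB h.subB' (List.nodup_append.1 h.nodup').1 (List.nodup_append.1 h.nodup').2.1
  have hiA' : i ∉ A' := hG.ladder.notMem hi
  have hmem : ∀ S ∈ L', ∀ j ∈ S, j ∈ A₁ ∨ j ∈ A₁' := fun S hS j hj => by
    rcases h.own.stable.kind S hS with hk | hk
    · exact Or.inl (hk j hj)
    · exact hk.mem_or hj
  have hcons : ∀ S ∈ L', i ∈ A₁ → rat A (i :: S) = rat A₁ (i :: S) ∧
      (Accepts A rank i S ↔ Accepts A₁ rank i S) := fun S hS hi₁ =>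
    ⟨rat_congr hd h.subA h.subA' (by simpa using ⟨Or.inl hi₁, hmem S hS⟩),
      accepts_congr hd h.subA h.subA' (hmem S hS) hi₁⟩
  rcases hT with hT | hT | hT | ⟨x, hx, rfl⟩ | ⟨x, hx, rfl⟩
  · have hi₁ : i ∈ A₁ := (hmem T hT i hiT).resolve_right fun h' => hiA' (h.subA' h')
    rw [rat_congr hd h.subA h.subA' (hmem T hT)]
    refine ⟨h.own.stable.rational T hT i hiT hi₁, h.own.atLeastHalf T hT i hiT hi₁,
      fun S hS _ hiS hacc => ?_⟩
    rw [(hcons S hS hi₁).1]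
    exact h.own.stable.stable T hT i hiT hi₁ S hS hiS ((hcons S hS hi₁).2.1 hacc)
  -- Here `i` is the only member of her colour in a coalition of the other side. Then her peak is at
  -- most `1/2` and she likes her ratio at least as much as `1/2`. Both `1` and the ratio `lad (|S|
  -- + 1)` of a mixed coalition of her side are worse, being further right.
  · have hb : ∃ j ∈ T, j ∉ B₁ := ⟨i, hiT, fun h' => hiA' (h.subB h')⟩
    obtain ⟨b, h1, h2, h3, hr, -⟩ := h.other.stable.proper hT hb
    obtain rfl : i = b := by
      by_contra hib
      exact hiA' (h.subB (h1.reds i hiT hib))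
    have h4 := h1.two_le hS₂.ladder (hr.imp fun r hr => ⟨hr.1, hr.2.1⟩)
    have hhalf : rank i (rat A T) ≤ rank i (1 / 2) := by
      have hu := h1.uni hS₂.ladder (Or.inr h1.blue)
      have h5 : rank i (1 - lad T.length) ≤ rank i (1 - lad 2) := by
        rcases h4.lt_or_eq with h4 | h4
        · exact (hu.dec 2 _ (by omega) h4 h3).le
        · rw [← h4]
      have h6 := (h1.mono h.subB h.subB').rat_eq hG'.ladder
      rw [rat_compl hd (List.ne_nil_of_mem hiT)
        fun j hj => ((h1.mono h.subB h.subB').mem_or hj).symm] at h6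
      rw [← h6, lad_two] at h5
      norm_num at h5 ⊢
      exact h5
    have hp : peak i ≤ 1 / 2 := by linarith
    have ha : 1 ≤ a := (List.length_pos_of_mem hi).trans_le hG.lenA
    obtain ⟨r, hrT, hrB, -⟩ := hr
    have hb₀ : 1 ≤ b₀ := (List.length_pos_of_mem (h.subB hrB)).trans_le hG.lenA'
    have hsp := hG.single i (Or.inl hi)
    refine ⟨hhalf.trans (hsp.right _ (one_mem_ratios ha) _ (half_mem_ratios ha hb₀) (by norm_num)
      hp).le, Or.inl hhalf, fun S hS hbS hiS _ => hhalf.trans ?_⟩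
    obtain ⟨c, h5, -, -, hrS, -⟩ := h.own.stable.proper hS hbS
    have h6 := h5.two_le hS₁.ladder (hrS.imp fun r hr => ⟨hr.1, hr.2.1⟩)
    have h7 := h5.mono h.subA h.subA'
    have h8 := (h7.cons hi hiS).length_le
    rw [List.length_cons] at h8
    have h9 := hG.lenA
    rw [h7.rat_cons hG.ladder hi hiS, ← lad_two]
    exact (hsp.right _ (lad_mem_ratios hb₀ (by omega) (by omega)) _
      (lad_mem_ratios hb₀ (by omega) (by omega)) (lad_lt_lad (by omega) (by omega))
      (by rw [lad_two]; exact hp)).le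
  · obtain ⟨h1, ⟨b, h2⟩, -, h3⟩ := h.pair T hT
    obtain ⟨hi₁, hiL, h4⟩ := h3 i hiT hi
    rw [h2.rat_eq hG.ladder, h1, lad_two]
    refine ⟨h4, Or.inl le_rfl, fun S hS hbS hiS hacc => ?_⟩
    rw [(hcons S hS hi₁).1]
    exact h.own.left i hi₁ hiL S hS hbS hiS ((hcons S hS hi₁).2.1 hacc)
  · obtain rfl : i = x := by simpa using hiT
    have hi₁ := h.subU (h.own.subset hx)
    rw [rat_eq_one (S := [i]) (by simp) (by simpa using hi)]
    refine ⟨le_rfl, Or.inr (h.own.subset hx), fun S hS hbS _ hacc => ?_⟩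
    rw [(hcons S hS hi₁).1]
    exact h.own.stay i hx S hS hbS ((hcons S hS hi₁).2.1 hacc)
  · obtain rfl : i = x := by simpa using hiT
    exact absurd (h.subB (h.subV (h.other.subset hx))) hiA'

/-- A coalition of the other side rejects `i`. -/
theorem other_rejects (hG : Side M A A' pref rank peak a b₀)
    (h : Configuration A A' A₁ A₁' B₁ B₁' rank peak U L U' L' V K V' K' pairs)
    (hG' : Side M A' A pref' (fun i θ => rank i (1 - θ)) (fun i => 1 - peak i) b₀ a)
    (hS : S ∈ K') (hi : i ∈ A) (hiS : i ∉ S) : ¬ Accepts A rank i S := by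
  intro hacc
  have hd := hG.nodup
  have hS₂ := hG'.sub h.subB h.subB' (List.nodup_append.1 h.nodup').1 (List.nodup_append.1 h.nodup').2.1
  rcases h.other.stable.kind S hS with hk | ⟨b, h1, -, h3, ⟨r, hr, hrB, hrp, hrw⟩, -⟩
  -- A singleton in the output of the other side stems from its `S_0`; its member is at least as
  -- happy alone as at `1/2`, the ratio after `i` joins.
  · obtain ⟨j, rfl, h1⟩ := h.other.single S hS hk
    have hj := h.subB (hk j (by simp))
    have h2 : OneBlue A A' [j] j := ⟨by simp, by simp, hj, by simp⟩
    have h3 := (h2.accepts_iff hG.ladder hi hiS).1 hacc j (by simp)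
    rw [rat_eq_one (by simp) hk] at h1
    simp only [List.length_cons, List.length_nil, zero_add, lad_one, lad_two, Nat.reduceAdd] at h3
    norm_num at h1 h3
    omega
  · have h4 := h1.two_le hS₂.ladder ⟨r, hr, hrB⟩
    have h5 := h1.mono h.subB h.subB'
    have hUS : ∀ j ∈ S, j ∈ A ∨ j ∈ A' := fun j hj => (h5.mem_or hj).symm
    have h6 := h5.rat_eq hG'.ladder
    have hb : b ≠ i := fun hbi => hiS (hbi ▸ h1.mem)
    have ha : 2 ≤ a := by
      refine le_trans ?_ hG.lenA
      have : [b, i].Nodup := by simpa using hb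
      exact (this.subperm (l₂ := A) (by simpa using ⟨h.subB' h1.blue, hi⟩)).length_le
    -- The majority member `r` of high peak vetoes a second minority agent, who would change the
    -- ratio from `lad |S|` to `(|S| - 1) / (|S| + 1)`. That `b` and `i` are two agents of `A`
    -- ensures that this ratio is in the domain of the ranks.
    have h7 := (hG'.single r (Or.inl (h.subB hrB))).rejects (h1.uni hS₂.ladder (Or.inl hrB)) ha hrp h4
      hrw (h5.length_le.trans (Nat.succ_le_succ hG'.lenA))
    have hSne : (S.length : ℚ) ≠ 0 := by
      have : S.length ≠ 0 := by omega
      exact_mod_cast this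
    have hc : rat A' (i :: S) = ((S.length : ℚ) - 1) / (S.length + 1) := by
      have h8 : (S.countP (fun x => decide (x ∈ A')) : ℚ) = S.length - 1 := by
        unfold rat lad at h6
        rw [div_eq_iff hSne, sub_mul, one_mul, one_div, inv_mul_cancel₀ hSne] at h6
        exact h6
      unfold rat
      rw [List.countP_cons_of_neg (by simpa using hG.ladder.notMem hi), h8, List.length_cons]
      push_cast
      rfl
    rw [rat_compl hd (by simp) (by simpa using ⟨Or.inl hi, hUS⟩)] at hc
    rw [rat_compl hd (List.ne_nil_of_mem hr) hUS] at h6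
    rw [← h6, ← hc] at h7
    simp only [sub_sub_cancel] at h7
    rcases hacc r hr with h8 | h8
    · rw [h8] at h7
      omega
    · omega

/-- Mixed coalitions of the own side are unattractive, those of the other side reject `i`, and pairs
are closed by their member of peak below `1/2`. Own singletons offer ratio `1`. A singleton of the
other colour offers `1/2`: if this tempts `i`, she was left over by the pairing, and then either she
does not prefer `1/2` to being alone or, that side being exhausted, the other agent rejects. -/
theorem stable (hG : Side M A A' pref rank peak a b₀)
    (h : Configuration A A' A₁ A₁' B₁ B₁' rank peak U L U' L' V K V' K' pairs)
    (hG' : Side M A' A pref' (fun i θ => rank i (1 - θ)) (fun i => 1 - peak i) b₀ a)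
    (hT : IsFinal U' L' V' K' pairs T) (hi : i ∈ A) (hiT : i ∈ T)
    (hS : IsFinal U' L' V' K' pairs S) (hiS : i ∉ S) (hacc : Accepts A rank i S) :
    rank i (rat A T) ≤ rank i (rat A (i :: S)) := by
  obtain ⟨h1, h2, h3⟩ := h.content hG hG' hT hi hiT
  rcases hS with hS | hS | hS | ⟨x, hx, rfl⟩ | ⟨x, hx, rfl⟩
  · by_cases hb : ∃ j ∈ S, j ∉ A₁
    · exact h3 S hS hb hiS hacc
    · push Not at hb
      rw [rat_eq_one (S := i :: S) (by simp) (by simpa using ⟨hi, fun j hj => h.subA (hb j hj)⟩)]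
      exact h1
  · exact absurd hacc (h.other_rejects hG hG' hS hi hiS)
  · obtain ⟨h4, ⟨b, h5⟩, ⟨j, hj, hjp⟩, -⟩ := h.pair S hS
    have h6 := (h5.accepts_iff hG.ladder hi hiS).1 hacc j hj
    have h7 := (h5.cons hi hiS).length_le
    have h8 := hG.lenA
    have hb₀ : 1 ≤ b₀ := (List.length_pos_of_mem h5.blue).trans_le hG.lenA'
    rw [List.length_cons] at h7
    rw [h4] at h6 h7
    have h9 := (hG.single j (h5.mem_or hj)).right _ (lad_mem_ratios (n := 2 + 1) hb₀ (by omega) (by omega)) _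
      (lad_mem_ratios (n := 2) hb₀ (by omega) (by omega)) (lad_lt_lad (by omega) (by omega))
      (by rw [lad_two]; exact hjp.le)
    omega
  · have hxA := h.subA (h.subU (h.own.subset hx))
    rw [rat_eq_one (S := [i, x]) (by simp) (by simpa using ⟨hi, hxA⟩)]
    exact h1
  · have hxA := h.subB (h.subV (h.other.subset hx))
    have h5 : OneBlue A A' [x] x := ⟨by simp, by simp, hxA, by simp⟩
    have h6 := (h5.accepts_iff hG.ladder hi hiS).1 hacc x (by simp)
    rw [h5.rat_cons hG.ladder hi hiS]
    simp only [List.length_cons, List.length_nil, zero_add, lad_one, lad_two, Nat.reduceAdd] at h6 ⊢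
    rcases h2 with h2 | h2
    · exact h2
    · rcases h.exhausted with h7 | h7
      · exact h1.trans (not_lt.1 (h7 i h2))
      · exact absurd h6 (h7 x (h.other.subset hx))

end Configuration

end Final

/-! ### The main algorithm -/

section Main

variable {α : Type} [DecidableEq α] {M : ℕ} [hM : Fact (4 ≤ M)]

/-- No agent in `A` has an IS-deviation within the list `P` of coalitions or to her singleton. -/
def StableFor (A : List α) (rank : α → ℚ → ℕ) (P : List (List α)) : Prop :=
  ∀ T ∈ P, ∀ i ∈ T, i ∈ A → rank i (rat A T) ≤ rank i 1 ∧
    ∀ S ∈ P, i ∉ S → Accepts A rank i S → rank i (rat A T) ≤ rank i (rat A (i :: S))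

/-- The properties of the list `pairs` formed from `reds` and `blues`. -/
structure Paired (reds blues : List α) (pairs : List (List α)) : Prop where
  pair : ∀ Q ∈ pairs, ∃ r ∈ reds, ∃ b ∈ blues, Q = [r, b]
  nodup : pairs.flatten.Nodup
  exhausted : (∀ r ∈ reds, r ∈ pairs.flatten) ∨ ∀ b ∈ blues, b ∈ pairs.flatten

/-- The members of a list who are in none of the given coalitions. -/
def rest (l : List α) (coals : List (List α)) : List α :=
  l.filter fun i => decide (i ∉ coals.flatten)

theorem mem_rest {l : List α} {coals : List (List α)} {i : α} :
    i ∈ rest l coals ↔ i ∈ l ∧ i ∉ coals.flatten := by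
  simp only [rest, List.mem_filter, decide_eq_true_eq]

theorem rest_subset (l : List α) (coals : List (List α)) : rest l coals ⊆ l :=
  fun _ hi => (mem_rest.1 hi).1

theorem rest_append_perm {l l' : List α} {coals : List (List α)} (hl : (l ++ l').Nodup)
    (hc : coals.flatten.Nodup) (hsub : coals.flatten ⊆ l ++ l') :
    (rest l coals ++ (rest l' coals ++ coals.flatten)).Perm (l ++ l') := by
  rw [← List.append_assoc, rest, rest, ← List.filter_append]
  refine (List.perm_ext_iff_of_nodup ?_ hl).2 fun i => ?_
  · refine List.nodup_append'.2 ⟨hl.filter _, hc, fun i hi => ?_⟩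
    simpa using (List.mem_filter.1 hi).2
  · by_cases hi : i ∈ coals.flatten
    · exact iff_of_true (List.mem_append_right _ hi) (hsub hi)
    · rw [List.mem_append, List.mem_filter]
      simp only [hi, not_false_eq_true, decide_true, and_true, or_false]

theorem Side.runs_uncovered {l : List α} {coals : List (List α)} (hl : l.length < M)
    (hc : coals.flatten.length + coals.length + 1 ≤ M ^ 2) :
    Runs M 4 (uncovered l coals) (fun r => r = rest l coals) := by
  refine Runs.charge_bind (k := 3) ?_ (Runs.pure rfl)
  rw [pow_succ']
  exact Nat.mul_le_mul hl hc

theorem runs_formPairs {reds blues : List α} (hn : (reds ++ blues).Nodup) (hr : reds.length < M)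
    (hb : blues.length < M) :
    Runs M 9 (formPairs reds blues) (Paired reds blues) := by
  unfold formPairs
  refine Runs.bind (k := 8) (Runs.repeatLoop (k := 6) (j := 1)
    (fun s : List α × List α × List (List α) =>
      (s.1 ++ (s.2.1 ++ s.2.2.flatten)).Perm (reds ++ blues) ∧ s.1 ⊆ reds ∧ s.2.1 ⊆ blues ∧
      s.1.length < M ∧ s.2.1.length < M ∧ ∀ Q ∈ s.2.2, ∃ r ∈ reds, ∃ b ∈ blues, Q = [r, b])
    (fun s => s.1 = [] ∨ s.2.1 = []) (fun s => s.1.length) ?_ ?_ (by rw [pow_one]; exact hr)) ?_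
  · rintro ⟨l, l', P⟩ ⟨h1, h2, h3, h4, h5, h6⟩
    simp only at h1 h2 h3 h4 h5 h6
    refine Runs.charge_bind (k := 5) (one_le_pow_of_fact M _) ?_
    split
    · next hnil => exact Runs.pure ⟨fun _ => by simpa using hnil, by simp⟩
    · next hnil =>
      simp only [Bool.or_eq_true, List.isEmpty_iff, not_or] at hnil
      refine Runs.bind (k := 4) (Runs.pick hnil.1) fun r hr => ?_
      refine Runs.bind (k := 3) (Runs.pick hnil.2) fun b hb => ?_
      refine Runs.bind (k := 2) (runs_removeAgent h4) ?_
      rintro _ rfl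
      have hpos : 0 < l.length := List.length_pos_of_mem hr
      have hlen : (l.erase r).length = l.length - 1 := List.length_erase_of_mem hr
      refine RunsIn.mono (RunsIn.bind (T' := 0) (runs_removeAgent h5) ?_) (by simp) fun _ hb => hb
      rintro _ rfl
      refine RunsIn.pure ⟨by simp, fun s' hs' => ?_⟩
      simp only [Option.some.injEq] at hs'
      subst hs'
      refine ⟨⟨?_, fun i hi => h2 (List.mem_of_mem_erase hi), fun i hi => h3 (List.mem_of_mem_erase hi),
        by simp only; omega, lt_of_le_of_lt List.length_erase_le h5, ?_⟩, by simp only; omega⟩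
      · refine List.Perm.trans ?_ h1
        have e1 := List.perm_cons_erase hr
        have e2 := List.perm_cons_erase hb
        rw [List.perm_iff_count] at e1 e2 ⊢
        intro x
        have e1 := e1 x
        have e2 := e2 x
        simp only [List.flatten_cons, List.count_append, List.count_cons, List.count_nil] at e1 e2 ⊢
        omega
      · simp only [List.mem_cons, forall_eq_or_imp]
        exact ⟨⟨r, h2 hr, b, h3 hb, rfl⟩, h6⟩
  · exact ⟨by simp, fun _ h => h, fun _ h => h, hr, hb, by simp⟩
  · rintro ⟨l, l', P⟩ ⟨⟨h1, h2, h3, h4, h5, h6⟩, h7⟩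
    simp only at h1 h2 h3 h4 h5 h6 h7
    have hn' := h1.nodup_iff.2 hn
    refine Runs.pure ⟨h6, (List.nodup_append.1 (List.nodup_append.1 hn').2.1).2.1, ?_⟩
    have hdis := List.disjoint_of_nodup_append hn
    refine h7.imp (fun h r hr => ?_) fun h b hb => ?_
    · have := h1.mem_iff.2 (List.mem_append_left _ hr)
      rw [h, List.nil_append, List.mem_append] at this
      exact this.resolve_left fun h' => hdis hr (h3 h')
    · have := h1.mem_iff.2 (List.mem_append_right _ hb)
      rw [h, List.nil_append, List.mem_append] at this
      exact this.resolve_left fun h' => hdis (h2 h') hb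

variable {A A' B₁ R₁ R₂ B₂ reds blues U' V' l β l' β' : List α} {pref pref' : α → ℚ → ℚ → Comp Bool}
  {rank : α → ℚ → ℕ} {peak : α → ℚ} {a b₀ : ℕ} {L K L' K' pairs : List (List α)}

theorem HalfResult.flatten_subset (h : HalfResult A A' rank peak l β L) : L.flatten ⊆ A ++ A' := by
  intro i hi
  obtain ⟨S, hS, hiS⟩ := List.mem_flatten.1 hi
  exact List.mem_append.2 (h.mem_or hS hiS)

theorem HalfResult.flatten_nodup (h : HalfResult A A' rank peak l β L) (hd : (A ++ A').Nodup) :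
    L.flatten.Nodup :=
  (List.nodup_append.1 (List.nodup_append.1 (h.nodup hd)).2.1).2.1

/-- The output of the algorithm is a stable partition. -/
theorem stable_of_phases (hG : Side M A A' pref rank peak a b₀)
    (hG' : Side M A' A pref' (fun i θ => rank i (1 - θ)) (fun i => 1 - peak i) b₀ a)
    (hL : HalfResult A A' rank peak l β L) (hR₁ : R₁ = rest A L) (hB₁ : B₁ = rest A' L)
    (hK : HalfResult B₁ R₁ (fun i θ => rank i (1 - θ)) (fun i => 1 - peak i) l' β' K)
    (hR₂ : R₂ = rest R₁ K) (hB₂ : B₂ = rest B₁ K)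
    (hp : Paired (R₂.filter fun r => rank r (1 / 2) < rank r 1)
      (B₂.filter fun b => rank b (1 / 2) < rank b 0) pairs)
    (hown : SideResult A A' rank peak (rest R₂ pairs) L U' L')
    (hother : SideResult B₁ R₁ (fun i θ => rank i (1 - θ)) (fun i => 1 - peak i) (rest B₂ pairs) K
      V' K')
    (P : List (List α))
    (hP : P = L' ++ K' ++ pairs ++ U'.map (fun i => [i]) ++ V'.map (fun i => [i])) :
    P.flatten.Perm (A ++ A') ∧ [] ∉ P ∧ StableFor A rank P ∧
      StableFor A' (fun i θ => rank i (1 - θ)) P := by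
  have hd := hG.nodup
  have hdis := List.disjoint_of_nodup_append hd
  have sR₁ : R₁ ⊆ A := hR₁ ▸ rest_subset _ _
  have sB₁ : B₁ ⊆ A' := hB₁ ▸ rest_subset _ _
  have sR₂ : R₂ ⊆ R₁ := hR₂ ▸ rest_subset _ _
  have sB₂ : B₂ ⊆ B₁ := hB₂ ▸ rest_subset _ _
  have e1 := rest_append_perm hd (hL.flatten_nodup hd) hL.flatten_subset
  rw [← hR₁, ← hB₁] at e1
  have hn₁ : (R₁ ++ B₁).Nodup :=
    (List.nodup_append.1 (by simpa using e1.nodup_iff.2 hd : ((R₁ ++ B₁) ++ L.flatten).Nodup)).1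
  have hn₁' : (B₁ ++ R₁).Nodup := List.perm_append_comm.nodup_iff.1 hn₁
  have e2 := rest_append_perm hn₁ (hK.flatten_nodup hn₁')
    fun i hi => List.perm_append_comm.mem_iff.1 (hK.flatten_subset hi)
  rw [← hR₂, ← hB₂] at e2
  have hn₂ : (R₂ ++ B₂).Nodup :=
    (List.nodup_append.1 (by simpa using e2.nodup_iff.2 hn₁ : ((R₂ ++ B₂) ++ K.flatten).Nodup)).1
  have hpm : ∀ Q ∈ pairs, ∃ r ∈ R₂, ∃ b ∈ B₂, rank r (1 / 2) < rank r 1 ∧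
      rank b (1 / 2) < rank b 0 ∧ Q = [r, b] := by
    intro Q hQ
    obtain ⟨r, hr, b, hb, rfl⟩ := hp.pair Q hQ
    simp only [List.mem_filter, decide_eq_true_eq] at hr hb
    exact ⟨r, hr.1, b, hb.1, hr.2, hb.2, rfl⟩
  have e3 := rest_append_perm hn₂ hp.nodup fun i hi => by
    obtain ⟨Q, hQ, hiQ⟩ := List.mem_flatten.1 hi
    obtain ⟨r, hr, b, hb, -, -, rfl⟩ := hpm Q hQ
    simp only [List.mem_cons, List.not_mem_nil, or_false] at hiQ
    rcases hiQ with rfl | rfl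
    · exact List.mem_append_left _ hr
    · exact List.mem_append_right _ hb
  have sR₃ := rest_subset R₂ pairs
  have sB₃ := rest_subset B₂ pairs
  have hexR : (∀ r ∈ R₂, rank r (1 / 2) < rank r 1 → r ∈ pairs.flatten) ∨
      ∀ b ∈ B₂, rank b (1 / 2) < rank b 0 → b ∈ pairs.flatten := by
    simpa only [List.mem_filter, decide_eq_true_eq, and_imp] using hp.exhausted
  have hex : (∀ i ∈ rest R₂ pairs, ¬ rank i (1 / 2) < rank i 1) ∨
      ∀ j ∈ rest B₂ pairs, ¬ rank j (1 / 2) < rank j 0 :=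
    hexR.imp (fun h i hi h' => (mem_rest.1 hi).2 (h i (sR₃ hi) h'))
      fun h i hi h' => (mem_rest.1 hi).2 (h i (sB₃ hi) h')
  have hc : Configuration A A' A A' B₁ R₁ rank peak (rest R₂ pairs) L U' L' (rest B₂ pairs) K V' K'
      pairs := by
    refine ⟨fun _ h => h, fun _ h => h, sB₁, sR₁, hd, hn₁', fun i hi => sR₁ (sR₂ (sR₃ hi)),
      fun i hi => sB₂ (sB₃ hi), hown, hother, fun Q hQ => ?_, hex⟩
    obtain ⟨r, hr, b, hb, h1, h2, rfl⟩ := hpm Q hQ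
    have hr1 := sR₂ hr
    have hb1 := sB₂ hb
    have hrA := sR₁ hr1
    have hbA := sB₁ hb1
    have hne : r ≠ b := fun h => hdis hrA (h ▸ hbA)
    rw [hR₁, mem_rest] at hr1
    rw [hB₁, mem_rest] at hb1
    refine ⟨rfl, ⟨b, by simpa using hne, by simp, hbA, by simp [hrA]⟩, ?_, ?_⟩
    · simpa using hL.low_peak hd hr1.1 hr1.2 hb1.1 hb1.2
    · simp only [List.mem_cons, List.not_mem_nil, or_false]
      rintro i (rfl | rfl) hi
      · exact ⟨hi, hr1.2, h1.le⟩
      · exact absurd hbA (hdis hi)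
  -- The same configuration seen from the blue agents, with ratios reflected: now the second run of
  -- `half` is the own side, and reflecting twice restores the original ranks and peaks.
  have hc' : Configuration A' A B₁ R₁ A A' (fun i θ => rank i (1 - θ)) (fun i => 1 - peak i)
      (rest B₂ pairs) K V' K' (rest R₂ pairs) L U' L' pairs := by
    refine ⟨sB₁, sR₁, fun _ h => h, fun _ h => h, hn₁', hd, fun i hi => sB₂ (sB₃ hi),
      fun i hi => sR₁ (sR₂ (sR₃ hi)), hother, by simpa only [sub_sub_cancel] using hown,
      fun Q hQ => ?_, ?_⟩
    · obtain ⟨r, hr, b, hb, h1, h2, rfl⟩ := hpm Q hQ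
      have hr1 := sR₂ hr
      have hb1 := sB₂ hb
      have hrA := sR₁ hr1
      have hbA := sB₁ hb1
      have hne : r ≠ b := fun h => hdis hrA (h ▸ hbA)
      rw [hR₂, mem_rest] at hr
      rw [hB₂, mem_rest] at hb
      refine ⟨rfl, ⟨r, by simpa using hne, by simp, hrA, by simp [hbA]⟩, ?_, ?_⟩
      · simpa [or_comm] using hK.low_peak hn₁' hb.1 hb.2 hr.1 hr.2
      · simp only [List.mem_cons, List.not_mem_nil, or_false]
        rintro i (rfl | rfl) hi
        · exact absurd hi (hdis hrA)
        · refine ⟨hb1, hb.2, ?_⟩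
          norm_num at h2 ⊢
          exact h2.le
    · norm_num at hex ⊢
      exact hex.symm
  have hfin : ∀ T, T ∈ P ↔ IsFinal U' L' V' K' pairs T := by
    intro T
    rw [hP]
    simp only [List.mem_append, List.mem_map, IsFinal, eq_comm (b := T), or_assoc]
  have hfin' : ∀ T, T ∈ P ↔ IsFinal V' K' U' L' pairs T := by
    intro T
    rw [hfin]
    exact or_left_comm.trans (or_congr Iff.rfl (or_congr Iff.rfl (or_congr Iff.rfl or_comm)))
  have hG'' : Side M A A' pref (fun i θ => rank i (1 - (1 - θ))) (fun i => 1 - (1 - peak i)) a b₀ := by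
    simpa only [sub_sub_cancel] using hG
  refine ⟨?_, ?_, fun T hT i hiT hi => ?_, fun T hT i hiT hi => ?_⟩
  · have e4 := hown.perm
    have e5 := hother.perm
    have hflat : P.flatten = L'.flatten ++ (K'.flatten ++ (pairs.flatten ++ (U' ++ V'))) := by
      have : ∀ l : List α, (l.map fun i => [i]).flatten = l := fun l => by
        induction l with
        | nil => rfl
        | cons x l ih => simp [ih]
      rw [hP]
      simp only [List.flatten_append, this, List.append_assoc]
    rw [hflat]
    rw [List.perm_iff_count] at e1 e2 e3 e4 e5 ⊢
    intro x
    have e1 := e1 x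
    have e2 := e2 x
    have e3 := e3 x
    have e4 := e4 x
    have e5 := e5 x
    simp only [List.count_append] at e1 e2 e3 e4 e5 ⊢
    omega
  · intro h
    rcases (hfin _).1 h with h | h | h | ⟨x, hx, h⟩ | ⟨x, hx, h⟩
    · exact hown.nonempty _ h rfl
    · exact hother.nonempty _ h rfl
    · obtain ⟨r, -, b, -, -, -, h⟩ := hpm _ h
      simp at h
    · simp at h
    · simp at h
  · refine ⟨(hc.content hG hG' ((hfin T).1 hT) hi hiT).1, fun S hS hiS hacc => ?_⟩
    exact hc.stable hG hG' ((hfin T).1 hT) hi hiT ((hfin S).1 hS) hiS hacc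
  · refine ⟨(hc'.content hG' hG'' ((hfin' T).1 hT) hi hiT).1, fun S hS hiS hacc => ?_⟩
    exact hc'.stable hG' hG'' ((hfin' T).1 hT) hi hiT ((hfin' S).1 hS) hiS hacc

/-- A run of the algorithm takes polynomially many steps and returns a stable partition. -/
theorem runs_stablePartition {I : GameInput α}
    (hG : Side M I.red I.blue I.prefers rank peak a b₀)
    (hG' : Side M I.blue I.red I.prefersBlue (fun i θ => rank i (1 - θ)) (fun i => 1 - peak i) b₀ a) :
    Runs M 60 (stablePartition I peak) (fun P => P.flatten.Perm (I.red ++ I.blue) ∧ [] ∉ P ∧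
      StableFor I.red rank P ∧ StableFor I.blue (fun i θ => rank i (1 - θ)) P) := by
  have hlarge := hG.large
  have hlenA := hG.lenA
  have hlenA' := hG.lenA'
  have hd := hG.nodup
  have hM2 : 4 * M ≤ M ^ 2 := by rw [sq]; exact Nat.mul_le_mul_right _ hM.out
  have hcoals : ∀ c : List (List α), c.flatten.Nodup → (∀ S ∈ c, S ≠ []) →
      (∀ i ∈ c.flatten, i ∈ I.red ∨ i ∈ I.blue) →
      c.length ≤ c.flatten.length ∧ c.flatten.length ≤ a + b₀ := by
    refine fun c h1 h2 h3 => ⟨?_, hG.length_le h1 h3⟩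
    rw [List.length_flatten]
    refine le_trans ?_ (List.length_le_sum_of_one_le (c.map List.length) ?_)
    · simp
    · intro n hn
      obtain ⟨S, hS, rfl⟩ := List.mem_map.1 hn
      exact List.length_pos_iff.2 (h2 S hS)
  unfold stablePartition
  refine Runs.bind (k := 59) (Runs.le hG.runs_half (by norm_num)) ?_
  rintro L ⟨l, β, hL⟩
  have hLc := hcoals L (hL.flatten_nodup hd) hL.nonempty
    fun i hi => List.mem_append.1 (hL.flatten_subset hi)
  refine Runs.bind (k := 58) (Runs.le (Side.runs_uncovered (by omega) (by omega)) (by norm_num)) ?_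
  intro R₁ hR₁
  refine Runs.bind (k := 57) (Runs.le (Side.runs_uncovered (by omega) (by omega)) (by norm_num)) ?_
  intro B₁ hB₁
  have sR₁ : R₁ ⊆ I.red := hR₁ ▸ rest_subset _ _
  have sB₁ : B₁ ⊆ I.blue := hB₁ ▸ rest_subset _ _
  have nR₁ : R₁.Nodup := hR₁ ▸ (List.nodup_append.1 hd).1.filter _
  have nB₁ : B₁.Nodup := hB₁ ▸ (List.nodup_append.1 hd).2.1.filter _
  have hS₁ := hG'.sub sB₁ sR₁ nB₁ nR₁
  have lR₁ := hS₁.lenA'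
  have lB₁ := hS₁.lenA
  refine Runs.bind (k := 56) (Runs.le hS₁.runs_half (by norm_num)) ?_
  rintro K ⟨l', β', hK⟩
  have hKc := hcoals K (hK.flatten_nodup hS₁.nodup) hK.nonempty fun i hi =>
    (List.mem_append.1 (hK.flatten_subset hi)).symm.imp (fun h => sR₁ h) fun h => sB₁ h
  refine Runs.bind (k := 55) (Runs.le (Side.runs_uncovered (by omega) (by omega)) (by norm_num)) ?_
  intro R₂ hR₂
  refine Runs.bind (k := 54) (Runs.le (Side.runs_uncovered (by omega) (by omega)) (by norm_num)) ?_
  intro B₂ hB₂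
  have sR₂ : R₂ ⊆ R₁ := hR₂ ▸ rest_subset _ _
  have sB₂ : B₂ ⊆ B₁ := hB₂ ▸ rest_subset _ _
  have nR₂ : R₂.Nodup := hR₂ ▸ nR₁.filter _
  have nB₂ : B₂.Nodup := hB₂ ▸ nB₁.filter _
  have lR₂ := (nR₂.subperm sR₂).length_le
  have lB₂ := (nB₂.subperm sB₂).length_le
  refine Runs.bind (k := 53) (Runs.le (Runs.select (k := 3)
    (p := fun r => rank r (1 / 2) < rank r 1)
    (fun r hr => hG.decides r (Or.inl (sR₁ (sR₂ hr))) _ _) (by omega)) (by norm_num)) ?_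
  rintro _ rfl
  refine Runs.bind (k := 52) (Runs.le (Runs.select (k := 3)
    (p := fun b => rank b (1 / 2) < rank b 0)
    (fun b hb => hG.decides b (Or.inr (sB₁ (sB₂ hb))) _ _) (by omega)) (by norm_num)) ?_
  rintro _ rfl
  refine Runs.bind (k := 51) (Runs.le (runs_formPairs ?_
    (lt_of_le_of_lt (List.length_filter_le ..) (by omega))
    (lt_of_le_of_lt (List.length_filter_le ..) (by omega))) (by norm_num)) ?_
  · refine List.nodup_append'.2 ⟨nR₂.filter _, nB₂.filter _, fun i hi hi' => ?_⟩
    exact List.disjoint_of_nodup_append hd (sR₁ (sR₂ (List.mem_of_mem_filter hi)))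
      (sB₁ (sB₂ (List.mem_of_mem_filter hi')))
  intro pairs hp
  have hpc := hcoals pairs hp.nodup (fun S hS => by
    obtain ⟨r, -, b, -, rfl⟩ := hp.pair S hS
    simp) fun i hi => by
      obtain ⟨Q, hQ, hiQ⟩ := List.mem_flatten.1 hi
      obtain ⟨r, hr, b, hb, rfl⟩ := hp.pair Q hQ
      simp only [List.mem_cons, List.not_mem_nil, or_false] at hiQ
      rcases hiQ with rfl | rfl
      · exact Or.inl (sR₁ (sR₂ (List.mem_of_mem_filter hr)))
      · exact Or.inr (sB₁ (sB₂ (List.mem_of_mem_filter hb)))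
  refine Runs.bind (k := 50) (Runs.le (Side.runs_uncovered (by omega) (by omega)) (by norm_num)) ?_
  rintro _ rfl
  refine Runs.bind (k := 49) (Runs.le (Side.runs_uncovered (by omega) (by omega)) (by norm_num)) ?_
  rintro _ rfl
  have sR₃ := rest_subset R₂ pairs
  have sB₃ := rest_subset B₂ pairs
  refine Runs.bind (k := 48) (Runs.le (hG.runs_settle_last (fun _ h => h) (fun _ h => h)
    (List.nodup_append.1 hd).1 (List.nodup_append.1 hd).2.1 hL (fun i hi => ?_) (nR₂.filter _))
    (by norm_num)) ?_
  · exact mem_rest.1 (hR₁ ▸ sR₂ (sR₃ hi))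
  rintro ⟨U', L'⟩ hown
  refine Runs.bind (k := 47) (Runs.le (hG'.runs_settle_last sB₁ sR₁ nB₁ nR₁ hK (fun i hi => ?_)
    (nB₂.filter _)) (by norm_num)) ?_
  · exact mem_rest.1 (hB₂ ▸ sB₃ hi)
  rintro ⟨V', K'⟩ hother
  have h := stable_of_phases hG hG' hL hR₁ hB₁ hK hR₂ hB₂ hp hown hother _ rfl
  refine Runs.charge_bind (k := 46) ?_ (Runs.pure h)
  have h1 := hown.len
  have h2 := hother.len
  have h3 := hown.perm.length_eq
  have h4 := hother.perm.length_eq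
  have h5 : (rest R₂ pairs).length ≤ R₂.length := List.length_filter_le ..
  have h6 : (rest B₂ pairs).length ≤ B₂.length := List.length_filter_le ..
  have h7 : 4 * M ^ 2 ≤ M ^ 46 := (four_mul_pow_le M 2).trans (pow_le_pow_of_fact (by norm_num))
  simp only [List.length_append] at h3 h4
  simp only at h1 h2 h3 h4
  omega

end Main

/-! ### Games and their descriptions -/

section Games

variable {α : Type} [DecidableEq α] {G : DiversityGame α} {I : GameInput α} {i : α}

/-- Exchanging colours maps `x / (x + y)` to `y / (x + y)`. The set `ratios a b` is invariant under
this up to swapping `a` and `b`, unlike `ratioSet`, which may contain ratios above `1`; hence ranks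
are only considered on `ratios`. -/
theorem SinglePeakedRank.mirror {rank : ℚ → ℕ} {p : ℚ} {a b : ℕ}
    (h : SinglePeakedRank rank p (ratios a b)) :
    SinglePeakedRank (fun θ => rank (1 - θ)) (1 - p) (ratios b a) := by
  have hm : ∀ θ ∈ ratios b a, 1 - θ ∈ ratios a b := by
    rintro _ ⟨x, y, hx, hy, hpos, rfl⟩
    refine ⟨y, x, hy, hx, by omega, ?_⟩
    have : (x : ℚ) + y ≠ 0 := by
      norm_cast
      omega
    rw [add_comm (y : ℚ), eq_div_iff this, sub_mul, div_mul_cancel₀ _ this]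
    ring
  exact ⟨fun x hx y hy hxy => by simpa using h.inj (hm x hx) (hm y hy) hxy,
    fun x hx y hy hxy hyp => h.right _ (hm x hx) _ (hm y hy) (by linarith) (by linarith),
    fun x hx y hy hxy hyp => h.left _ (hm x hx) _ (hm y hy) (by linarith) (by linarith)⟩

theorem ratios_subset_ratioSet (R B : Finset α) : ratios R.card B.card ⊆ ratioSet R B := by
  rintro _ ⟨x, y, hx, hy, hpos, rfl⟩
  exact ⟨x, x + y, hx, hpos, by omega, by push_cast; rfl⟩

/-- The set of ratios as a finite set. -/
def ratioFinset (R B : Finset α) : Finset ℚ :=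
  (Finset.range (R.card + 1) ×ˢ Finset.Icc 1 (R.card + B.card)).image fun x => (x.1 : ℚ) / x.2

theorem mem_ratioFinset {R B : Finset α} {θ : ℚ} : θ ∈ ratioFinset R B ↔ θ ∈ ratioSet R B := by
  simp only [ratioFinset, Finset.mem_image, Finset.mem_product, Finset.mem_range, Finset.mem_Icc,
    Prod.exists, ratioSet, Set.mem_ofPred_eq]
  exact ⟨fun ⟨r, s, ⟨h1, h2, h3⟩, h4⟩ => ⟨r, s, by omega, h2, h3, h4.symm⟩,
    fun ⟨r, s, h1, h2, h3, h4⟩ => ⟨r, s, ⟨by omega, h2, h3⟩, h4.symm⟩⟩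

theorem card_ratioFinset_le (R B : Finset α) :
    (ratioFinset R B).card ≤ (R.card + 1) * (R.card + B.card) := by
  refine Finset.card_image_le.trans ?_
  simp

/-- A finite set on which a relation is transitive and total has a sorted list. -/
theorem exists_list_pairwise {β : Type} [DecidableEq β] (r : β → β → Prop) (s : Finset β)
    (ht : ∀ a ∈ s, ∀ b ∈ s, ∀ c ∈ s, r a b → r b c → r a c)
    (hc : ∀ a ∈ s, ∀ b ∈ s, a ≠ b → r a b ∨ r b a) :
    ∃ l : List β, (∀ x, x ∈ l ↔ x ∈ s) ∧ l.Pairwise r := by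
  classical
  induction s using Finset.induction_on with
  | empty => exact ⟨[], by simp, List.Pairwise.nil⟩
  | insert x s hx ih =>
    have hsub : ∀ a ∈ s, a ∈ insert x s := fun a => Finset.mem_insert_of_mem
    have hxs := Finset.mem_insert_self x s
    obtain ⟨l, h1, h2⟩ := ih
      (fun a ha b hb c hc => ht a (hsub a ha) b (hsub b hb) c (hsub c hc))
      fun a ha b hb => hc a (hsub a ha) b (hsub b hb)
    refine ⟨l.filter (fun y => r y x) ++ x :: l.filter (fun y => r x y), fun y => ?_, ?_⟩
    · simp only [List.mem_append, List.mem_cons, List.mem_filter, h1, decide_eq_true_eq,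
        Finset.mem_insert]
      constructor
      · rintro (h | h | h)
        · exact Or.inr h.1
        · exact Or.inl h
        · exact Or.inr h.1
      · rintro (h | h)
        · exact Or.inr (Or.inl h)
        · rcases hc y (hsub y h) x hxs (fun hyx => hx (hyx ▸ h)) with h3 | h3
          · exact Or.inl ⟨h, h3⟩
          · exact Or.inr (Or.inr ⟨h, h3⟩)
    · refine List.pairwise_append.2 ⟨h2.filter _, List.pairwise_cons.2 ⟨fun y hy => ?_, h2.filter _⟩,
        fun y hy z hz => ?_⟩
      · simpa using (List.mem_filter.1 hy).2
      · simp only [List.mem_cons, List.mem_filter, h1, decide_eq_true_eq] at hy hz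
        rcases hz with rfl | hz
        · exact hy.2
        · exact ht y (hsub y hy.1) x hxs z (hsub z hz.1) hy.2 hz.2

theorem DiversityGame.exists_represents (G : DiversityGame α) :
    ∃ I : GameInput α, I.Represents G := by
  have : ∀ i, ∃ l : List ℚ, i ∈ G.agents → (∀ θ : ℚ, θ ∈ l ↔ θ ∈ ratioSet G.R G.B) ∧
      l.Pairwise (G.pref i) := by
    intro i
    by_cases hi : i ∈ G.agents
    · obtain ⟨l, h1, h2⟩ := exists_list_pairwise (G.pref i) (ratioFinset G.R G.B)
        (by simpa only [mem_ratioFinset] using G.trans i hi)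
        (by simpa only [mem_ratioFinset] using G.total i hi)
      exact ⟨l, fun _ => ⟨fun θ => (h1 θ).trans mem_ratioFinset, h2⟩⟩
    · exact ⟨[], fun h => absurd h hi⟩
  choose ranking h using this
  exact ⟨⟨G.R.toList, G.B.toList, ranking⟩, G.R.nodup_toList, G.R.toList_toFinset, G.B.nodup_toList,
    G.B.toList_toFinset, h⟩

/-! ### Reading ranks and peaks off the description of a game -/

namespace GameInput.Represents

theorem mem_red (h : I.Represents G) : i ∈ I.red ↔ i ∈ G.R := by
  rw [← h.2.1, List.mem_toFinset]

theorem mem_blue (h : I.Represents G) : i ∈ I.blue ↔ i ∈ G.B := by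
  rw [← h.2.2.2.1, List.mem_toFinset]

theorem mem_agents (h : I.Represents G) : i ∈ G.agents ↔ i ∈ I.red ∨ i ∈ I.blue := by
  rw [h.mem_red, h.mem_blue, DiversityGame.agents, Finset.mem_union]

theorem length_red (h : I.Represents G) : I.red.length = G.R.card := by
  rw [← h.2.1, List.toFinset_card_of_nodup h.1]

theorem length_blue (h : I.Represents G) : I.blue.length = G.B.card := by
  rw [← h.2.2.2.1, List.toFinset_card_of_nodup h.2.2.1]

theorem card_agents (h : I.Represents G) : G.agents.card = I.red.length + I.blue.length := by
  rw [DiversityGame.agents, Finset.card_union_of_disjoint G.disj, h.length_red, h.length_blue]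

theorem nodup (h : I.Represents G) : (I.red ++ I.blue).Nodup :=
  List.nodup_append'.2 ⟨h.1, h.2.2.1, fun _ hi hi' =>
    Finset.disjoint_left.1 G.disj (h.mem_red.1 hi) (h.mem_blue.1 hi')⟩

theorem nodup_ranking (h : I.Represents G) (hi : i ∈ G.agents) : (I.ranking i).Nodup := by
  obtain ⟨h1, h2⟩ := h.2.2.2.2 i hi
  refine h2.imp_of_mem fun {a b} ha _ hab heq => ?_
  subst heq
  exact G.irrefl i hi a ((h1 a).1 ha) hab

theorem length_ranking_le (h : I.Represents G) (hi : i ∈ G.agents) :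
    (I.ranking i).length ≤ (I.red.length + 1) * (I.red.length + I.blue.length) := by
  rw [← List.toFinset_card_of_nodup (h.nodup_ranking hi), h.length_red, h.length_blue]
  refine le_trans (Finset.card_le_card fun θ hθ => ?_) (card_ratioFinset_le G.R G.B)
  exact mem_ratioFinset.2 (((h.2.2.2.2 i hi).1 θ).1 (List.mem_toFinset.1 hθ))

theorem idxOf_lt (h : I.Represents G) (hi : i ∈ G.agents) {a b : ℚ} (ha : a ∈ ratioSet G.R G.B)
    (hb : b ∈ ratioSet G.R G.B) (hab : G.pref i a b) :
    (I.ranking i).idxOf a < (I.ranking i).idxOf b := by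
  obtain ⟨h1, h2⟩ := h.2.2.2.2 i hi
  have ha' := (h1 a).2 ha
  have hb' := (h1 b).2 hb
  by_contra hcon
  rcases (not_lt.1 hcon).lt_or_eq with hlt | heq
  · have h3 := List.pairwise_iff_getElem.1 h2 _ _ (List.idxOf_lt_length_iff.2 hb')
      (List.idxOf_lt_length_iff.2 ha') hlt
    rw [List.getElem_idxOf, List.getElem_idxOf] at h3
    exact G.irrefl i hi a ha (G.trans i hi a ha b hb a ha hab h3)
  · obtain rfl := (List.idxOf_inj hb').1 heq
    exact G.irrefl i hi _ ha hab

theorem singlePeakedRank (h : I.Represents G) (hi : i ∈ G.agents) {p : ℚ} (hp : G.IsPeak i (p : ℝ)) :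
    SinglePeakedRank (fun θ => (I.ranking i).idxOf θ) p (ratios I.red.length I.blue.length) := by
  have hsub : ratios I.red.length I.blue.length ⊆ ratioSet G.R G.B := by
    rw [h.length_red, h.length_blue]
    exact ratios_subset_ratioSet _ _
  refine ⟨fun x hx y _ hxy => (List.idxOf_inj (((h.2.2.2.2 i hi).1 x).2 (hsub hx))).1 hxy,
    fun x hx y hy hxy hyp => ?_, fun x hx y hy hxy hyp => ?_⟩
  · exact h.idxOf_lt hi (hsub hy) (hsub hx)
      (hp.2.2 x (hsub hx) y (hsub hy) (Or.inl ⟨hxy, by exact_mod_cast hyp⟩))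
  · exact h.idxOf_lt hi (hsub hy) (hsub hx)
      (hp.2.2 x (hsub hx) y (hsub hy) (Or.inr ⟨hxy, by exact_mod_cast hyp⟩))

theorem runs_prefers (h : I.Represents G) (hi : i ∈ G.agents) (a b : ℚ) :
    Runs (G.agents.card + 4) 3 (I.prefers i a b)
      (fun r => r = true ↔ (I.ranking i).idxOf a < (I.ranking i).idxOf b) := by
  refine RunsIn.mono (RunsIn.bind (T' := 0) (RunsIn.charge _) fun _ _ =>
    RunsIn.pure decide_eq_true_iff) ?_ fun _ hb => hb
  have h1 := h.length_ranking_le hi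
  rw [h.card_agents]
  nlinarith [Nat.zero_le I.red.length, Nat.zero_le I.blue.length,
    Nat.zero_le (I.red.length * I.blue.length),
    Nat.zero_le ((I.red.length + I.blue.length) ^ 3), sq_nonneg (I.red.length + I.blue.length)]

theorem side (h : I.Represents G) {peak : α → ℚ} (hp : ∀ i ∈ G.agents, G.IsPeak i (peak i : ℝ)) :
    Side (G.agents.card + 4) I.red I.blue I.prefers (fun i θ => (I.ranking i).idxOf θ) peak
      I.red.length I.blue.length where
  nodup := h.nodup
  decides i hi a b := h.runs_prefers (h.mem_agents.2 hi) a b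
  single i hi := h.singlePeakedRank (h.mem_agents.2 hi) (hp i (h.mem_agents.2 hi))
  lenA := le_rfl
  lenA' := le_rfl
  large := by rw [h.card_agents]

theorem side_blue (h : I.Represents G) {peak : α → ℚ}
    (hp : ∀ i ∈ G.agents, G.IsPeak i (peak i : ℝ)) :
    Side (G.agents.card + 4) I.blue I.red I.prefersBlue (fun i θ => (I.ranking i).idxOf (1 - θ))
      (fun i => 1 - peak i) I.blue.length I.red.length where
  nodup := List.perm_append_comm.nodup_iff.1 h.nodup
  decides i hi a b := h.runs_prefers (h.mem_agents.2 hi.symm) (1 - a) (1 - b)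
  single i hi := (h.singlePeakedRank (h.mem_agents.2 hi.symm) (hp i (h.mem_agents.2 hi.symm))).mirror
  lenA := le_rfl
  lenA' := le_rfl
  large := by rw [h.card_agents, add_comm I.red.length]

/-- The top of each ranking is a peak. -/
theorem isPeak_head (h : I.Represents G) (hG : G.SinglePeaked) (hi : i ∈ G.agents) :
    ∃ t : ℚ, (I.ranking i).head? = some t ∧ G.IsPeak i (t : ℝ) := by
  obtain ⟨h1, h2⟩ := h.2.2.2.2 i hi
  have hpos : 1 ≤ G.R.card + G.B.card := by
    rw [← Finset.card_union_of_disjoint G.disj]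
    exact Finset.card_pos.2 ⟨i, hi⟩
  cases hr : I.ranking i with
  | nil =>
    have := (h1 0).2 ⟨0, 1, Nat.zero_le _, le_rfl, hpos, by simp⟩
    simp [hr] at this
  | cons t l =>
    rw [hr] at h1 h2
    have ht := (h1 t).1 (by simp)
    have htop : ∀ x ∈ ratioSet G.R G.B, x ≠ t → G.pref i t x := fun x hx hxt =>
      (List.pairwise_cons.1 h2).1 x (((List.mem_cons).1 ((h1 x).2 hx)).resolve_left hxt)
    have htop' : ∀ x ∈ ratioSet G.R G.B, x ≠ t → ¬ G.pref i x t := fun x hx hxt hxt' =>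
      G.irrefl i hi x hx (G.trans i hi x hx t ht x hx hxt' (htop x hx hxt))
    obtain ⟨p, hp0, hp1, hp⟩ := hG i hi
    refine ⟨t, rfl, ?_, ?_, fun a ha b hb hab => ?_⟩
    · obtain ⟨r, s, -, -, -, rfl⟩ := ht
      positivity
    -- The set of ratios may contain values above `1`. Such a value cannot be on top: the ratio `1`
    -- lies between it and the peak `p ≤ 1`, and is preferred.
    · by_contra hcon
      have ht1 : (1 : ℚ) < t := by exact_mod_cast not_le.1 hcon
      have hone : (1 : ℚ) ∈ ratioSet G.R G.B := by
        obtain ⟨r, s, hr, -, -, hrs⟩ := ht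
        have : r ≠ 0 := by
          rintro rfl
          rw [hrs] at ht1
          norm_num at ht1
        exact ⟨1, 1, by omega, le_rfl, hpos, by simp⟩
      exact htop' 1 hone ht1.ne (hp t ht 1 hone (Or.inr ⟨ht1, by simpa using hp1⟩))
    · by_cases hbt : b = t
      · subst hbt
        refine htop a ha ?_
        rintro rfl
        simp at hab
      · rcases hab with ⟨hab, hbt'⟩ | ⟨hab, hbt'⟩
        -- If `b` is not on the same side of the true peak `p`, then it lies between `p` and `t` and
        -- would be preferred to the top `t`.
        · by_cases hbp : (b : ℝ) ≤ p
          · exact hp a ha b hb (Or.inl ⟨hab, hbp⟩)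
          · exact absurd (hp t ht b hb (Or.inr ⟨lt_of_le_of_ne (by exact_mod_cast hbt') hbt,
              (not_le.1 hbp).le⟩)) (htop' b hb hbt)
        · by_cases hbp : p ≤ (b : ℝ)
          · exact hp a ha b hb (Or.inr ⟨hab, hbp⟩)
          · exact absurd (hp t ht b hb (Or.inl ⟨lt_of_le_of_ne (by exact_mod_cast hbt') (Ne.symm hbt),
              (not_le.1 hbp).le⟩)) (htop' b hb hbt)

theorem redRatio_toFinset (h : I.Represents G) {S : List α} (hS : S.Nodup) :
    G.redRatio S.toFinset = rat I.red S := by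
  unfold DiversityGame.redRatio rat
  have : S.toFinset ∩ G.R = (S.filter fun x => decide (x ∈ I.red)).toFinset := by
    ext x
    simp [h.mem_red]
  rw [this, List.toFinset_card_of_nodup (hS.filter _), List.toFinset_card_of_nodup hS,
    List.countP_eq_length_filter]

end GameInput.Represents

/-! ### From the list of coalitions to a stable partition -/

theorem eq_of_mem_of_nodup_flatten {P : List (List α)} (hP : P.flatten.Nodup) {S T : List α}
    (hS : S ∈ P) (hT : T ∈ P) {x : α} (hxS : x ∈ S) (hxT : x ∈ T) : S = T := by
  by_contra hne
  have : Std.Symm (List.Disjoint (α := α)) := ⟨fun _ _ h => h.symm⟩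
  exact (List.nodup_flatten.1 hP).2.forall hS hT hne hxS hxT

/-- The partition of the agents into the coalitions in a list. -/
def GameInput.Represents.partition (h : I.Represents G) (P : List (List α))
    (hP : P.flatten.Perm (I.red ++ I.blue)) (hne : [] ∉ P) : Finpartition G.agents where
  parts := (P.map List.toFinset).toFinset
  supIndep := by
    rw [Finset.supIndep_iff_pairwiseDisjoint]
    intro S hS T hT hST
    simp only [List.coe_toFinset, List.mem_map, Set.mem_ofPred_eq] at hS hT
    obtain ⟨S, hS, rfl⟩ := hS
    obtain ⟨T, hT, rfl⟩ := hT
    refine Finset.disjoint_left.2 fun x hx hx' => hST ?_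
    rw [eq_of_mem_of_nodup_flatten (hP.nodup_iff.2 h.nodup) hS hT (List.mem_toFinset.1 hx)
      (List.mem_toFinset.1 hx')]
  sup_parts := by
    ext i
    simp only [Finset.mem_sup, List.mem_toFinset, List.mem_map, id_eq, exists_exists_and_eq_and]
    rw [h.mem_agents, ← List.mem_append, ← hP.mem_iff, List.mem_flatten]
  bot_notMem := by
    simpa [List.toFinset_eq_empty_iff] using hne

theorem GameInput.Represents.individuallyStable (h : I.Represents G) {P : List (List α)}
    (hP : P.flatten.Perm (I.red ++ I.blue)) (hne : [] ∉ P)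
    (hR : StableFor I.red (fun i θ => (I.ranking i).idxOf θ) P)
    (hB : StableFor I.blue (fun i θ => (I.ranking i).idxOf (1 - θ)) P) :
    G.IndividuallyStable (h.partition P hP hne) := by
  intro i hi T' hT' hiT
  have hd := h.nodup
  have hPn := hP.nodup_iff.2 hd
  simp only [GameInput.Represents.partition, List.mem_toFinset, List.mem_map] at hT' ⊢
  obtain ⟨T, hT, rfl⟩ := hT'
  rw [List.mem_toFinset] at hiT
  have hU : ∀ S ∈ P, ∀ j ∈ S, j ∈ I.red ∨ j ∈ I.blue := fun S hS j hj =>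
    List.mem_append.1 (hP.mem_iff.1 (List.mem_flatten_of_mem hS hj))
  have hnod : ∀ S ∈ P, S.Nodup := (List.nodup_flatten.1 hPn).1
  have hΘ : ∀ S : List α, S ≠ [] → S.Nodup → (∀ j ∈ S, j ∈ I.red ∨ j ∈ I.blue) →
      rat I.red S ∈ ratioSet G.R G.B := fun S h1 h2 h3 =>
    ratios_subset_ratioSet _ _ (rat_mem_ratios h1 h2 h3 h.length_red.le h.length_blue.le)
  have hiU := hU T hT i hiT
  have hTne := List.ne_nil_of_mem hiT
  have hTΘ := hΘ T hTne (hnod T hT) (hU T hT)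
  have hstable : (I.ranking i).idxOf (rat I.red T) ≤ (I.ranking i).idxOf (rat I.red [i]) ∧
      ∀ S ∈ P, i ∉ S → Accepts I.red (fun i θ => (I.ranking i).idxOf θ) i S →
      (I.ranking i).idxOf (rat I.red T) ≤ (I.ranking i).idxOf (rat I.red (i :: S)) := by
    rcases hiU with hir | hib
    · rw [rat_eq_one (S := [i]) (by simp) (by simpa using hir)]
      exact hR T hT i hiT hir
    -- For blue agents, stability is known in terms of blue ratios and reflected ranks;
    -- complementing the ratios translates it, together with acceptance, to red ratios.
    · have h1 := hB T hT i hiT hib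
      have hcompl : ∀ S : List α, S ≠ [] → (∀ j ∈ S, j ∈ I.red ∨ j ∈ I.blue) →
          1 - rat I.blue S = rat I.red S := fun S h2 h3 => by
        rw [rat_compl hd h2 h3, sub_sub_cancel]
      rw [← hcompl T hTne (hU T hT), ← hcompl [i] (by simp) (by simpa using Or.inr hib),
        rat_eq_one (A := I.blue) (S := [i]) (by simp) (by simpa using hib)]
      refine ⟨h1.1, fun S hS hiS hacc => ?_⟩
      have hiS' : ∀ j ∈ i :: S, j ∈ I.red ∨ j ∈ I.blue := by simpa using ⟨Or.inr hib, hU S hS⟩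
      rw [← hcompl (i :: S) (by simp) hiS']
      refine h1.2 S hS hiS fun j hj => ?_
      have hne := List.ne_nil_of_mem hj
      have h2 := hacc j hj
      rw [← hcompl (i :: S) (by simp) hiS', ← hcompl S hne (hU S hS)] at h2
      exact h2.imp sub_right_injective.eq_iff.1 id
  refine ⟨?_, fun hdev => ?_⟩
  · rintro _ ⟨S, hS, rfl⟩ hST ⟨hdev, hacc⟩
    have hiS : i ∉ S := fun hiS => hST (by
      rw [eq_of_mem_of_nodup_flatten hPn hS hT hiS hiT])
    have hcn : (i :: S).Nodup := List.nodup_cons.2 ⟨hiS, hnod S hS⟩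
    have hcΘ := hΘ (i :: S) (by simp) hcn (by simpa using ⟨hiU, hU S hS⟩)
    unfold DiversityGame.StrictlyPrefers at hdev
    unfold DiversityGame.WeaklyPrefers at hacc
    rw [← List.toFinset_cons, h.redRatio_toFinset hcn] at hdev hacc
    rw [h.redRatio_toFinset (hnod T hT)] at hdev
    rw [h.redRatio_toFinset (hnod S hS)] at hacc
    have h1 := h.idxOf_lt hi hcΘ hTΘ hdev
    have h2 := hstable.2 S hS hiS fun j hj => (hacc j (List.mem_toFinset.2 hj)).imp id fun h3 =>
      h.idxOf_lt (h.mem_agents.2 (hU S hS j hj)) hcΘ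
        (hΘ S (List.ne_nil_of_mem hj) (hnod S hS) (hU S hS)) h3
    omega
  · have h0 := hdev.1
    unfold DiversityGame.StrictlyPrefers at h0
    rw [← List.toFinset_nil, ← List.toFinset_cons, h.redRatio_toFinset (List.nodup_singleton i),
      h.redRatio_toFinset (hnod T hT)] at h0
    have h1 := h.idxOf_lt hi (hΘ [i] (by simp) (by simp) (by simpa using hiU)) hTΘ h0
    have h2 := hstable.1
    omega

end Games

theorem mainTheorem1 :
    ∃ C k : ℕ, ∀ (α : Type) [DecidableEq α] (G : DiversityGame α), G.SinglePeaked →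
      -- an individually stable partition exists
      (∃ π : Finpartition G.agents, G.IndividuallyStable π) ∧
      ∀ I : GameInput α, I.Represents G →
        -- peaks can be read off the input: the top of each ranking is one
        (∀ i ∈ G.agents, ∃ t : ℚ, (I.ranking i).head? = some t ∧ G.IsPeak i (t : ℝ)) ∧
        -- whatever peaks are used and however the choices are made, the algorithm stops within
        -- polynomially many steps, with an individually stable partition as its output
        ∀ peak : α → ℚ, (∀ i ∈ G.agents, G.IsPeak i (peak i : ℝ)) →
          ∀ ρ : ℕ → ℕ, ∃ (L : List (List α)) (rest : ℕ) (π : Finpartition G.agents),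
            stablePartition I peak ρ (C * (G.agents.card + 1) ^ k) = some (L, rest) ∧
            π.parts = (L.map List.toFinset).toFinset ∧
            (∀ S ∈ L, S.Nodup) ∧ (L.map List.toFinset).Nodup ∧
            G.IndividuallyStable π := by
  have key : ∀ (α : Type) [DecidableEq α] (G : DiversityGame α) (I : GameInput α),
      I.Represents G → ∀ peak : α → ℚ, (∀ i ∈ G.agents, G.IsPeak i (peak i : ℝ)) →
      ∀ ρ : ℕ → ℕ, ∃ (L : List (List α)) (rest : ℕ) (π : Finpartition G.agents),
        stablePartition I peak ρ (4 ^ 60 * (G.agents.card + 1) ^ 60) = some (L, rest) ∧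
        π.parts = (L.map List.toFinset).toFinset ∧
        (∀ S ∈ L, S.Nodup) ∧ (L.map List.toFinset).Nodup ∧ G.IndividuallyStable π := by
    intro α _ G I h peak hp ρ
    have : Fact (4 ≤ G.agents.card + 4) := ⟨by omega⟩
    -- The bound `M ^ 60` with `M = |N| + 4 ≤ 4 * (|N| + 1)` gives the constants `C = 4 ^ 60` and `k
    -- = 60`.
    have hn : (G.agents.card + 4) ^ 60 ≤ 4 ^ 60 * (G.agents.card + 1) ^ 60 := by
      rw [← mul_pow]
      exact Nat.pow_le_pow_left (by omega) 60
    obtain ⟨L, m, hL, -, hP, hne, hR, hB⟩ := runs_stablePartition (h.side hp) (h.side_blue hp) ρ _ hn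
    have hnd := List.nodup_flatten.1 (hP.nodup_iff.2 h.nodup)
    refine ⟨L, m, h.partition L hP hne, hL, rfl, hnd.1, ?_, h.individuallyStable hP hne hR hB⟩
    refine List.pairwise_map.2 (hnd.2.imp_of_mem fun {S T} hS _ hST heq => ?_)
    obtain ⟨x, hx⟩ := List.exists_mem_of_ne_nil S fun h => hne (h ▸ hS)
    exact hST hx (List.mem_toFinset.1 (heq ▸ List.mem_toFinset.2 hx))
  refine ⟨4 ^ 60, 60, fun α _ G hG => ⟨?_, fun I h => ⟨fun i hi => h.isPeak_head hG hi, key α G I h⟩⟩⟩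
  -- Existence follows by running the algorithm on some description of the game, with the top ratios
  -- as peaks and the zero tape.
  obtain ⟨I, h⟩ := G.exists_represents
  have : ∀ i, ∃ t : ℚ, i ∈ G.agents → G.IsPeak i (t : ℝ) := fun i => by
    by_cases hi : i ∈ G.agents
    · obtain ⟨t, -, ht⟩ := h.isPeak_head hG hi
      exact ⟨t, fun _ => ht⟩
    · exact ⟨0, fun h => absurd h hi⟩
  choose peak hp using this
  obtain ⟨-, -, π, -, -, -, -, hπ⟩ := key α G I h peak hp fun _ => 0
  exact ⟨π, hπ⟩
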